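/- **Setting.** Let $f:\mathbb R^m\times\mathbb R^d\to\mathbb R^m$ be differentiable, $U_{ad}\subset\mathbb R^d$ nonempty, closed and convex, and $C:\mathbb R^m\to\mathbb R$ a polynomial of degree at most two, $\Gamma:=\|\nabla_{yy}C\|$. Let $u(y,p)$ be, for all $(y,p)$ in an open tube around the trajectory below, a locally unique minimizer of $v\mapsto p^{\sf T}f(y,v)$ over $U_{ad}$, and set $g(y,p)=f(y,u(y,p))$, $\phi(y,p)=-\nabla_yf(y,u(y,p))^{\sf T}p$. Let $(y,p)$ satisfy $$y'=g(y,p),\quad p'=\phi(y,p)\ \text{ on }[0,T^*],\qquad y(0)=y_0,\quad p(T)=\nabla C(y(T))^{\sf T},\qquad 0<T\le T^*,$$ and $y,p\in C^s[0,T^*]$. Assume that in the tube $g,\phi$ are differentiable with $\|\nabla_yg\|\le\Lambda_y$, $\|\nabla_pg\|\le\Lambda_p$, $\|\nabla_y\phi\|\le\Lambda_y^\dagger$, $\|\nabla_p\phi\|\le\Lambda_p^\dagger$. **Peer triplet.** Let $s\ge3$, $r=q=s-1$. A triplet consists of nodes $c_1,\dots,c_s\ge0$, matrices $A,B(\sigma),K,A_0,K_0,A_N,K_N\in\mathbb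 R^{s\times s}$ ($A,A_0,A_N$ nonsingular, $K$ diagonal) and $a,w\in\mathbb R^s$. Put $A_n=A$, $K_n=K$ for $1\le n<N$. On a grid $t_0=0$, $t_{n+1}=t_n+h_n$ ($0\le n\le N$), $t_{N+1}=T$, with $N\ge1$, $h_n>0$, $\sigma_n=h_n/h_{n-1}$, the discrete solution $Y_n=(Y_{ni})_i$, $P_n=(P_{ni})_i$ solves $$A_0Y_0=a\otimes y_0+h_0K_0G(Y_0,P_0),\qquad A_nY_n=B(\sigma_n)Y_{n-1}+h_nK_nG(Y_n,P_n)\quad(1\le n\le N),$$ $$A_n^{\sf T}P_n=B(\sigma_{n+1})^{\sf T}P_{n+1}-h_n\Phi(Y_n,K_n^{\sf T}P_n)\quad(0\le n<N),$$ $$A_N^{\sf T}P_N=w\otimes\nabla C\Big(\sum_jw_jY_{Nj}\Big)^{\sf T}-h_N\Phi(Y_N,K_N^{\sf T}P_N),$$ where $G(Y_n,P_n)=(g(Y_{ni},P_{ni}))_i$ and $\Phi(Y_n,Q_n)=(\phi(Y_{ni},Q_{ni}))_i$. Let $\mathbf 1=(1,\dots,1)^{\sf T}$, ${\bf c}^k=(c_i^k)_i$,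 $V_k=(\mathbf 1,{\bf c},\dots,{\bf c}^{k-1})$, $\mathcal P_k=\big(\binom{j-1}{i-1}\big)_{i,j=1}^k$, $\tilde E_k=(i\,\delta_{i+1,j})_{i,j=1}^k$, $S_k(\sigma)=\mathrm{diag}(1,\sigma,\dots,\sigma^{k-1})$. Assume for all $\sigma>0$: * standard method: $AV_r=B(\sigma)V_r\mathcal P_r^{-1}S_r(\sigma)^{-1}+KV_r\tilde E_r$, $\;A^{\sf T}V_q=B(\sigma)^{\sf T}V_qS_q(\sigma)\mathcal P_q-KV_q\tilde E_q$, $\;\mathbf 1^{\sf T}A\mathbf 1=1$; * starting method: $A_0V_r=ae_1^{\sf T}+K_0V_r\tilde E_r$, $\;A_0^{\sf T}V_q=B(\sigma)^{\sf T}V_qS_q(\sigma)\mathcal P_q-K_0^{\sf T}V_q\tilde E_q$, $\;\mathbf 1^{\sf T}A_0\mathbf 1=1$, $\;{\bf c}^{\sf T}A_0\mathbf 1=0$; * end method: $A_NV_r=B(\sigma)V_r\mathcal P_r^{-1}S_r(\sigma)^{-1}+K_NV_r\tilde E_r$, $\;w^{\sf T}V_r=\mathbf 1^{\sf T}$, $\;A_N^{\sf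 T}V_q+K_N^{\sf T}V_q\tilde E_q=w\mathbf 1^{\sf T}$; * one-leg condition: $({\bf c}^{q_b-1})^{\sf T}K_n=\mathbf 1^{\sf T}K_n\,\mathrm{diag}(c_i)^{q_b-1}$ for $n=0,N$, with some $q-1\le q_b\le2$. A column of $K_0$ or $K_N$ whose sum vanishes is assumed to be zero. For every nonzero column sum $\kappa$ of $K,K_0$ or $K_N$ the control attached to $(y,\kappa p)$ is the one attached to $(y,p)$: $u(y,\kappa p)=u(y,p)$ for $(y,p)$ in the tube. **Stability.** Let $0<\underline\sigma<1<\bar\sigma$, let $W$ be nonsingular, $W^\dagger=(AW)^{-\sf T}$. Assume that there is some $\gamma<1$ such that for all $\sigma\in[\underline\sigma,\bar\sigma]$ $$\|W^{-1}A^{-1}B(\sigma)W\|_\infty=1=\|(W^\dagger)^{-1}A^{-\sf T}B(\sigma)^{\sf T}W^\dagger\|_1,$$ $$\|W^{-1}(A^{-1}B(\sigma)-\mathbf 1\mathbf 1^{\sf T}A)W\|_\infty\le\gamma,\qquad \|(W^\dagger)^{-1}(A^{-\sf T}B(\sigma)^{\sf T}-\mathbf 1\mathbf 1^{\sf T}A^{\sf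 T})W^\dagger\|_1\le\gamma.$$ For stage vectors let $|||Y|||=\max_n\|W^{-1}Y_n\|_\infty$ and $|||P|||=\max_n\|(W^\dagger)^{-1}P_n\|_1$ (maximum, resp. sum, over the stages of the Euclidean norm in $\mathbb R^m$). Let $c^*=\max\{1,c_1,\dots,c_s\}$, $\pi_n=[t_n,t_n+h_nc^*]$ for $0\le n\le N$, $\pi_{-1}=\pi_{N+1}=\emptyset$, and $\|v^{(k:l)}\|_{[n]}=\max_{k\le j\le l}\max\{\|v^{(j)}(x)\|:x\in\pi_{n-1}\cup\pi_n\cup\pi_{n+1}\}$. Let ${\bf y}_n=(y(t_n+h_nc_i))_i$, ${\bf p}_n=(p(t_n+h_nc_i))_i$. **Super-convergence conditions.** $$D(\sigma):=\mathbf 1^{\sf T}\big(A{\bf c}^r-B(\sigma)({\bf c}-\mathbf 1)^r\sigma^{-r}-rK{\bf c}^{r-1}\big)=0,$$ $$D^\dagger(\sigma):=\mathbf 1^{\sf T}\big(A^{\sf T}{\bf c}^q-B(\sigma)^{\sf T}(\mathbf 1+\sigma{\bf c})^q+qK{\bf c}^{q-1}\big)=0.$$ **Claim.** There are positive constants $\zeta_y,\zeta_p,\zeta_y^\dagger,\zeta_p^\dagger$,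 depending only on the triplet and its stability data $W,\underline\sigma,\bar\sigma$, with the following property for all problems with $$(\zeta_y\Lambda_y+\zeta_p\Lambda_p)T\le\tfrac12,\qquad(\zeta_y^\dagger\Lambda_y^\dagger+\zeta_p^\dagger\Lambda_p^\dagger)T+\tfrac s2\Gamma\le\tfrac12 .$$ (a) Let $D(\sigma)=D^\dagger(\sigma)=0$ for all $\sigma>0$. Then there is $\mu>0$, depending only on the triplet, its stability data $W,\underline\sigma,\bar\sigma$ and $T$, such that for every such problem there are $\varepsilon,H>0$ such that on every grid as above with $\sigma_n\in[\underline\sigma,\bar\sigma]$ ($1\le n\le N$), $\bigcup_n\pi_n\subset[0,T^*]$ and $\max_nh_n\le H$ there is exactly one discrete solution with $\max\{|||Y-{\bf y}|||,|||P-{\bf p}|||\}\le\varepsilon$, and it satisfies $$\max\{|||Y-{\bf y}|||,|||P-{\bf p}|||\}\le\mu\Big(\max_nh_n^{s-1}\|y^{(s-1:s)}\|_{[n]}+\max_nh_n^{s-1}\|p^{(s-1:s)}\|_{[n]}+\delta_0h_0^{s-1}\|p^{(s-2)}\|_{[0]}+\delta_Nh_N^{s-1}\|p^{(s-2)}\|_{[N]}\Big).$$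 Here, for $n\in\{0,N\}$, $\delta_n=0$ if $({\bf c}^{k})^{\sf T}K_n=\mathbf 1^{\sf T}K_n\,\mathrm{diag}(c_i)^{k}$ for all $0\le k<s-1$ (in particular if $K_n$ is diagonal), and $\delta_n=1$ otherwise. (b) If only $D(1)=D^\dagger(1)=0$ is assumed, then the same holds on those grids that in addition satisfy $|\sigma_n-1|\le Lh_n$ for $1\le n\le N$, for any given $L>0$, with $\mu$ depending also on $L$. -/

import Mathlib

open Set Filter Topology

noncomputable section

/-- The state space `ℝ^m` with the Euclidean norm. -/
abbrev Eu (m : ℕ) : Type := EuclideanSpace ℝ (Fin m)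

/-! ### Matrices of the order conditions -/

/-- Vandermonde matrix `V_k = (1, c, …, c^{k-1})`. -/
def vdm {s : ℕ} (c : Fin s → ℝ) (k : ℕ) : Matrix (Fin s) (Fin k) ℝ :=
  Matrix.of fun i j => c i ^ (j : ℕ)

/-- Pascal matrix; with indices starting at 0 its `(i, j)` entry is `j.choose i`. -/
def pascal (k : ℕ) : Matrix (Fin k) (Fin k) ℝ :=
  Matrix.of fun i j => ((Nat.choose (j : ℕ) (i : ℕ) : ℕ) : ℝ)

/-- Nilpotent differentiation matrix `Ẽ_k`: with indices starting at 0, the entry `(i, i+1)`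
is `i + 1`, all others vanish. -/
def nilE (k : ℕ) : Matrix (Fin k) (Fin k) ℝ :=
  Matrix.of fun i j => if (j : ℕ) = (i : ℕ) + 1 then ((i : ℕ) : ℝ) + 1 else 0

/-- Scaling matrix `S_k(σ) = diag(1, σ, …, σ^{k-1})`. -/
def scaleS (k : ℕ) (σ : ℝ) : Matrix (Fin k) (Fin k) ℝ :=
  Matrix.diagonal fun i => σ ^ (i : ℕ)

/-- Maximal absolute row sum, the matrix norm `‖·‖_∞`. -/
def rowSumNorm {s : ℕ} (M : Matrix (Fin s) (Fin s) ℝ) : ℝ := ⨆ i, ∑ j, |M i j|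

/-- Maximal absolute column sum, the matrix norm `‖·‖_1`. -/
def colSumNorm {s : ℕ} (M : Matrix (Fin s) (Fin s) ℝ) : ℝ := ⨆ j, ∑ i, |M i j|

/-- The action of `M ⊗ I_m` on a stage vector. -/
def stageMul {s m : ℕ} (M : Matrix (Fin s) (Fin s) ℝ) (Y : Fin s → Eu m) : Fin s → Eu m :=
  fun i => ∑ j, M i j • Y j

/-! ### Peer triplets -/

/-- The coefficients of an `s`-stage Peer triplet with nodes `c`: standard method
`(A, B(σ), K)`, starting method `(A0, K0, a)`, end method `(AN, B(σ), KN, w)`. -/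
structure PeerTriplet (s : ℕ) where
  c : Fin s → ℝ
  A : Matrix (Fin s) (Fin s) ℝ
  B : ℝ → Matrix (Fin s) (Fin s) ℝ
  K : Matrix (Fin s) (Fin s) ℝ
  A0 : Matrix (Fin s) (Fin s) ℝ
  K0 : Matrix (Fin s) (Fin s) ℝ
  AN : Matrix (Fin s) (Fin s) ℝ
  KN : Matrix (Fin s) (Fin s) ℝ
  a : Fin s → ℝ
  w : Fin s → ℝ

/-- Linear one-leg condition with exponent `k`: `(c^k)ᵀ M = 1ᵀ M diag(c)^k`. -/
def OneLeg {s : ℕ} (c : Fin s → ℝ) (M : Matrix (Fin s) (Fin s) ℝ) (k : ℕ) : Prop :=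
  ∀ i, ∑ j, c j ^ k * M j i = (∑ j, M j i) * c i ^ k

open scoped Classical in
/-- `0` if the one-leg condition holds for all exponents `k < q` (for instance if `M` is
diagonal), and `1` otherwise. -/
def oneLegDefect {s : ℕ} (c : Fin s → ℝ) (M : Matrix (Fin s) (Fin s) ℝ) (q : ℕ) : ℝ :=
  if ∀ k < q, OneLeg c M k then 0 else 1

namespace PeerTriplet

variable {s : ℕ}

/-- `c^* = max {c_1, …, c_s, 1}`. -/
def cstar (X : PeerTriplet s) : ℝ := max 1 (⨆ i, X.c i)

/-- The matrix `A_n` used in step `n` of a grid with last index `N ≥ 1`. -/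
def An (X : PeerTriplet s) (N n : ℕ) : Matrix (Fin s) (Fin s) ℝ :=
  if n = 0 then X.A0 else if n = N then X.AN else X.A

/-- The matrix `K_n` used in step `n` of a grid with last index `N ≥ 1`. -/
def Kn (X : PeerTriplet s) (N n : ℕ) : Matrix (Fin s) (Fin s) ℝ :=
  if n = 0 then X.K0 else if n = N then X.KN else X.K

/-- Standing structural properties: nonnegative nodes, nonsingular `A_n`, diagonal `K`, and the
column sums of `K_0`, `K_N` vanish for zero columns only. -/
def Structural (X : PeerTriplet s) : Prop :=
  (∀ i, 0 ≤ X.c i) ∧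
  IsUnit X.A.det ∧ IsUnit X.A0.det ∧ IsUnit X.AN.det ∧
  X.K.IsDiag ∧
  (∀ i, ∑ j, X.K0 j i = 0 → ∀ j, X.K0 j i = 0) ∧
  (∀ i, ∑ j, X.KN j i = 0 → ∀ j, X.KN j i = 0)

/-- Order conditions of the standard method, uniformly in the stepsize ratio: local order `r`
forward and local order `q` for the adjoint step, with the normalization `1ᵀ A 1 = 1`. -/
def StandardOrder (X : PeerTriplet s) (r q : ℕ) : Prop :=
  (∀ σ : ℝ, 0 < σ →
    X.A * vdm X.c r =
      X.B σ * vdm X.c r * (pascal r)⁻¹ * (scaleS r σ)⁻¹ + X.K * vdm X.c r * nilE r) ∧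
  (∀ σ : ℝ, 0 < σ →
    X.A.transpose * vdm X.c q =
      (X.B σ).transpose * vdm X.c q * scaleS q σ * pascal q
        - X.K.transpose * vdm X.c q * nilE q) ∧
  ∑ i, ∑ j, X.A i j = 1

/-- Order conditions of the starting method, with one-leg order `qb`. -/
def StartOrder (X : PeerTriplet s) (r q qb : ℕ) : Prop :=
  X.A0 * vdm X.c r =
    Matrix.of (fun i (j : Fin r) => if (j : ℕ) = 0 then X.a i else 0)
      + X.K0 * vdm X.c r * nilE r ∧
  (∀ σ : ℝ, 0 < σ →
    X.A0.transpose * vdm X.c q =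
      (X.B σ).transpose * vdm X.c q * scaleS q σ * pascal q
        - X.K0.transpose * vdm X.c q * nilE q) ∧
  ∑ i, ∑ j, X.A0 i j = 1 ∧
  ∑ i, ∑ j, X.c i * X.A0 i j = 0 ∧
  OneLeg X.c X.K0 (qb - 1)

/-- Order conditions of the end method, with one-leg order `qb`. -/
def EndOrder (X : PeerTriplet s) (r q qb : ℕ) : Prop :=
  (∀ σ : ℝ, 0 < σ →
    X.AN * vdm X.c r =
      X.B σ * vdm X.c r * (pascal r)⁻¹ * (scaleS r σ)⁻¹ + X.KN * vdm X.c r * nilE r) ∧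
  (∀ j : Fin r, ∑ i, X.w i * X.c i ^ (j : ℕ) = 1) ∧
  X.AN.transpose * vdm X.c q + X.KN.transpose * vdm X.c q * nilE q =
    Matrix.of (fun i (_ : Fin q) => X.w i) ∧
  OneLeg X.c X.KN (qb - 1)

/-- Forward stability matrix `B̄(σ) = A⁻¹ B(σ)`. -/
def Bbar (X : PeerTriplet s) (σ : ℝ) : Matrix (Fin s) (Fin s) ℝ := X.A⁻¹ * X.B σ

/-- Adjoint stability matrix `B̃(σ)ᵀ = A⁻ᵀ B(σ)ᵀ`. -/
def BtildeT (X : PeerTriplet s) (σ : ℝ) : Matrix (Fin s) (Fin s) ℝ :=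
  X.A⁻¹.transpose * (X.B σ).transpose

/-- The rank-one matrix `B̄^∞ = 1 1ᵀ A`. -/
def Binf (X : PeerTriplet s) : Matrix (Fin s) (Fin s) ℝ :=
  Matrix.of (fun _ _ => (1 : ℝ)) * X.A

/-- The rank-one matrix `(B̃^∞)ᵀ = 1 1ᵀ Aᵀ`. -/
def BinfT (X : PeerTriplet s) : Matrix (Fin s) (Fin s) ℝ :=
  Matrix.of (fun _ _ => (1 : ℝ)) * X.A.transpose

/-- The weight `W^† = (A W)^{-T}` of the adjoint norm. -/
def Wdag (X : PeerTriplet s) (W : Matrix (Fin s) (Fin s) ℝ) : Matrix (Fin s) (Fin s) ℝ :=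
  (X.A * W)⁻¹.transpose

/-- Uniform zero-stability in the norms with weights `W`, `W^†` for ratios in `[σlo, σhi]`. -/
def UniformlyZeroStable (X : PeerTriplet s) (W : Matrix (Fin s) (Fin s) ℝ) (σlo σhi : ℝ) : Prop :=
  IsUnit W.det ∧ ∀ σ ∈ Icc σlo σhi,
    rowSumNorm (W⁻¹ * X.Bbar σ * W) = 1 ∧
    colSumNorm ((X.Wdag W)⁻¹ * X.BtildeT σ * X.Wdag W) = 1

/-- The non-dominant part of the stability matrices is a contraction with factor `γ`, uniformly
for ratios in `[σlo, σhi]`. -/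
def UniformlyDamped (X : PeerTriplet s) (W : Matrix (Fin s) (Fin s) ℝ) (σlo σhi γ : ℝ) : Prop :=
  ∀ σ ∈ Icc σlo σhi,
    rowSumNorm (W⁻¹ * (X.Bbar σ - X.Binf) * W) ≤ γ ∧
    colSumNorm ((X.Wdag W)⁻¹ * (X.BtildeT σ - X.BinfT) * X.Wdag W) ≤ γ

/-- Super-convergence residual of the forward scheme,
`1ᵀ (A c^r - B(σ) (c - 1)^r σ^{-r} - r K c^{r-1})`. -/
def supState (X : PeerTriplet s) (r : ℕ) (σ : ℝ) : ℝ :=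
  ∑ i, ∑ j, (X.A i j * X.c j ^ r - X.B σ i j * (X.c j - 1) ^ r * (σ ^ r)⁻¹
    - r * X.K i j * X.c j ^ (r - 1))

/-- Super-convergence residual of the adjoint scheme,
`1ᵀ (Aᵀ c^q - B(σ)ᵀ (1 + σ c)^q + q K c^{q-1})`. -/
def supAdjoint (X : PeerTriplet s) (q : ℕ) (σ : ℝ) : ℝ :=
  ∑ i, ∑ j, (X.A j i * X.c j ^ q - X.B σ j i * (1 + σ * X.c j) ^ q
    + q * X.K i j * X.c j ^ (q - 1))

end PeerTriplet

/-! ### The optimal control problem and its reduced boundary value problem -/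

/-- Data of the problem: minimize `C (y T)` subject to `y' = f(y, u)`, `u ∈ U_ad`, `y(0) = y0`. -/
structure ControlProblem (m d : ℕ) where
  f : Eu m → Eu d → Eu m
  C : Eu m → ℝ
  Uad : Set (Eu d)
  y0 : Eu m

namespace ControlProblem

variable {m d : ℕ}

/-- `f` is differentiable, `U_ad` is nonempty, closed and convex, and `C` is a polynomial of
degree at most two. -/
def Regular (Q : ControlProblem m d) : Prop :=
  Differentiable ℝ (fun z : Eu m × Eu d => Q.f z.1 z.2) ∧
  Q.Uad.Nonempty ∧ IsClosed Q.Uad ∧ Convex ℝ Q.Uad ∧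
  ∃ (c₀ : ℝ) (b : Eu m) (M : Eu m →L[ℝ] Eu m),
    ∀ x, Q.C x = c₀ + inner ℝ b x + inner ℝ x (M x)

/-- The Hamiltonian `H(y, u, p) = pᵀ f(y, u)`. -/
def hamiltonian (Q : ControlProblem m d) (y : Eu m) (v : Eu d) (p : Eu m) : ℝ :=
  inner ℝ p (Q.f y v)

/-- `g(y, p) = f(y, u(y, p))`. -/
def g (Q : ControlProblem m d) (u : Eu m → Eu m → Eu d) (y p : Eu m) : Eu m :=
  Q.f y (u y p)

/-- `φ(y, p) = -∇_y f(y, u(y, p))ᵀ p`, the derivative being taken with the control frozen. -/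
def phi (Q : ControlProblem m d) (u : Eu m → Eu m → Eu d) (y p : Eu m) : Eu m :=
  -(ContinuousLinearMap.adjoint (fderiv ℝ (fun x => Q.f x (u y p)) y) p)

/-- `Γ = ‖∇_{yy} C‖` (the Hessian of a polynomial of degree at most two is constant). -/
def Gam (Q : ControlProblem m d) : ℝ := ‖fderiv ℝ (gradient Q.C) 0‖

/-- `(y, p)` solves the reduced boundary value problem with final time `T`; the differential
equations hold on `[0, Tstar]`, `Tstar ≥ T`. -/
def IsExactSolution (Q : ControlProblem m d) (u : Eu m → Eu m → Eu d)
    (y p : ℝ → Eu m) (T Tstar : ℝ) : Prop :=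
  T ≤ Tstar ∧ y 0 = Q.y0 ∧ p T = gradient Q.C (y T) ∧
  ∀ t ∈ Icc 0 Tstar,
    HasDerivWithinAt y (Q.g u (y t) (p t)) (Icc 0 Tstar) t ∧
    HasDerivWithinAt p (Q.phi u (y t) (p t)) (Icc 0 Tstar) t

/-- The open tube of radius `ρ` around the trajectory `(y, p)` on `[0, Tstar]`. -/
def tube (y p : ℝ → Eu m) (Tstar ρ : ℝ) : Set (Eu m × Eu m) :=
  {z | ∃ t ∈ Icc 0 Tstar, ‖z.1 - y t‖ < ρ ∧ ‖z.2 - p t‖ < ρ}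

/-- Control uniqueness on a set `S` of pairs `(y, p)`: `u(y, p)` is a locally unique minimizer of
the Hamiltonian over `U_ad`. -/
def ControlUniqueness (Q : ControlProblem m d) (u : Eu m → Eu m → Eu d)
    (S : Set (Eu m × Eu m)) : Prop :=
  ∀ z ∈ S, u z.1 z.2 ∈ Q.Uad ∧
    ∀ᶠ v in 𝓝 (u z.1 z.2), v ∈ Q.Uad → v ≠ u z.1 z.2 →
      Q.hamiltonian z.1 (u z.1 z.2) z.2 < Q.hamiltonian z.1 v z.2

/-- The scheme evaluates `φ` at multiples `κ p` of multipliers, `κ` being a column sum of one of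
the matrices `K_n` (the diagonal entries, if `K_n` is diagonal); the control belonging to such a
multiple, `κ ≠ 0`, is the one belonging to `p`. -/
def ControlScaling {s : ℕ} (X : PeerTriplet s) (u : Eu m → Eu m → Eu d)
    (S : Set (Eu m × Eu m)) : Prop :=
  ∀ z ∈ S, ∀ M ∈ ({X.K, X.K0, X.KN} : Set (Matrix (Fin s) (Fin s) ℝ)), ∀ i,
    ∑ j, M j i ≠ 0 → u z.1 ((∑ j, M j i) • z.2) = u z.1 z.2

/-- `g` and `φ` are differentiable on `S`, and their partial derivatives are bounded there by
`Λy, Λp` and `Λy', Λp'`. -/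
def DerivativeBounds (Q : ControlProblem m d) (u : Eu m → Eu m → Eu d)
    (S : Set (Eu m × Eu m)) (Λy Λp Λy' Λp' : ℝ) : Prop :=
  DifferentiableOn ℝ (fun z : Eu m × Eu m => Q.g u z.1 z.2) S ∧
  DifferentiableOn ℝ (fun z : Eu m × Eu m => Q.phi u z.1 z.2) S ∧
  ∀ z ∈ S,
    ‖fderiv ℝ (fun x => Q.g u x z.2) z.1‖ ≤ Λy ∧
    ‖fderiv ℝ (fun x => Q.g u z.1 x) z.2‖ ≤ Λp ∧
    ‖fderiv ℝ (fun x => Q.phi u x z.2) z.1‖ ≤ Λy' ∧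
    ‖fderiv ℝ (fun x => Q.phi u z.1 x) z.2‖ ≤ Λp'

end ControlProblem

/-! ### Grids -/

/-- A time grid with steps `t_n → t_n + h_n`, `0 ≤ n ≤ N` (values `h n` for `n > N` play no
role). -/
structure Grid where
  N : ℕ
  h : ℕ → ℝ

namespace Grid

/-- `t_n`. -/
def t (G : Grid) (n : ℕ) : ℝ := ∑ k ∈ Finset.range n, G.h k

/-- The stepsize ratio `σ_n = h_n / h_{n-1}`, `n ≥ 1`. -/
def ratio (G : Grid) (n : ℕ) : ℝ := G.h n / G.h (n - 1)

/-- The interval `π_n = [t_n, t_n + h_n c^*]`. -/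
def cell (G : Grid) (cst : ℝ) (n : ℕ) : Set ℝ := Icc (G.t n) (G.t n + G.h n * cst)

/-- `π_{n-1} ∪ π_n ∪ π_{n+1}`, where only the cells `π_0, …, π_N` are taken into account. -/
def window (G : Grid) (cst : ℝ) (n : ℕ) : Set ℝ :=
  {x | ∃ k ≤ G.N, n ≤ k + 1 ∧ k ≤ n + 1 ∧ x ∈ G.cell cst k}

/-- A grid of `[0, T]` with all cells in `[0, Tstar]`, stepsize ratios in `[σlo, σhi]` and
largest stepsize at most `H`. -/
def Admissible (G : Grid) (cst T Tstar σlo σhi H : ℝ) : Prop :=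
  1 ≤ G.N ∧ (∀ n ≤ G.N, 0 < G.h n) ∧ G.t (G.N + 1) = T ∧
  (∀ n ≤ G.N, G.t n + G.h n * cst ≤ Tstar) ∧
  (∀ n, 1 ≤ n → n ≤ G.N → G.ratio n ∈ Icc σlo σhi) ∧
  (∀ n ≤ G.N, G.h n ≤ H)

/-- Smooth grids: `|σ_n - 1| ≤ L h_n` for `1 ≤ n ≤ N`. -/
def Smooth (L : ℝ) (G : Grid) : Prop :=
  ∀ n, 1 ≤ n → n ≤ G.N → |G.ratio n - 1| ≤ L * G.h n

/-- Maximum over the grid indices `0 ≤ n ≤ N`. -/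
def maxOver (G : Grid) (F : ℕ → ℝ) : ℝ :=
  (Finset.range (G.N + 1)).sup' Finset.nonempty_range_add_one F

/-- The localized seminorm `‖v^{(r₁:r₂)}‖_{[n]}`, the maximum of `‖v^{(k)}(x)‖` over
`r₁ ≤ k ≤ r₂` and `x` in the window of `n`, for a function `v` on `[0, Tstar]`. -/
def semi {m : ℕ} (G : Grid) (cst Tstar : ℝ) (v : ℝ → Eu m) (r₁ r₂ n : ℕ) : ℝ :=
  sSup {x | ∃ k, r₁ ≤ k ∧ k ≤ r₂ ∧ ∃ τ ∈ G.window cst n,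
    x = ‖iteratedDerivWithin k v (Icc 0 Tstar) τ‖}

end Grid

/-! ### The discrete boundary value problem and its error -/

namespace PeerTriplet

variable {s m d : ℕ}

/-- The stage vector of the exact values `v (t_n + h_n c_i)`. -/
def exact (X : PeerTriplet s) (G : Grid) (v : ℝ → Eu m) (n : ℕ) : Fin s → Eu m :=
  fun i => v (G.t n + G.h n * X.c i)

/-- `(Y_n, P_n)`, `0 ≤ n ≤ N`, solves the discrete boundary value problem of the triplet with
eliminated controls. -/
def IsDiscreteSolution (X : PeerTriplet s) (Q : ControlProblem m d) (u : Eu m → Eu m → Eu d)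
    (G : Grid) (Y P : ℕ → Fin s → Eu m) : Prop :=
  stageMul X.A0 (Y 0) =
    (fun i => X.a i • Q.y0) + G.h 0 • stageMul X.K0 (fun i => Q.g u (Y 0 i) (P 0 i)) ∧
  (∀ n, 1 ≤ n → n ≤ G.N →
    stageMul (X.An G.N n) (Y n) =
      stageMul (X.B (G.ratio n)) (Y (n - 1))
        + G.h n • stageMul (X.Kn G.N n) (fun i => Q.g u (Y n i) (P n i))) ∧
  (∀ n < G.N,
    stageMul (X.An G.N n).transpose (P n) =
      stageMul (X.B (G.ratio (n + 1))).transpose (P (n + 1))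
        - G.h n • fun i => Q.phi u (Y n i) (stageMul (X.Kn G.N n).transpose (P n) i)) ∧
  stageMul X.AN.transpose (P G.N) =
    (fun i => X.w i • gradient Q.C (∑ j, X.w j • Y G.N j))
      - G.h G.N • fun i => Q.phi u (Y G.N i) (stageMul X.KN.transpose (P G.N) i)

/-- `|||Y - y|||`: maximum over the grid of the `W`-weighted maximum norm of the stage errors. -/
def errY (X : PeerTriplet s) (W : Matrix (Fin s) (Fin s) ℝ) (G : Grid)
    (Y : ℕ → Fin s → Eu m) (y : ℝ → Eu m) : ℝ :=
  G.maxOver fun n => ‖stageMul W⁻¹ (Y n - X.exact G y n)‖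

/-- `|||P - p|||`: maximum over the grid of the `W^†`-weighted sum norm of the stage errors. -/
def errP (X : PeerTriplet s) (W : Matrix (Fin s) (Fin s) ℝ) (G : Grid)
    (P : ℕ → Fin s → Eu m) (p : ℝ → Eu m) : ℝ :=
  G.maxOver fun n => ∑ i, ‖stageMul (X.Wdag W)⁻¹ (P n - X.exact G p n) i‖

/-- The localized quantity of order `s - 1` in the error bound. The last two terms, from the two
boundary steps, are absent if `K_0`, `K_N` satisfy the one-leg condition for all exponents below
`s - 1`, in particular if they are diagonal. -/
def localBound (X : PeerTriplet s) (G : Grid) (y p : ℝ → Eu m) (Tstar : ℝ) : ℝ :=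
  G.maxOver (fun n => G.h n ^ (s - 1) * G.semi X.cstar Tstar y (s - 1) s n)
    + G.maxOver (fun n => G.h n ^ (s - 1) * G.semi X.cstar Tstar p (s - 1) s n)
    + oneLegDefect X.c X.K0 (s - 1) *
        (G.h 0 ^ (s - 1) * G.semi X.cstar Tstar p (s - 2) (s - 2) 0)
    + oneLegDefect X.c X.KN (s - 1) *
        (G.h G.N ^ (s - 1) * G.semi X.cstar Tstar p (s - 2) (s - 2) G.N)

/-- Super-convergence with constant `μ` and final time `T` on the grids of the class `cls`, for
all problems that satisfy the smallness conditions with the constants `ζ`: on all sufficiently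
fine grids there is exactly one discrete solution in a fixed neighbourhood of the exact one, and
its errors are bounded by `μ` times the localized quantity of order `s - 1`. -/
def SuperConvergent (X : PeerTriplet s) (W : Matrix (Fin s) (Fin s) ℝ) (σlo σhi : ℝ)
    (ζy ζp ζy' ζp' T μ : ℝ) (cls : Grid → Prop) : Prop :=
  ∀ (m d : ℕ) (Q : ControlProblem m d) (u : Eu m → Eu m → Eu d) (y p : ℝ → Eu m)
    (Tstar ρ Λy Λp Λy' Λp' : ℝ),
    Q.Regular → 0 < ρ →
    Q.IsExactSolution u y p T Tstar →
    ContDiffOn ℝ s y (Icc 0 Tstar) → ContDiffOn ℝ s p (Icc 0 Tstar) →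
    Q.ControlUniqueness u (ControlProblem.tube y p Tstar ρ) →
    ControlProblem.ControlScaling X u (ControlProblem.tube y p Tstar ρ) →
    Q.DerivativeBounds u (ControlProblem.tube y p Tstar ρ) Λy Λp Λy' Λp' →
    (ζy * Λy + ζp * Λp) * T ≤ 1 / 2 →
    (ζy' * Λy' + ζp' * Λp') * T + (s : ℝ) / 2 * Q.Gam ≤ 1 / 2 →
    ∃ ε > 0, ∃ H > 0, ∀ G : Grid, G.Admissible X.cstar T Tstar σlo σhi H → cls G →
      ∃ Y P : ℕ → Fin s → Eu m,
        X.IsDiscreteSolution Q u G Y P ∧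
        max (X.errY W G Y y) (X.errP W G P p) ≤ ε ∧
        (∀ Y' P' : ℕ → Fin s → Eu m, X.IsDiscreteSolution Q u G Y' P' →
          max (X.errY W G Y' y) (X.errP W G P' p) ≤ ε →
          ∀ n ≤ G.N, Y' n = Y n ∧ P' n = P n) ∧
        max (X.errY W G Y y) (X.errP W G P p) ≤ μ * X.localBound G y p Tstar

end PeerTriplet

end

/-!
The scheme is a pair of fixed point equations: `stateMap` solves the forward recursion with given
right-hand sides `G`, and `backMap` solves the adjoint recursion backward in time. The theorem holds
because these maps are contractions near the exact solution, and because the exact solution nearly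
is a fixed point.

*Stability.* Written in the coordinates of `W` and `W†`, the recursion matrices `A⁻¹ B(σ)` and
`A⁻ᵀ B(σ)ᵀ` have norm one, and they contract, with factor `γ`, everything that is annihilated by the
left eigenvector `𝟏ᵀA` or `𝟏ᵀAᵀ`. The preconsistency relations `𝟏ᵀB(σ) = 𝟏ᵀA` and `B(σ)𝟏 = A𝟏`,
contained in the order conditions, make this splitting invariant under the recursion for every `σ`.
Hence general perturbations of size `h^(r+1)` or `h Λ` sum to `T · max h^r` or `T Λ`, whereas
perturbations whose stages add up to zero are damped geometrically and enter only through their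
maximum (`recursion_bound`, used in `forward_stable` and `backward_stable`). The boundary steps
enter once.

*Residuals.* By the order conditions and Taylor expansion, the defect of the exact solution in a
standard step is of size `h^r`, `r = s - 1`. The leading terms at the stages are multiples of one
derivative, with coefficients that add up to `D(σ)` or `D†(σ)`, up to a factor. If these vanish, the
leading term is damped and the rest, of size `h^(r+1)`, sums to `O(h^r)`. If only
`D(1) = D†(1) = 0`, then `D` and `D†`, which are polynomials in `σ` and `1 / σ` by the
preconsistency relations, are Lipschitz continuous near `σ = 1`, and they are `O(h)` on smooth
grids (`stateMap_exact_sub_le`, `backMap_exact_sub_le`).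

*Multipliers.* In the adjoint steps `φ` is evaluated at the combinations `Kₙᵀ Pₙ`. The control is
invariant under scaling by a column sum and `φ(y, ·)` is linear for fixed control, so
`φ(y, k p) = k φ(y, p)` for such `k`, and after normalization the arguments stay in the tube. For
diagonal `K` no further error arises; the boundary steps contribute an error that the one-leg
condition reduces to the order `r`, with a term in `p^(s-2)` if the condition stops one order short.

*Contraction.* The state equation is Lipschitz with a constant proportional to `T (Λ_y + Λ_p)`. The
adjoint equation has in addition the dependence of the end condition on `Y`, with constant
`c Γ ≤ c`, which is bounded but not small. In the norm `max (|||Y|||) (|||P||| / (4 c))` the map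
still contracts by the factor `1 / 2`, as soon as `4 c² (Λ_y + Λ_p) T ≤ 1 / 2` and likewise for the
adjoint constants (`superConvergent_of_residual_le`). The fixed point theorem on a small ball gives
existence, uniqueness, and the error bound by twice the residual.
-/

/-! ### Matrices acting on stage vectors -/

section StageMul

variable {s m : ℕ}

/-- `stageMul M` as a linear map. -/
def stageLin (M : Matrix (Fin s) (Fin s) ℝ) : (Fin s → Eu m) →ₗ[ℝ] (Fin s → Eu m) where
  toFun := stageMul M
  map_add' Y Z := by
    funext i; simp [stageMul, smul_add, Finset.sum_add_distrib]
  map_smul' a Y := by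
    funext i; simp [stageMul, Finset.smul_sum, smul_comm a]

@[simp] lemma stageLin_apply (M : Matrix (Fin s) (Fin s) ℝ) (Y : Fin s → Eu m) :
    stageLin M Y = stageMul M Y := rfl

lemma stageMul_add (M : Matrix (Fin s) (Fin s) ℝ) (Y Z : Fin s → Eu m) :
    stageMul M (Y + Z) = stageMul M Y + stageMul M Z := (stageLin M).map_add Y Z

lemma stageMul_sub (M : Matrix (Fin s) (Fin s) ℝ) (Y Z : Fin s → Eu m) :
    stageMul M (Y - Z) = stageMul M Y - stageMul M Z := (stageLin M).map_sub Y Z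

lemma stageMul_smul (M : Matrix (Fin s) (Fin s) ℝ) (a : ℝ) (Y : Fin s → Eu m) :
    stageMul M (a • Y) = a • stageMul M Y := (stageLin M).map_smul a Y

lemma stageMul_mul (M L : Matrix (Fin s) (Fin s) ℝ) (Y : Fin s → Eu m) :
    stageMul (M * L) Y = stageMul M (stageMul L Y) := by
  funext i
  simp only [stageMul, Matrix.mul_apply, Finset.sum_smul, Finset.smul_sum, mul_smul]
  exact Finset.sum_comm

lemma stageMul_one (Y : Fin s → Eu m) : stageMul 1 Y = Y := by
  funext i; simp [stageMul, Matrix.one_apply]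

lemma sub_stageMul (M L : Matrix (Fin s) (Fin s) ℝ) (Y : Fin s → Eu m) :
    stageMul (M - L) Y = stageMul M Y - stageMul L Y := by
  funext i; simp [stageMul, sub_smul, Finset.sum_sub_distrib]

lemma stageMul_inv_cancel {M : Matrix (Fin s) (Fin s) ℝ} (hM : IsUnit M.det)
    (Y : Fin s → Eu m) : stageMul M⁻¹ (stageMul M Y) = Y := by
  rw [← stageMul_mul, Matrix.nonsing_inv_mul _ hM, stageMul_one]

lemma stageMul_cancel_inv {M : Matrix (Fin s) (Fin s) ℝ} (hM : IsUnit M.det)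
    (Y : Fin s → Eu m) : stageMul M (stageMul M⁻¹ Y) = Y := by
  rw [← stageMul_mul, Matrix.mul_nonsing_inv _ hM, stageMul_one]

lemma stageMul_eq_iff {M : Matrix (Fin s) (Fin s) ℝ} (hM : IsUnit M.det)
    (Y Z : Fin s → Eu m) : stageMul M Y = Z ↔ Y = stageMul M⁻¹ Z :=
  ⟨fun h => by rw [← h, stageMul_inv_cancel hM], fun h => by rw [h, stageMul_cancel_inv hM]⟩

lemma norm_stageMul_apply_le (M : Matrix (Fin s) (Fin s) ℝ) (Y : Fin s → Eu m) (i : Fin s) :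
    ‖stageMul M Y i‖ ≤ ∑ j, |M i j| * ‖Y j‖ :=
  (norm_sum_le _ _).trans (Finset.sum_le_sum fun j _ => by rw [norm_smul, Real.norm_eq_abs])

lemma sum_abs_le_rowSumNorm (M : Matrix (Fin s) (Fin s) ℝ) (i : Fin s) :
    ∑ j, |M i j| ≤ rowSumNorm M :=
  le_ciSup (f := fun i => ∑ j, |M i j|) (Set.finite_range _).bddAbove i

lemma sum_abs_le_colSumNorm (M : Matrix (Fin s) (Fin s) ℝ) (j : Fin s) :
    ∑ i, |M i j| ≤ colSumNorm M :=
  le_ciSup (f := fun j => ∑ i, |M i j|) (Set.finite_range _).bddAbove j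

lemma rowSumNorm_nonneg (M : Matrix (Fin s) (Fin s) ℝ) : 0 ≤ rowSumNorm M :=
  Real.iSup_nonneg fun _ => Finset.sum_nonneg fun _ _ => abs_nonneg _

lemma norm_stageMul_le (M : Matrix (Fin s) (Fin s) ℝ) (Y : Fin s → Eu m) :
    ‖stageMul M Y‖ ≤ rowSumNorm M * ‖Y‖ := by
  refine (pi_norm_le_iff_of_nonneg (mul_nonneg (rowSumNorm_nonneg M) (norm_nonneg _))).2 fun i => ?_
  calc ‖stageMul M Y i‖ ≤ ∑ j, |M i j| * ‖Y j‖ := norm_stageMul_apply_le M Y i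
    _ ≤ ∑ j, |M i j| * ‖Y‖ := Finset.sum_le_sum fun j _ =>
        mul_le_mul_of_nonneg_left (norm_le_pi_norm Y j) (abs_nonneg _)
    _ = (∑ j, |M i j|) * ‖Y‖ := by rw [Finset.sum_mul]
    _ ≤ _ := mul_le_mul_of_nonneg_right (sum_abs_le_rowSumNorm M i) (norm_nonneg _)

lemma norm_stageMul_le_of_entries {κ : ℝ} (M : Matrix (Fin s) (Fin s) ℝ)
    (hM : ∀ i j, |M i j| ≤ κ) (Y : Fin s → Eu m) (i : Fin s) :
    ‖stageMul M Y i‖ ≤ s * κ * ‖Y‖ := by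
  refine (norm_stageMul_apply_le M Y i).trans ?_
  calc ∑ j, |M i j| * ‖Y j‖ ≤ ∑ _j : Fin s, κ * ‖Y‖ := Finset.sum_le_sum fun j _ =>
        mul_le_mul (hM i j) (norm_le_pi_norm Y j) (norm_nonneg _) ((abs_nonneg _).trans (hM i j))
    _ = s * κ * ‖Y‖ := by simp [mul_assoc]

lemma sum_norm_stageMul_le (M : Matrix (Fin s) (Fin s) ℝ) (Y : Fin s → Eu m) :
    ∑ i, ‖stageMul M Y i‖ ≤ colSumNorm M * ∑ i, ‖Y i‖ := by
  calc ∑ i, ‖stageMul M Y i‖ ≤ ∑ i, ∑ j, |M i j| * ‖Y j‖ :=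
        Finset.sum_le_sum fun i _ => norm_stageMul_apply_le M Y i
    _ = ∑ j, (∑ i, |M i j|) * ‖Y j‖ := by rw [Finset.sum_comm]; simp [Finset.sum_mul]
    _ ≤ ∑ j, colSumNorm M * ‖Y j‖ := Finset.sum_le_sum fun j _ =>
        mul_le_mul_of_nonneg_right (sum_abs_le_colSumNorm M j) (norm_nonneg _)
    _ = _ := by rw [Finset.mul_sum]

/-- The maximum norm over the stages with weight `D`, that is `‖D Y‖_∞`. -/
noncomputable def maxSeminorm (D : Matrix (Fin s) (Fin s) ℝ) : Seminorm ℝ (Fin s → Eu m) :=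
  (normSeminorm ℝ (Fin s → Eu m)).comp (stageLin D)

lemma maxSeminorm_apply (D : Matrix (Fin s) (Fin s) ℝ) (Y : Fin s → Eu m) :
    maxSeminorm D Y = ‖stageMul D Y‖ := rfl

/-- The sum norm over the stages with weight `D`, that is `‖D P‖_1`. -/
noncomputable def sumSeminorm (D : Matrix (Fin s) (Fin s) ℝ) : Seminorm ℝ (Fin s → Eu m) :=
  Seminorm.of (fun P => ∑ i, ‖stageMul D P i‖)
    (fun P Q => by
      rw [← Finset.sum_add_distrib, stageMul_add]
      exact Finset.sum_le_sum fun i _ => norm_add_le _ _)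
    (fun a P => by simp [stageMul_smul, norm_smul, Finset.mul_sum])

lemma sumSeminorm_apply (D : Matrix (Fin s) (Fin s) ℝ) (P : Fin s → Eu m) :
    sumSeminorm D P = ∑ i, ‖stageMul D P i‖ := rfl

/-- A bound on the conjugated matrix `D M D⁻¹` bounds the action of `M` in the `D`-weighted
maximum norm. -/
lemma maxSeminorm_stageMul_le {D M : Matrix (Fin s) (Fin s) ℝ} (hD : IsUnit D.det) {k : ℝ}
    (h : rowSumNorm (D * M * D⁻¹) ≤ k) (Y : Fin s → Eu m) :
    maxSeminorm D (stageMul M Y) ≤ k * maxSeminorm D Y := by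
  have e : stageMul D (stageMul M Y) = stageMul (D * M * D⁻¹) (stageMul D Y) := by
    rw [stageMul_mul, stageMul_inv_cancel hD, stageMul_mul]
  rw [maxSeminorm_apply, maxSeminorm_apply, e]
  exact (norm_stageMul_le _ _).trans (mul_le_mul_of_nonneg_right h (norm_nonneg _))

lemma sumSeminorm_stageMul_le {D M : Matrix (Fin s) (Fin s) ℝ} (hD : IsUnit D.det) {k : ℝ}
    (h : colSumNorm (D * M * D⁻¹) ≤ k) (Y : Fin s → Eu m) :
    sumSeminorm D (stageMul M Y) ≤ k * sumSeminorm D Y := by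
  have e : stageMul D (stageMul M Y) = stageMul (D * M * D⁻¹) (stageMul D Y) := by
    rw [stageMul_mul, stageMul_inv_cancel hD, stageMul_mul]
  rw [sumSeminorm_apply, sumSeminorm_apply, e]
  exact (sum_norm_stageMul_le _ _).trans
    (mul_le_mul_of_nonneg_right h (Finset.sum_nonneg fun _ _ => norm_nonneg _))

lemma maxSeminorm_le (D : Matrix (Fin s) (Fin s) ℝ) (Y : Fin s → Eu m) :
    maxSeminorm D Y ≤ rowSumNorm D * ‖Y‖ := norm_stageMul_le D Y

lemma norm_le_maxSeminorm {D : Matrix (Fin s) (Fin s) ℝ} (hD : IsUnit D.det) (Y : Fin s → Eu m) :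
    ‖Y‖ ≤ rowSumNorm D⁻¹ * maxSeminorm D Y := by
  conv_lhs => rw [← stageMul_inv_cancel hD Y]
  exact norm_stageMul_le _ _

lemma maxSeminorm_le_sumSeminorm (D : Matrix (Fin s) (Fin s) ℝ) (Y : Fin s → Eu m) :
    maxSeminorm D Y ≤ sumSeminorm D Y :=
  (pi_norm_le_iff_of_nonneg (apply_nonneg _ _)).2 fun i =>
    Finset.single_le_sum (f := fun i => ‖stageMul D Y i‖) (fun _ _ => norm_nonneg _)
      (Finset.mem_univ i)

lemma sumSeminorm_le (D : Matrix (Fin s) (Fin s) ℝ) (Y : Fin s → Eu m) :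
    sumSeminorm D Y ≤ s * rowSumNorm D * ‖Y‖ := by
  calc sumSeminorm D Y ≤ ∑ _i : Fin s, rowSumNorm D * ‖Y‖ := by
        rw [sumSeminorm_apply]
        exact Finset.sum_le_sum fun i _ => (norm_le_pi_norm _ i).trans (norm_stageMul_le D Y)
    _ = _ := by simp [mul_assoc]

lemma norm_le_sumSeminorm {D : Matrix (Fin s) (Fin s) ℝ} (hD : IsUnit D.det) (Y : Fin s → Eu m) :
    ‖Y‖ ≤ rowSumNorm D⁻¹ * sumSeminorm D Y :=
  (norm_le_maxSeminorm hD Y).trans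
    (mul_le_mul_of_nonneg_left (maxSeminorm_le_sumSeminorm D Y) (rowSumNorm_nonneg _))

end StageMul

/-! ### Stable and partially damped recursions -/

section Recursion

variable {E : Type*} [AddCommGroup E] [Module ℝ E]

/-- The solution of `Z 0 = r 0`, `Z n = M n (Z (n - 1)) + r n`. -/
def recSeq (M : ℕ → E →ₗ[ℝ] E) (r : ℕ → E) : ℕ → E
  | 0 => r 0
  | n + 1 => M (n + 1) (recSeq M r n) + r (n + 1)

lemma recSeq_of_pos (M : ℕ → E →ₗ[ℝ] E) (r : ℕ → E) {n : ℕ} (hn : 1 ≤ n) :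
    recSeq M r n = M n (recSeq M r (n - 1)) + r n := by
  obtain ⟨k, rfl⟩ := Nat.exists_eq_add_of_le' hn
  rfl

lemma eq_recSeq (M : ℕ → E →ₗ[ℝ] E) (r Z : ℕ → E) (N : ℕ) (h0 : Z 0 = r 0)
    (h : ∀ n, 1 ≤ n → n ≤ N → Z n = M n (Z (n - 1)) + r n) : ∀ n ≤ N, Z n = recSeq M r n := by
  intro n
  induction n with
  | zero => intro _; exact h0
  | succ n ih =>
    intro hn
    rw [h (n + 1) (by omega) hn, Nat.add_sub_cancel, ih (by omega)]
    rfl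

/-- Stability of a recursion with stable inner steps and one bounded final step. Inhomogeneities
`β n` in the kernel of `Q` are damped geometrically, hence enter through their maximum; the other
inhomogeneities `α n` are summed. -/
lemma recursion_bound (ν : Seminorm ℝ E) (Q : E →ₗ[ℝ] E) (M : ℕ → E →ₗ[ℝ] E) {N : ℕ} (hN : 1 ≤ N)
    {γ κ b : ℝ} (hγ0 : 0 ≤ γ) (hγ : γ < 1) (hκ : 1 ≤ κ) (hb : 0 ≤ b)
    (hM : ∀ n, 1 ≤ n → n < N → ∀ x, ν (M n x) ≤ ν x)
    (hMγ : ∀ n, 1 ≤ n → n < N → ∀ x, Q x = 0 → Q (M n x) = 0 ∧ ν (M n x) ≤ γ * ν x)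
    (hMN : ∀ x, ν (M N x) ≤ κ * ν x) (Z α β : ℕ → E) (h0 : Z 0 = α 0)
    (hZ : ∀ n, 1 ≤ n → n < N → Z n = M n (Z (n - 1)) + (α n + β n))
    (hZN : Z N = M N (Z (N - 1)) + α N)
    (hβ : ∀ n, 1 ≤ n → n < N → Q (β n) = 0 ∧ ν (β n) ≤ b) :
    ∀ n ≤ N, ν (Z n) ≤ κ * (∑ j ∈ Finset.range (N + 1), ν (α j) + b / (1 - γ)) := by
  have hγ' : 0 < 1 - γ := by linarith
  have hbγ : 0 ≤ b / (1 - γ) := div_nonneg hb hγ'.le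
  have hmono : ∀ k ≤ N + 1, ∑ j ∈ Finset.range k, ν (α j) ≤
      ∑ j ∈ Finset.range (N + 1), ν (α j) := fun k hk =>
    Finset.sum_le_sum_of_subset_of_nonneg (Finset.range_mono hk) fun _ _ _ => apply_nonneg _ _
  -- `X` collects the contributions of the `β n`, `Z - X` those of the `α n`.
  set X : ℕ → E := recSeq M (fun n => if n = 0 then 0 else β n) with hX
  have hX0 : X 0 = 0 := by simp [hX, recSeq]
  have hXs : ∀ n, X (n + 1) = M (n + 1) (X n) + β (n + 1) := fun n => by simp [hX, recSeq]
  have hXb : ∀ n, n < N → Q (X n) = 0 ∧ ν (X n) ≤ b / (1 - γ) := by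
    intro n
    induction n with
    | zero => intro _; rw [hX0]; simpa using hbγ
    | succ n ih =>
      intro hn
      obtain ⟨h1, h2⟩ := ih (by omega)
      obtain ⟨h3, h4⟩ := hMγ (n + 1) (by omega) hn _ h1
      obtain ⟨h5, h6⟩ := hβ (n + 1) (by omega) hn
      refine ⟨by rw [hXs, map_add, h3, h5, add_zero], ?_⟩
      rw [hXs]
      calc ν (M (n + 1) (X n) + β (n + 1)) ≤ γ * (b / (1 - γ)) + b :=
            (map_add_le_add ν _ _).trans
              (add_le_add (h4.trans (mul_le_mul_of_nonneg_left h2 hγ0)) h6)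
        _ = b / (1 - γ) := by field_simp; ring
  have hD : ∀ n, n < N → ν (Z n - X n) ≤ ∑ j ∈ Finset.range (n + 1), ν (α j) := by
    intro n
    induction n with
    | zero => intro _; simp [hX0, h0]
    | succ n ih =>
      intro hn
      have e : Z (n + 1) - X (n + 1) = M (n + 1) (Z n - X n) + α (n + 1) := by
        rw [hXs, hZ (n + 1) (by omega) hn, Nat.add_sub_cancel, map_sub]; abel
      rw [e, Finset.sum_range_succ]
      exact (map_add_le_add ν _ _).trans
        (add_le_add_left ((hM _ (by omega) hn _).trans (ih (by omega))) _)
  have hlt : ∀ n, n < N → ν (Z n) ≤ ∑ j ∈ Finset.range (n + 1), ν (α j) + b / (1 - γ) := by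
    intro n hn
    calc ν (Z n) = ν ((Z n - X n) + X n) := by rw [sub_add_cancel]
      _ ≤ _ := (map_add_le_add ν _ _).trans (add_le_add (hD n hn) (hXb n hn).2)
  have hS : 0 ≤ ∑ j ∈ Finset.range (N + 1), ν (α j) + b / (1 - γ) :=
    add_nonneg (Finset.sum_nonneg fun _ _ => apply_nonneg _ _) hbγ
  intro n hn
  rcases hn.lt_or_eq with hn | rfl
  · refine (hlt n hn).trans (le_trans ?_ (le_mul_of_one_le_left hS hκ))
    exact add_le_add_left (hmono _ (by omega)) _
  · have h1 := hlt (n - 1) (by omega)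
    rw [Nat.sub_add_cancel hN] at h1
    rw [hZN]
    refine (map_add_le_add ν _ _).trans ?_
    have h2 := (hMN (Z (n - 1))).trans (mul_le_mul_of_nonneg_left h1 (by linarith))
    have h3 : ν (α n) ≤ κ * ν (α n) := le_mul_of_one_le_left (apply_nonneg _ _) hκ
    rw [Finset.sum_range_succ]
    nlinarith

end Recursion

/-! ### A fixed point theorem for definite seminorms -/

/-- Banach's fixed point theorem on a ball of a finite-dimensional space whose norm is given as a
definite seminorm. -/
lemma exists_fixedPoint_of_seminorm {E : Type*} [AddCommGroup E] [Module ℝ E]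
    [FiniteDimensional ℝ E] (ν : Seminorm ℝ E) (hν : ∀ x, ν x = 0 → x = 0) (f : E → E) {R : ℝ}
    (hR : 0 ≤ R) (hmaps : ∀ x, ν x ≤ R → ν (f x) ≤ R)
    (hf : ∀ x y, ν x ≤ R → ν y ≤ R → ν (f x - f y) ≤ 1 / 2 * ν (x - y)) :
    ∃ x, ν x ≤ R ∧ f x = x := by
  let _ : NormedAddCommGroup E := AddGroupNorm.toNormedAddCommGroup
    { toFun := ν
      map_zero' := map_zero ν
      add_le' := map_add_le_add ν
      neg' := map_neg_eq_map ν
      eq_zero_of_map_eq_zero' := hν }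
  have hnorm : ∀ x : E, ‖x‖ = ν x := fun _ => rfl
  let _ : NormedSpace ℝ E := ⟨fun a x => (map_smul_eq_mul ν a x).le⟩
  have : CompleteSpace E := FiniteDimensional.complete ℝ E
  have hmem : ∀ x, x ∈ Metric.closedBall (0 : E) R ↔ ν x ≤ R := fun x => by
    rw [mem_closedBall_zero_iff, hnorm]
  have hs : MapsTo f (Metric.closedBall 0 R) (Metric.closedBall 0 R) := fun x hx =>
    (hmem _).2 (hmaps x ((hmem _).1 hx))
  have hc : ContractingWith (1 / 2) (hs.restrict f _ _) := by
    refine ⟨by norm_num, LipschitzWith.of_dist_le_mul fun x y => ?_⟩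
    have := hf x y ((hmem _).1 x.2) ((hmem _).1 y.2)
    simpa [Subtype.dist_eq, dist_eq_norm, hnorm] using this
  obtain ⟨x, hx, hfx, -⟩ := ContractingWith.exists_fixedPoint'
    (Metric.isClosed_closedBall.isComplete) hs hc (x := 0) ((hmem 0).2 (by simpa using hR))
    (edist_ne_top _ _)
  exact ⟨x, (hmem _).1 hx, hfx⟩

/-! ### Taylor expansion and local defects -/

section Taylor

variable {F : Type*} [NormedAddCommGroup F] [NormedSpace ℝ F]

/-- Taylor expansion of `f 0` around `t`, in either direction, where `f (k + 1)` is the derivative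
of `f k` within a set `I`. The constant is not sharp. -/
lemma norm_sub_taylor_le (I : Set ℝ) (t M : ℝ) (n : ℕ) (f : ℕ → ℝ → F)
    (hf : ∀ k < n, ∀ τ ∈ I, HasDerivWithinAt (f k) (f (k + 1) τ) I τ)
    (x : ℝ) (hx : uIcc t x ⊆ I) (hM : ∀ τ ∈ uIcc t x, ‖f n τ‖ ≤ M) :
    ‖f 0 x - ∑ k ∈ Finset.range n, ((x - t) ^ k / k.factorial) • f k t‖ ≤ M * |x - t| ^ n := by
  induction n generalizing f x with
  | zero => simpa using hM x right_mem_uIcc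
  | succ n ih =>
    have hM0 : 0 ≤ M := (norm_nonneg _).trans (hM x right_mem_uIcc)
    set g : ℝ → F := fun y =>
      f 0 y - ∑ k ∈ Finset.range (n + 1), ((y - t) ^ k / k.factorial) • f k t with hg
    have hsub : ∀ y ∈ uIcc t x, uIcc t y ⊆ uIcc t x := fun y hy =>
      uIcc_subset_uIcc left_mem_uIcc hy
    have hder : ∀ y ∈ uIcc t x, HasDerivWithinAt g
        (f 1 y - ∑ k ∈ Finset.range n, ((y - t) ^ k / k.factorial) • f (k + 1) t)
        (uIcc t x) y := by
      intro y hy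
      have h0 := (hf 0 (Nat.succ_pos n) y (hx hy)).mono hx
      refine h0.sub ?_
      simp_rw [Finset.sum_range_succ']
      rw [show ∑ k ∈ Finset.range n, ((y - t) ^ k / (k.factorial : ℝ)) • f (k + 1) t =
        ∑ k ∈ Finset.range n, ((y - t) ^ k / (k.factorial : ℝ)) • f (k + 1) t + 0 by rw [add_zero]]
      refine HasDerivWithinAt.add ?_ (by simpa using hasDerivWithinAt_const y (uIcc t x) (f 0 t))
      refine HasDerivWithinAt.fun_sum fun k _ => HasDerivWithinAt.smul_const ?_ _
      have h1 := (((hasDerivAt_id y).sub_const t).pow (k + 1)).div_const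
        ((k + 1).factorial : ℝ)
      refine HasDerivAt.hasDerivWithinAt (h1.congr_deriv ?_)
      have : (k.factorial : ℝ) ≠ 0 := by positivity
      rw [Nat.factorial_succ]
      push_cast
      field_simp
      simp
    have hbd : ∀ y ∈ uIcc t x,
        ‖f 1 y - ∑ k ∈ Finset.range n, ((y - t) ^ k / k.factorial) • f (k + 1) t‖ ≤
          M * |x - t| ^ n := by
      intro y hy
      refine (ih (fun k => f (k + 1)) (fun k hk => hf (k + 1) (by omega)) y
        ((hsub y hy).trans hx) (fun τ hτ => hM τ (hsub y hy hτ))).trans ?_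
      have : |y - t| ≤ |x - t| := abs_sub_left_of_mem_uIcc hy
      gcongr
    have hmv := Convex.norm_image_sub_le_of_norm_hasDerivWithin_le hder hbd (convex_uIcc t x)
      left_mem_uIcc right_mem_uIcc
    have hgt : g t = 0 := by
      simp [hg, Finset.sum_range_succ']
    rw [hgt, sub_zero, Real.norm_eq_abs, mul_assoc, ← pow_succ] at hmv
    exact hmv

/-- Expansion of the local defect of a linear multistep formula with abscissae `x`, `z` (in units
of the stepsize `h`, relative to `t`): if the formula is exact for polynomials of degree below `r`,
its defect is `h ^ r` times the `r`-th moment up to terms of order `r + 1`. -/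
lemma norm_defect_sub_le {ι ι' : Type*} [Fintype ι] [Fintype ι'] (I J : Set ℝ) (t h M : ℝ)
    (hh : 0 ≤ h) (r : ℕ) (f : ℕ → ℝ → F)
    (hf : ∀ k < r + 1, ∀ τ ∈ I, HasDerivWithinAt (f k) (f (k + 1) τ) I τ) (hJ : J ⊆ I)
    (hM : ∀ τ ∈ J, ‖f (r + 1) τ‖ ≤ M) (a κ x : ι → ℝ) (b z : ι' → ℝ)
    (hx : ∀ i, uIcc t (t + h * x i) ⊆ J) (hz : ∀ i, uIcc t (t + h * z i) ⊆ J) (mom : ℕ → ℝ)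
    (hmom : ∀ k, mom k = ∑ i, a i * x i ^ k - ∑ i, b i * z i ^ k
      - ∑ i, κ i * (k * x i ^ (k - 1)))
    (hmom0 : ∀ k < r, mom k = 0) :
    ‖(∑ i, a i • f 0 (t + h * x i) - ∑ i, b i • f 0 (t + h * z i)
        - h • ∑ i, κ i • f 1 (t + h * x i)) - (mom r * (h ^ r / r.factorial)) • f r t‖ ≤
      (∑ i, |a i| * |x i| ^ (r + 1) + ∑ i, |b i| * |z i| ^ (r + 1) + ∑ i, |κ i| * |x i| ^ r)
        * (M * h ^ (r + 1)) := by
  set P : ℝ → F := fun ξ => ∑ k ∈ Finset.range (r + 1), ((h * ξ) ^ k / k.factorial) • f k t with hP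
  set P' : ℝ → F := fun ξ => ∑ k ∈ Finset.range r, ((h * ξ) ^ k / k.factorial) • f (k + 1) t
    with hP'
  have e0 : ∀ ξ, uIcc t (t + h * ξ) ⊆ J →
      ‖f 0 (t + h * ξ) - P ξ‖ ≤ |ξ| ^ (r + 1) * (M * h ^ (r + 1)) := by
    intro ξ hξ
    have := norm_sub_taylor_le I t M (r + 1) f hf (t + h * ξ) (hξ.trans hJ) fun τ hτ => hM τ (hξ hτ)
    rw [add_sub_cancel_left, abs_mul, abs_of_nonneg hh] at this
    refine this.trans (le_of_eq ?_)
    ring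
  have e1 : ∀ ξ, uIcc t (t + h * ξ) ⊆ J →
      ‖h • (f 1 (t + h * ξ) - P' ξ)‖ ≤ |ξ| ^ r * (M * h ^ (r + 1)) := by
    intro ξ hξ
    have := norm_sub_taylor_le I t M r (fun k => f (k + 1)) (fun k hk => hf (k + 1) (by omega))
      (t + h * ξ) (hξ.trans hJ) fun τ hτ => hM τ (hξ hτ)
    rw [add_sub_cancel_left, abs_mul, abs_of_nonneg hh] at this
    rw [norm_smul, Real.norm_eq_abs, abs_of_nonneg hh]
    refine (mul_le_mul_of_nonneg_left this hh).trans (le_of_eq ?_)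
    ring
  have e2 : ∀ ξ, h • P' ξ =
      ∑ k ∈ Finset.range (r + 1), ((k * ξ ^ (k - 1)) * (h ^ k / k.factorial)) • f k t := by
    intro ξ
    rw [Finset.sum_range_succ', hP', Finset.smul_sum]
    simp only [Nat.cast_zero, zero_mul, zero_smul, add_zero, smul_smul, Nat.add_sub_cancel]
    refine Finset.sum_congr rfl fun k _ => ?_
    congr 1
    have : (k.factorial : ℝ) ≠ 0 := by positivity
    rw [Nat.factorial_succ]
    push_cast
    field_simp
    ring
  have e3 : ∀ ξ, P ξ = ∑ k ∈ Finset.range (r + 1), (ξ ^ k * (h ^ k / k.factorial)) • f k t := by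
    intro ξ
    refine Finset.sum_congr rfl fun k _ => ?_
    congr 1
    rw [mul_pow]; ring
  have key : (mom r * (h ^ r / r.factorial)) • f r t =
      ∑ i, a i • P (x i) - ∑ i, b i • P (z i) - ∑ i, κ i • (h • P' (x i)) := by
    have : (mom r * (h ^ r / r.factorial)) • f r t =
        ∑ k ∈ Finset.range (r + 1), (mom k * (h ^ k / k.factorial)) • f k t := by
      rw [Finset.sum_range_succ, Finset.sum_eq_zero, zero_add]
      intro k hk
      rw [hmom0 k (Finset.mem_range.1 hk), zero_mul, zero_smul]
    rw [this]
    simp_rw [e2, e3, Finset.smul_sum, smul_smul]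
    rw [Finset.sum_comm (s := Finset.univ (α := ι)), Finset.sum_comm (s := Finset.univ (α := ι')),
      Finset.sum_comm (s := Finset.univ (α := ι)), ← Finset.sum_sub_distrib,
      ← Finset.sum_sub_distrib]
    refine Finset.sum_congr rfl fun k _ => ?_
    rw [hmom]
    simp only [← Finset.sum_smul, ← sub_smul, ← mul_assoc, ← Finset.sum_mul, ← sub_mul]
  have split : (∑ i, a i • f 0 (t + h * x i) - ∑ i, b i • f 0 (t + h * z i)
        - h • ∑ i, κ i • f 1 (t + h * x i)) - (mom r * (h ^ r / r.factorial)) • f r t =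
      ∑ i, a i • (f 0 (t + h * x i) - P (x i)) - ∑ i, b i • (f 0 (t + h * z i) - P (z i))
        - ∑ i, κ i • (h • (f 1 (t + h * x i) - P' (x i))) := by
    rw [key]
    simp only [smul_sub, Finset.sum_sub_distrib, Finset.smul_sum]
    simp only [smul_comm h]
    abel
  rw [split, add_mul, add_mul, Finset.sum_mul, Finset.sum_mul, Finset.sum_mul]
  refine (norm_sub_le _ _).trans (add_le_add ((norm_sub_le _ _).trans (add_le_add ?_ ?_)) ?_)
  · refine (norm_sum_le _ _).trans (Finset.sum_le_sum fun i _ => ?_)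
    rw [norm_smul, Real.norm_eq_abs, mul_assoc]
    exact mul_le_mul_of_nonneg_left (e0 _ (hx i)) (abs_nonneg _)
  · refine (norm_sum_le _ _).trans (Finset.sum_le_sum fun i _ => ?_)
    rw [norm_smul, Real.norm_eq_abs, mul_assoc]
    exact mul_le_mul_of_nonneg_left (e0 _ (hz i)) (abs_nonneg _)
  · refine (norm_sum_le _ _).trans (Finset.sum_le_sum fun i _ => ?_)
    rw [norm_smul, Real.norm_eq_abs, mul_assoc]
    exact mul_le_mul_of_nonneg_left (e1 _ (hx i)) (abs_nonneg _)

/-- The derivatives of a `C^n` function on an interval form a family of successive derivatives. -/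
lemma hasDerivWithinAt_iteratedDerivWithin {n : ℕ} {v : ℝ → F} {b : ℝ} (hb : 0 < b)
    (hv : ContDiffOn ℝ n v (Icc 0 b)) {k : ℕ} (hk : k < n) {τ : ℝ} (hτ : τ ∈ Icc 0 b) :
    HasDerivWithinAt (iteratedDerivWithin k v (Icc 0 b))
      (iteratedDerivWithin (k + 1) v (Icc 0 b) τ) (Icc 0 b) τ := by
  have h := (hv.differentiableOn_iteratedDerivWithin (by exact_mod_cast hk)
    (uniqueDiffOn_Icc hb)) τ hτ
  rw [iteratedDerivWithin_succ]
  exact h.hasDerivWithinAt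

end Taylor

/-! ### Order conditions as moment equations -/

section Moments

variable {s : ℕ}

lemma vdm_mul_nilE (c : Fin s → ℝ) (r : ℕ) (i : Fin s) (k : Fin r) :
    (vdm c r * nilE r) i k = (k : ℕ) * c i ^ ((k : ℕ) - 1) := by
  obtain ⟨k, hk⟩ := k
  simp only [Matrix.mul_apply, vdm, nilE, Matrix.of_apply]
  rcases k with _ | k
  · simp
  · rw [Finset.sum_eq_single ⟨k, by omega⟩]
    · simp; ring
    · intro j _ hj
      rw [if_neg, mul_zero]
      intro h
      exact hj (Fin.ext (by simp at h ⊢; omega))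
    · simp

lemma vdm_scale_pascal (c : Fin s → ℝ) (q : ℕ) (σ : ℝ) :
    vdm c q * scaleS q σ * pascal q = vdm (fun i => 1 + σ * c i) q := by
  ext i ⟨k, hk⟩
  rw [Matrix.mul_apply]
  simp only [scaleS, Matrix.mul_diagonal, vdm, pascal, Matrix.of_apply]
  rw [add_comm, add_pow]
  have := Fin.sum_univ_eq_sum_range
    (fun l => c i ^ l * σ ^ l * ((k.choose l : ℕ) : ℝ)) q
  rw [this]
  have hsub : Finset.range (k + 1) ⊆ Finset.range q := Finset.range_mono (by omega)
  rw [← Finset.sum_subset hsub]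
  · refine Finset.sum_congr rfl fun l _ => ?_
    rw [mul_pow, one_pow, mul_one, mul_comm (σ ^ l)]
  · intro l _ hl
    rw [Nat.choose_eq_zero_of_lt (by simpa using hl)]; simp

lemma pascal_det (r : ℕ) : (pascal r).det = 1 := by
  rw [Matrix.det_of_isUpperTriangular]
  · simp [pascal]
  · intro i j hij
    simp only [pascal, Matrix.of_apply]
    rw [Nat.choose_eq_zero_of_lt (by simpa using hij)]; simp

lemma vdm_pascal_inv (c : Fin s → ℝ) (r : ℕ) {σ : ℝ} (hσ : σ ≠ 0) :
    vdm c r * (pascal r)⁻¹ * (scaleS r σ)⁻¹ = vdm (fun i => (c i - 1) / σ) r := by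
  have hS : IsUnit (scaleS r σ).det := by
    rw [scaleS, Matrix.det_diagonal]
    exact (Finset.prod_ne_zero_iff.2 fun i _ => pow_ne_zero _ hσ).isUnit
  have hP : IsUnit (pascal r).det := by rw [pascal_det]; exact isUnit_one
  have h := vdm_scale_pascal (fun i => (c i - 1) / σ) r σ
  have e : (fun i => 1 + σ * ((c i - 1) / σ)) = c := by
    funext i; field_simp; ring
  rw [e] at h
  rw [← h, Matrix.mul_assoc _ (pascal r), Matrix.mul_nonsing_inv _ hP, Matrix.mul_one,
    Matrix.mul_assoc, Matrix.mul_nonsing_inv _ hS, Matrix.mul_one]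

variable {X : PeerTriplet s} {r q qb : ℕ}

/-- Moment equations from a forward order condition with coefficients `M`, `L`. -/
lemma forward_moment {M L : Matrix (Fin s) (Fin s) ℝ} {σ : ℝ} (hσ : 0 < σ)
    (h : M * vdm X.c r =
      X.B σ * vdm X.c r * (pascal r)⁻¹ * (scaleS r σ)⁻¹ + L * vdm X.c r * nilE r)
    (i : Fin s) {k : ℕ} (hk : k < r) :
    ∑ j, M i j * X.c j ^ k - ∑ j, X.B σ i j * ((X.c j - 1) / σ) ^ k
      - ∑ j, L i j * (k * X.c j ^ (k - 1)) = 0 := by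
  have h2 := congrFun (congrFun h i) ⟨k, hk⟩
  rw [Matrix.mul_assoc (X.B σ), Matrix.mul_assoc (X.B σ), vdm_pascal_inv _ _ hσ.ne',
    Matrix.mul_assoc L, Matrix.add_apply, Matrix.mul_apply, Matrix.mul_apply, Matrix.mul_apply] at h2
  simp only [vdm_mul_nilE] at h2
  simp only [vdm, Matrix.of_apply] at h2
  rw [h2]; ring

/-- Moment equations from an adjoint order condition with coefficients `M`, `L`. -/
lemma adjoint_moment {M L : Matrix (Fin s) (Fin s) ℝ} {σ : ℝ}
    (h : M.transpose * vdm X.c q = (X.B σ).transpose * vdm X.c q * scaleS q σ * pascal q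
        - L.transpose * vdm X.c q * nilE q)
    (i : Fin s) {k : ℕ} (hk : k < q) :
    ∑ j, M j i * X.c j ^ k - ∑ j, X.B σ j i * (1 + σ * X.c j) ^ k
      - ∑ j, -L j i * (k * X.c j ^ (k - 1)) = 0 := by
  have h2 := congrFun (congrFun h i) ⟨k, hk⟩
  rw [Matrix.mul_assoc (X.B σ).transpose, Matrix.mul_assoc (X.B σ).transpose, vdm_scale_pascal,
    Matrix.mul_assoc L.transpose, Matrix.sub_apply, Matrix.mul_apply, Matrix.mul_apply,
    Matrix.mul_apply] at h2
  simp only [vdm_mul_nilE] at h2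
  simp only [vdm, Matrix.of_apply, Matrix.transpose_apply] at h2
  rw [h2]
  simp

lemma start_moment (h : X.StartOrder r q qb) (i : Fin s) {k : ℕ} (hk : k < r) :
    ∑ j, X.A0 i j * X.c j ^ k - ∑ _j : Unit, X.a i * 0 ^ k
      - ∑ j, X.K0 i j * (k * X.c j ^ (k - 1)) = 0 := by
  have h2 := congrFun (congrFun h.1 i) ⟨k, hk⟩
  rw [Matrix.mul_assoc, Matrix.add_apply, Matrix.mul_apply, Matrix.mul_apply] at h2
  simp only [vdm_mul_nilE] at h2
  simp only [vdm, Matrix.of_apply] at h2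
  rw [h2]
  rcases k with _ | k <;> simp

lemma end_moment (h : X.EndOrder r q qb) (i : Fin s) {k : ℕ} (hk : k < q) :
    ∑ j, X.AN j i * X.c j ^ k - ∑ _j : Unit, X.w i * 1 ^ k
      - ∑ j, -X.KN j i * (k * X.c j ^ (k - 1)) = 0 := by
  have h2 := congrFun (congrFun h.2.2.1 i) ⟨k, hk⟩
  rw [Matrix.mul_assoc, Matrix.add_apply, Matrix.mul_apply, Matrix.mul_apply] at h2
  simp only [vdm_mul_nilE] at h2
  simp only [vdm, Matrix.of_apply, Matrix.transpose_apply] at h2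
  simp [← h2]

/-- Preconsistency: `B(σ) 1 = A 1`. -/
lemma sum_row_B (hr : 0 < r) (h : X.StandardOrder r q) {σ : ℝ} (hσ : 0 < σ) (i : Fin s) :
    ∑ j, X.B σ i j = ∑ j, X.A i j := by
  have := forward_moment hσ (h.1 σ hσ) i hr
  simp at this
  linarith

/-- Preconsistency of the adjoint scheme: `1ᵀ B(σ) = 1ᵀ A`. -/
lemma sum_col_B (hq : 0 < q) (h : X.StandardOrder r q) {σ : ℝ} (hσ : 0 < σ) (i : Fin s) :
    ∑ j, X.B σ j i = ∑ j, X.A j i := by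
  have := adjoint_moment (h.2.1 σ hσ) i hq
  simp at this
  linarith

end Moments

/-! ### A common bound for the coefficients of a triplet -/

section Coefficients

variable {s : ℕ}

/-- The number `κ` bounds all coefficients of the triplet (for stepsize ratios in `[σlo, σhi]`)
and all constants of equivalence between the weighted norms and the maximum norm. -/
structure PeerTriplet.BoundedBy (X : PeerTriplet s) (W : Matrix (Fin s) (Fin s) ℝ)
    (σlo σhi κ : ℝ) : Prop where
  one_le : 1 ≤ κ
  lo : σlo⁻¹ ≤ κ
  hi : σhi ≤ κ
  c : ∀ i, X.c i ≤ κ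
  a : ∀ i, |X.a i| ≤ κ
  w : ∀ i, |X.w i| ≤ κ
  A : ∀ M ∈ ({X.A, X.A0, X.AN} : Set (Matrix (Fin s) (Fin s) ℝ)), ∀ i j, |M i j| ≤ κ
  Ainv : ∀ M ∈ ({X.A, X.A0, X.AN} : Set (Matrix (Fin s) (Fin s) ℝ)), ∀ i j, |M⁻¹ i j| ≤ κ
  K : ∀ M ∈ ({X.K, X.K0, X.KN} : Set (Matrix (Fin s) (Fin s) ℝ)), ∀ i j, |M i j| ≤ κ
  Kcol : ∀ M ∈ ({X.K, X.K0, X.KN} : Set (Matrix (Fin s) (Fin s) ℝ)), ∀ i,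
    |∑ j, M j i|⁻¹ ≤ κ
  B : ∀ σ ∈ Icc σlo σhi, ∀ i j, |X.B σ i j| ≤ κ
  weight : rowSumNorm W⁻¹ ≤ κ
  weight_inv : rowSumNorm W⁻¹⁻¹ ≤ κ
  weightDag : s * rowSumNorm (X.Wdag W)⁻¹ ≤ κ
  weightDag_inv : rowSumNorm (X.Wdag W)⁻¹⁻¹ ≤ κ

lemma abs_entry_le_of_rowSumNorm_le {M : Matrix (Fin s) (Fin s) ℝ} {k : ℝ}
    (h : rowSumNorm M ≤ k) (i j : Fin s) : |M i j| ≤ k :=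
  (Finset.single_le_sum (f := fun j => |M i j|) (fun _ _ => abs_nonneg _)
    (Finset.mem_univ j)).trans ((sum_abs_le_rowSumNorm M i).trans h)

lemma abs_mul_mul_entry_le (P M R : Matrix (Fin s) (Fin s) ℝ) (hM : ∀ i j, |M i j| ≤ 1)
    (i j : Fin s) : |(P * M * R) i j| ≤ ∑ l, (∑ k, |P i k|) * |R l j| := by
  rw [Matrix.mul_apply]
  refine (Finset.abs_sum_le_sum_abs _ _).trans (Finset.sum_le_sum fun l _ => ?_)
  rw [abs_mul, Matrix.mul_apply]
  refine mul_le_mul_of_nonneg_right ?_ (abs_nonneg _)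
  refine (Finset.abs_sum_le_sum_abs _ _).trans (Finset.sum_le_sum fun k _ => ?_)
  rw [abs_mul]
  exact mul_le_of_le_one_right (abs_nonneg _) (hM k l)

lemma PeerTriplet.exists_boundedBy (X : PeerTriplet s) {W : Matrix (Fin s) (Fin s) ℝ}
    {σlo σhi : ℝ} (hA : IsUnit X.A.det) (hstab : X.UniformlyZeroStable W σlo σhi) :
    ∃ κ, X.BoundedBy W σlo σhi κ := by
  have hB : ∀ σ ∈ Icc σlo σhi, ∀ i j,
      |X.B σ i j| ≤ ∑ l, (∑ k, |(X.A * W) i k|) * |W⁻¹ l j| := by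
    intro σ hσ i j
    have e : X.B σ = (X.A * W) * (W⁻¹ * X.Bbar σ * W) * W⁻¹ := by
      have h1 : W * W⁻¹ = 1 := Matrix.mul_nonsing_inv _ hstab.1
      have h2 : X.A * X.A⁻¹ = 1 := Matrix.mul_nonsing_inv _ hA
      calc X.B σ = X.A * ((W * W⁻¹) * (X.A⁻¹ * X.B σ) * (W * W⁻¹)) := by
            rw [h1, Matrix.one_mul, Matrix.mul_one, ← Matrix.mul_assoc, h2, Matrix.one_mul]
        _ = _ := by simp only [PeerTriplet.Bbar, Matrix.mul_assoc]
    conv_lhs => rw [e]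
    exact abs_mul_mul_entry_le _ _ _ (abs_entry_le_of_rowSumNorm_le (hstab.2 σ hσ).1.le) i j
  have hfin : ∀ f : Fin s → ℝ, ∀ᶠ κ : ℝ in atTop, ∀ i, f i ≤ κ := fun f =>
    eventually_all.2 fun i => eventually_ge_atTop _
  have hfin2 : ∀ f : Fin s → Fin s → ℝ, ∀ᶠ κ : ℝ in atTop, ∀ i j, f i j ≤ κ := fun f =>
    eventually_all.2 fun i => eventually_all.2 fun j => eventually_ge_atTop _
  have hset : ∀ S : Set (Matrix (Fin s) (Fin s) ℝ), S.Finite →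
      ∀ f : Matrix (Fin s) (Fin s) ℝ → Fin s → Fin s → ℝ,
      ∀ᶠ κ : ℝ in atTop, ∀ M ∈ S, ∀ i j, f M i j ≤ κ := fun S hS f =>
    (eventually_all_finite hS).2 fun M _ => hfin2 (f M)
  have hset1 : ∀ S : Set (Matrix (Fin s) (Fin s) ℝ), S.Finite →
      ∀ f : Matrix (Fin s) (Fin s) ℝ → Fin s → ℝ,
      ∀ᶠ κ : ℝ in atTop, ∀ M ∈ S, ∀ i, f M i ≤ κ := fun S hS f =>
    (eventually_all_finite hS).2 fun M _ => hfin (f M)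
  have fA : ({X.A, X.A0, X.AN} : Set (Matrix (Fin s) (Fin s) ℝ)).Finite := by simp
  have fK : ({X.K, X.K0, X.KN} : Set (Matrix (Fin s) (Fin s) ℝ)).Finite := by simp
  refine Eventually.exists (f := (atTop : Filter ℝ)) ?_
  filter_upwards [eventually_ge_atTop 1, eventually_ge_atTop σlo⁻¹, eventually_ge_atTop σhi,
    hfin X.c, hfin fun i => |X.a i|, hfin fun i => |X.w i|, hset _ fA fun M i j => |M i j|,
    hset _ fA fun M i j => |M⁻¹ i j|, hset _ fK fun M i j => |M i j|,
    hset1 _ fK fun M i => |∑ j, M j i|⁻¹,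
    hfin2 fun i j => ∑ l, (∑ k, |(X.A * W) i k|) * |W⁻¹ l j|,
    eventually_ge_atTop (rowSumNorm W⁻¹), eventually_ge_atTop (rowSumNorm W⁻¹⁻¹),
    eventually_ge_atTop (s * rowSumNorm (X.Wdag W)⁻¹),
    eventually_ge_atTop (rowSumNorm (X.Wdag W)⁻¹⁻¹)]
    with κ h1 h2 h3 h4 h5 h6 h7 h8 h9 h10 h11 h12 h13 h14 h15
  exact ⟨h1, h2, h3, h4, h5, h6, h7, h8, h9, h10, fun σ hσ i j => (hB σ hσ i j).trans (h11 i j),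
    h12, h13, h14, h15⟩

/-- If the super-convergence residual of the forward scheme vanishes at `σ = 1`, it is of first
order in `σ - 1`: by preconsistency it depends on `σ` only through powers of `σ`. -/
lemma PeerTriplet.exists_abs_supState_le (X : PeerTriplet s) {r q : ℕ} (hq : 0 < q)
    (h : X.StandardOrder r q) {σlo σhi : ℝ} (hlo : 0 < σlo) (hlo1 : σlo < 1) (hhi : 1 < σhi)
    (h1 : X.supState r 1 = 0) :
    ∃ L : ℝ, 0 ≤ L ∧ ∀ σ ∈ Icc σlo σhi, |X.supState r σ| ≤ L * |σ - 1| := by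
  set F : ℝ → ℝ := fun σ => ∑ j, ((∑ i, X.A i j) * X.c j ^ r
    - (∑ i, X.A i j) * (X.c j - 1) ^ r * (σ ^ r)⁻¹ - r * (∑ i, X.K i j) * X.c j ^ (r - 1)) with hF
  have hFe : ∀ σ ∈ Icc σlo σhi, X.supState r σ = F σ := by
    intro σ hσ
    rw [PeerTriplet.supState, Finset.sum_comm]
    refine Finset.sum_congr rfl fun j _ => ?_
    rw [Finset.sum_sub_distrib, Finset.sum_sub_distrib, ← Finset.sum_mul, ← Finset.sum_mul,
      ← Finset.sum_mul, ← Finset.sum_mul, ← Finset.mul_sum, sum_col_B hq h (hlo.trans_le hσ.1)]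
  have hC : ContDiffOn ℝ 1 F (Icc σlo σhi) := by
    refine ContDiffOn.sum fun j _ => ?_
    refine ContDiffOn.sub (ContDiffOn.sub contDiffOn_const (contDiffOn_const.mul ?_))
      contDiffOn_const
    exact (contDiffOn_id.pow r).inv fun σ hσ => pow_ne_zero _ (hlo.trans_le hσ.1).ne'
  obtain ⟨L, hL⟩ := hC.exists_lipschitzOnWith one_ne_zero (convex_Icc _ _) isCompact_Icc
  refine ⟨L, L.2, fun σ hσ => ?_⟩
  have h1m : (1 : ℝ) ∈ Icc σlo σhi := ⟨hlo1.le, hhi.le⟩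
  have := hL.dist_le_mul σ hσ 1 h1m
  rwa [Real.dist_eq, Real.dist_eq, ← hFe σ hσ, ← hFe 1 h1m, h1, sub_zero] at this

lemma PeerTriplet.exists_abs_supAdjoint_le (X : PeerTriplet s) {r q : ℕ} (hr : 0 < r)
    (h : X.StandardOrder r q) {σlo σhi : ℝ} (hlo : 0 < σlo) (hlo1 : σlo < 1) (hhi : 1 < σhi)
    (h1 : X.supAdjoint q 1 = 0) :
    ∃ L : ℝ, 0 ≤ L ∧ ∀ σ ∈ Icc σlo σhi, |X.supAdjoint q σ| ≤ L * |σ - 1| := by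
  set F : ℝ → ℝ := fun σ => ∑ j, ((∑ i, X.A j i) * X.c j ^ q
    - (∑ i, X.A j i) * (1 + σ * X.c j) ^ q + q * (∑ i, X.K i j) * X.c j ^ (q - 1)) with hF
  have hFe : ∀ σ ∈ Icc σlo σhi, X.supAdjoint q σ = F σ := by
    intro σ hσ
    rw [PeerTriplet.supAdjoint, Finset.sum_comm]
    refine Finset.sum_congr rfl fun j _ => ?_
    rw [Finset.sum_add_distrib, Finset.sum_sub_distrib, ← Finset.sum_mul, ← Finset.sum_mul,
      ← Finset.sum_mul, ← Finset.mul_sum, sum_row_B hr h (hlo.trans_le hσ.1)]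
  have hC : ContDiffOn ℝ 1 F (Icc σlo σhi) := by
    refine ContDiffOn.sum fun j _ => ?_
    refine ContDiffOn.add (ContDiffOn.sub contDiffOn_const (contDiffOn_const.mul ?_))
      contDiffOn_const
    exact (contDiffOn_const.add (contDiffOn_id.mul contDiffOn_const)).pow q
  obtain ⟨L, hL⟩ := hC.exists_lipschitzOnWith one_ne_zero (convex_Icc _ _) isCompact_Icc
  refine ⟨L, L.2, fun σ hσ => ?_⟩
  have h1m : (1 : ℝ) ∈ Icc σlo σhi := ⟨hlo1.le, hhi.le⟩
  have := hL.dist_le_mul σ hσ 1 h1m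
  rwa [Real.dist_eq, Real.dist_eq, ← hFe σ hσ, ← hFe 1 h1m, h1, sub_zero] at this

/-- The one-leg condition of order `qb ≥ s - 2`, where `qb ≤ 2`, covers all exponents below
`s - 2`. -/
lemma oneLeg_of_lt {c : Fin s → ℝ} {M : Matrix (Fin s) (Fin s) ℝ} {n qb : ℕ} (hn : n ≤ qb)
    (hqb : qb ≤ 2) (h : OneLeg c M (qb - 1)) : ∀ k < n, OneLeg c M k := by
  intro k hk
  rcases Nat.eq_zero_or_pos k with rfl | hk0
  · intro i; simp
  · have : k = qb - 1 := by omega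
    rwa [this]

end Coefficients

/-! ### Lipschitz estimates in the tube -/

section Problem

variable {m d : ℕ}

lemma norm_sub_le_of_partial {h : Eu m → Eu m → Eu m} {y p : Eu m} {ρ Λ₁ Λ₂ : ℝ}
    (hd : ∀ a b, ‖a - y‖ < ρ → ‖b - p‖ < ρ →
      DifferentiableAt ℝ (fun z : Eu m × Eu m => h z.1 z.2) (a, b))
    (h1 : ∀ a b, ‖a - y‖ < ρ → ‖b - p‖ < ρ → ‖fderiv ℝ (fun x => h x b) a‖ ≤ Λ₁)
    (h2 : ∀ a b, ‖a - y‖ < ρ → ‖b - p‖ < ρ → ‖fderiv ℝ (fun x => h a x) b‖ ≤ Λ₂)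
    {a b a' b' : Eu m} (ha : ‖a - y‖ < ρ) (hb : ‖b - p‖ < ρ) (ha' : ‖a' - y‖ < ρ)
    (hb' : ‖b' - p‖ < ρ) : ‖h a b - h a' b'‖ ≤ Λ₁ * ‖a - a'‖ + Λ₂ * ‖b - b'‖ := by
  have e1 : ‖h a b - h a' b‖ ≤ Λ₁ * ‖a - a'‖ :=
    Convex.norm_image_sub_le_of_norm_fderiv_le (𝕜 := ℝ) (f := fun x => h x b)
      (s := Metric.ball y ρ)
      (fun x hx => DifferentiableAt.comp x (g := fun z : Eu m × Eu m => h z.1 z.2)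
        (f := fun x => (x, b)) (hd x b (mem_ball_iff_norm.1 hx) hb)
        (differentiableAt_id.prodMk (differentiableAt_const b)))
      (fun x hx => h1 x b (mem_ball_iff_norm.1 hx) hb) (convex_ball _ _)
      (mem_ball_iff_norm.2 ha') (mem_ball_iff_norm.2 ha)
  have e2 : ‖h a' b - h a' b'‖ ≤ Λ₂ * ‖b - b'‖ :=
    Convex.norm_image_sub_le_of_norm_fderiv_le (𝕜 := ℝ) (f := fun x => h a' x)
      (s := Metric.ball p ρ)
      (fun x hx => DifferentiableAt.comp x (g := fun z : Eu m × Eu m => h z.1 z.2)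
        (f := fun x => (a', x)) (hd a' x ha' (mem_ball_iff_norm.1 hx))
        ((differentiableAt_const a').prodMk differentiableAt_id))
      (fun x hx => h2 a' x ha' (mem_ball_iff_norm.1 hx)) (convex_ball _ _)
      (mem_ball_iff_norm.2 hb') (mem_ball_iff_norm.2 hb)
  calc ‖h a b - h a' b'‖ = ‖(h a b - h a' b) + (h a' b - h a' b')‖ := by congr 1; abel
    _ ≤ _ := (norm_add_le _ _).trans (add_le_add e1 e2)

namespace ControlProblem

variable {Q : ControlProblem m d} {u : Eu m → Eu m → Eu d} {y p : ℝ → Eu m} {Tstar ρ : ℝ}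

lemma mem_tube {t : ℝ} (ht : t ∈ Icc 0 Tstar) {a b : Eu m} (ha : ‖a - y t‖ < ρ)
    (hb : ‖b - p t‖ < ρ) : (a, b) ∈ tube y p Tstar ρ := ⟨t, ht, ha, hb⟩

lemma isOpen_tube : IsOpen (tube y p Tstar ρ) := by
  have : tube y p Tstar ρ =
      ⋃ t ∈ Icc 0 Tstar, {z : Eu m × Eu m | ‖z.1 - y t‖ < ρ ∧ ‖z.2 - p t‖ < ρ} := by
    ext z; simp only [tube, Set.mem_ofPred_eq, mem_iUnion, exists_prop]
  rw [this]
  refine isOpen_biUnion fun t _ => ?_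
  have h1 : Continuous fun z : Eu m × Eu m => ‖z.1 - y t‖ := by fun_prop
  have h2 : Continuous fun z : Eu m × Eu m => ‖z.2 - p t‖ := by fun_prop
  exact (isOpen_lt h1 continuous_const).inter (isOpen_lt h2 continuous_const)

variable {Λy Λp Λy' Λp' : ℝ}

lemma DerivativeBounds.norm_g_sub_le
    (hD : Q.DerivativeBounds u (tube y p Tstar ρ) Λy Λp Λy' Λp') {t : ℝ} (ht : t ∈ Icc 0 Tstar)
    {a b a' b' : Eu m} (ha : ‖a - y t‖ < ρ) (hb : ‖b - p t‖ < ρ) (ha' : ‖a' - y t‖ < ρ)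
    (hb' : ‖b' - p t‖ < ρ) :
    ‖Q.g u a b - Q.g u a' b'‖ ≤ Λy * ‖a - a'‖ + Λp * ‖b - b'‖ :=
  norm_sub_le_of_partial
    (fun _ _ ha hb => hD.1.differentiableAt (isOpen_tube.mem_nhds (mem_tube ht ha hb)))
    (fun _ _ ha hb => (hD.2.2 _ (mem_tube ht ha hb)).1)
    (fun _ _ ha hb => (hD.2.2 _ (mem_tube ht ha hb)).2.1) ha hb ha' hb'

lemma DerivativeBounds.norm_phi_sub_le
    (hD : Q.DerivativeBounds u (tube y p Tstar ρ) Λy Λp Λy' Λp') {t : ℝ} (ht : t ∈ Icc 0 Tstar)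
    {a b a' b' : Eu m} (ha : ‖a - y t‖ < ρ) (hb : ‖b - p t‖ < ρ) (ha' : ‖a' - y t‖ < ρ)
    (hb' : ‖b' - p t‖ < ρ) :
    ‖Q.phi u a b - Q.phi u a' b'‖ ≤ Λy' * ‖a - a'‖ + Λp' * ‖b - b'‖ :=
  norm_sub_le_of_partial
    (fun _ _ ha hb => hD.2.1.differentiableAt (isOpen_tube.mem_nhds (mem_tube ht ha hb)))
    (fun _ _ ha hb => (hD.2.2 _ (mem_tube ht ha hb)).2.2.1)
    (fun _ _ ha hb => (hD.2.2 _ (mem_tube ht ha hb)).2.2.2) ha hb ha' hb'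

lemma DerivativeBounds.nonneg (hρ : 0 < ρ) (hT : 0 ≤ Tstar)
    (hD : Q.DerivativeBounds u (tube y p Tstar ρ) Λy Λp Λy' Λp') :
    0 ≤ Λy ∧ 0 ≤ Λp ∧ 0 ≤ Λy' ∧ 0 ≤ Λp' := by
  obtain ⟨h1, h2, h3, h4⟩ := hD.2.2 (y 0, p 0)
    (mem_tube (left_mem_Icc.2 hT) (by simpa using hρ) (by simpa using hρ))
  exact ⟨(norm_nonneg _).trans h1, (norm_nonneg _).trans h2, (norm_nonneg _).trans h3,
    (norm_nonneg _).trans h4⟩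

lemma phi_smul {k : ℝ} {x q : Eu m} (h : u x (k • q) = u x q) :
    Q.phi u x (k • q) = k • Q.phi u x q := by
  simp [phi, h]

lemma phi_zero (x : Eu m) : Q.phi u x 0 = 0 := by simp [phi]

/-- For a quadratic objective the gradient is affine, with the Hessian as its linear part. -/
lemma Regular.norm_gradient_sub_le (hQ : Q.Regular) (x x' : Eu m) :
    ‖gradient Q.C x - gradient Q.C x'‖ ≤ Q.Gam * ‖x - x'‖ := by
  obtain ⟨-, -, -, -, c₀, b, M, hC⟩ := hQ
  set S : Eu m →L[ℝ] Eu m := M + ContinuousLinearMap.adjoint M with hS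
  have hg : gradient Q.C = fun x => b + S x := by
    funext x
    apply HasGradientAt.gradient
    rw [hasGradientAt_iff_hasFDerivAt]
    have hC' : Q.C = fun x => c₀ + inner ℝ b x + inner ℝ x (M x) := funext hC
    have h1 : HasFDerivAt (fun x : Eu m => inner ℝ b x) (innerSL ℝ b) x :=
      (innerSL ℝ b).hasFDerivAt
    have h2 := (hasFDerivAt_id x).inner ℝ (M.hasFDerivAt (x := x))
    rw [hC']
    refine ((h1.const_add c₀).add h2).congr_fderiv ?_
    ext v
    simp [hS, ContinuousLinearMap.adjoint_inner_left, real_inner_comm]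
    ring
  have hGam : Q.Gam = ‖S‖ := by
    rw [Gam, hg]
    congr 1
    exact (S.hasFDerivAt.const_add b).fderiv
  rw [hGam, hg]
  simp only [add_sub_add_left_eq_sub, ← map_sub]
  exact S.le_opNorm _

end ControlProblem

end Problem

/-! ### Bounds for local defects -/

section Defect

variable {F : Type*} [NormedAddCommGroup F] [NormedSpace ℝ F] {ι ι' : Type*} [Fintype ι]
  [Fintype ι']

/-- The defect `∑ aᵢ v(t + h xᵢ) - ∑ bᵢ v(t + h zᵢ) - h ∑ kᵢ v'(t + h xᵢ)` of a linear multistep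
formula. -/
noncomputable def defect (a k x : ι → ℝ) (b z : ι' → ℝ) (v v' : ℝ → F) (t h : ℝ) : F :=
  ∑ i, a i • v (t + h * x i) - ∑ i, b i • v (t + h * z i) - h • ∑ i, k i • v' (t + h * x i)

/-- The defect of the formula at `t = 0`, `h = 1` for the monomial of degree `j`. -/
noncomputable def defectMoment (a k x : ι → ℝ) (b z : ι' → ℝ) (j : ℕ) : ℝ :=
  ∑ i, a i * x i ^ j - ∑ i, b i * z i ^ j - ∑ i, k i * (j * x i ^ (j - 1))

lemma sum_abs_mul_abs_pow_le {a x : ι → ℝ} {κ Z : ℝ} {n j r : ℕ} (ha : ∀ i, |a i| ≤ κ)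
    (hκ : 0 ≤ κ) (hx : ∀ i, |x i| ≤ Z) (hZ : 1 ≤ Z) (hι : Fintype.card ι ≤ n) (hj : j ≤ r) :
    ∑ i, |a i| * |x i| ^ j ≤ n * κ * Z ^ r := by
  have hZ0 : 0 ≤ Z := zero_le_one.trans hZ
  calc ∑ i, |a i| * |x i| ^ j ≤ ∑ _i : ι, κ * Z ^ r := by
        refine Finset.sum_le_sum fun i _ => ?_
        refine mul_le_mul (ha i) ?_ (by positivity) hκ
        exact (pow_le_pow_left₀ (abs_nonneg _) (hx i) j).trans (pow_le_pow_right₀ hZ hj)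
    _ = Fintype.card ι * (κ * Z ^ r) := by simp
    _ ≤ n * (κ * Z ^ r) := by
        refine mul_le_mul_of_nonneg_right (by exact_mod_cast hι) (by positivity)
    _ = _ := by ring

/-- Size of the leading coefficient and of the remainder of the defect of a formula of order `r`
whose data are bounded by `κ` and `Z`. -/
lemma defect_expansion {v v' : ℝ → F} {Ts t h M κ Z : ℝ} {r n : ℕ} (hTs : 0 < Ts)
    (hv : ContDiffOn ℝ (r + 1 : ℕ) v (Icc 0 Ts))
    (hv' : ∀ τ ∈ Icc 0 Ts, HasDerivWithinAt v (v' τ) (Icc 0 Ts) τ) {J : Set ℝ}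
    (hJ : J ⊆ Icc 0 Ts) (hM : ∀ τ ∈ J, ‖iteratedDerivWithin (r + 1) v (Icc 0 Ts) τ‖ ≤ M)
    (htJ : t ∈ J) (hh : 0 ≤ h)
    {a k x : ι → ℝ} {b z : ι' → ℝ} (hx : ∀ i, uIcc t (t + h * x i) ⊆ J)
    (hz : ∀ i, uIcc t (t + h * z i) ⊆ J) (hmom : ∀ j < r, defectMoment a k x b z j = 0)
    (hκ : 0 ≤ κ) (hZ : 1 ≤ Z) (ha : ∀ i, |a i| ≤ κ) (hk : ∀ i, |k i| ≤ κ) (hb : ∀ i, |b i| ≤ κ)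
    (hxZ : ∀ i, |x i| ≤ Z) (hzZ : ∀ i, |z i| ≤ Z) (hι : Fintype.card ι ≤ n)
    (hι' : Fintype.card ι' ≤ n) :
    |defectMoment a k x b z r| ≤ n * (r + 3) * κ * Z ^ (r + 1) ∧
    ‖defect a k x b z v v' t h - (defectMoment a k x b z r * (h ^ r / r.factorial)) •
        iteratedDerivWithin r v (Icc 0 Ts) t‖ ≤ n * (r + 3) * κ * Z ^ (r + 1) * (M * h ^ (r + 1)) := by
  have hC : 0 ≤ n * κ * Z ^ (r + 1) := by positivity
  have hM0 : 0 ≤ M := (norm_nonneg _).trans (hM t htJ)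
  constructor
  · have e1 := sum_abs_mul_abs_pow_le ha hκ hxZ hZ hι (r := r + 1) (Nat.le_succ r)
    have e2 := sum_abs_mul_abs_pow_le hb hκ hzZ hZ hι' (r := r + 1) (Nat.le_succ r)
    have e3 := sum_abs_mul_abs_pow_le hk hκ hxZ hZ hι (r := r + 1) ((Nat.sub_le r 1).trans (Nat.le_succ r))
    have f1 : |∑ i, a i * x i ^ r| ≤ ∑ i, |a i| * |x i| ^ r :=
      (Finset.abs_sum_le_sum_abs _ _).trans (le_of_eq (by simp [abs_mul, abs_pow]))
    have f2 : |∑ i, b i * z i ^ r| ≤ ∑ i, |b i| * |z i| ^ r :=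
      (Finset.abs_sum_le_sum_abs _ _).trans (le_of_eq (by simp [abs_mul, abs_pow]))
    have f3 : |∑ i, k i * (r * x i ^ (r - 1))| ≤ r * ∑ i, |k i| * |x i| ^ (r - 1) := by
      refine (Finset.abs_sum_le_sum_abs _ _).trans (le_of_eq ?_)
      rw [Finset.mul_sum]
      refine Finset.sum_congr rfl fun i _ => ?_
      rw [abs_mul, abs_mul, abs_pow, Nat.abs_cast]; ring
    have f4 := mul_le_mul_of_nonneg_left e3 (Nat.cast_nonneg (α := ℝ) r)
    refine (abs_sub _ _).trans ((add_le_add_left (abs_sub _ _) _).trans ?_)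
    linarith
  · have hf : ∀ j < r + 1, ∀ τ ∈ Icc 0 Ts, HasDerivWithinAt (iteratedDerivWithin j v (Icc 0 Ts))
        (iteratedDerivWithin (j + 1) v (Icc 0 Ts) τ) (Icc 0 Ts) τ := fun j hj τ hτ =>
      hasDerivWithinAt_iteratedDerivWithin hTs hv hj hτ
    have key := norm_defect_sub_le (Icc 0 Ts) J t h M hh r
      (fun j => iteratedDerivWithin j v (Icc 0 Ts)) hf hJ hM a k x b z hx hz
      (defectMoment a k x b z) (fun _ => rfl) hmom
    have e1 : ∀ i, iteratedDerivWithin 1 v (Icc 0 Ts) (t + h * x i) = v' (t + h * x i) := by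
      intro i
      have hm := hJ (hx i right_mem_uIcc)
      rw [iteratedDerivWithin_one]
      exact (hv' _ hm).derivWithin (uniqueDiffOn_Icc hTs _ hm)
    simp only [iteratedDerivWithin_zero, e1] at key
    refine key.trans (mul_le_mul_of_nonneg_right ?_ (by positivity))
    have e1 := sum_abs_mul_abs_pow_le ha hκ hxZ hZ hι (le_refl (r + 1))
    have e2 := sum_abs_mul_abs_pow_le hb hκ hzZ hZ hι' (le_refl (r + 1))
    have e3 := sum_abs_mul_abs_pow_le hk hκ hxZ hZ hι (r := r + 1) (Nat.le_succ r)
    have : 0 ≤ r * (n * κ * Z ^ (r + 1)) := by positivity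
    linarith

lemma norm_leading_le {M h μ C : ℝ} {r : ℕ} {w : F} (hh : 0 ≤ h) (hC : |μ| ≤ C) (hw : ‖w‖ ≤ M) :
    ‖(μ * (h ^ r / r.factorial)) • w‖ ≤ C * (h ^ r * M) := by
  have hM : 0 ≤ M := (norm_nonneg _).trans hw
  have hfac : (1 : ℝ) ≤ r.factorial := by exact_mod_cast Nat.one_le_iff_ne_zero.2 r.factorial_ne_zero
  rw [norm_smul, Real.norm_eq_abs, abs_mul, abs_of_nonneg (by positivity : 0 ≤ h ^ r / r.factorial),
    mul_assoc]
  refine mul_le_mul hC ?_ (by positivity) ((abs_nonneg _).trans hC)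
  exact mul_le_mul (div_le_self (by positivity) hfac) hw (norm_nonneg _) (by positivity)

/-- A defect of order `r`, without use of its leading coefficient. -/
lemma norm_le_of_expansion {M h μ C T : ℝ} {r : ℕ} {d w : F} (hh : 0 ≤ h) (hhT : h ≤ T)
    (hC : |μ| ≤ C) (hw : ‖w‖ ≤ M)
    (hd : ‖d - (μ * (h ^ r / r.factorial)) • w‖ ≤ C * (M * h ^ (r + 1))) :
    ‖d‖ ≤ C * (1 + T) * (h ^ r * M) := by
  have hM : 0 ≤ M := (norm_nonneg _).trans hw
  have hC0 : 0 ≤ C := (abs_nonneg _).trans hC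
  have h1 := norm_leading_le (r := r) hh hC hw
  have h2 : C * (M * h ^ (r + 1)) ≤ C * T * (h ^ r * M) := by
    have : C * (M * h ^ (r + 1)) = C * h * (h ^ r * M) := by ring
    rw [this]; gcongr
  calc ‖d‖ = ‖(d - (μ * (h ^ r / r.factorial)) • w) + (μ * (h ^ r / r.factorial)) • w‖ := by
        rw [sub_add_cancel]
    _ ≤ C * T * (h ^ r * M) + C * (h ^ r * M) := (norm_add_le _ _).trans (add_le_add (hd.trans h2) h1)
    _ = _ := by ring

/-- Splitting of a vector of defects of order `r` whose leading coefficients have a sum of size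
`O(h)`: up to terms of order `r + 1` the defects sum up to zero. -/
lemma exists_split_of_expansion [Nonempty ι] {M h C L : ℝ} {r : ℕ} {d : ι → F} {w : F} {μ : ι → ℝ}
    (hh : 0 ≤ h) (hC : ∀ i, |μ i| ≤ C) (hw : ‖w‖ ≤ M)
    (hd : ∀ i, ‖d i - (μ i * (h ^ r / r.factorial)) • w‖ ≤ C * (M * h ^ (r + 1)))
    (hL : |∑ i, μ i| ≤ L * h) :
    ∃ α β : ι → F, d = α + β ∧ ∑ i, β i = 0 ∧ ‖β‖ ≤ 2 * C * (h ^ r * M) ∧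
      ‖α‖ ≤ (C + L) * h * (h ^ r * M) := by
  have hM : 0 ≤ M := (norm_nonneg _).trans hw
  have hC0 : 0 ≤ C := (abs_nonneg _).trans (hC (Classical.arbitrary ι))
  have hLh : 0 ≤ L * h := (abs_nonneg _).trans hL
  have hn : (1 : ℝ) ≤ Fintype.card ι := by exact_mod_cast Fintype.card_pos
  set D : ℝ := (∑ i, μ i) / Fintype.card ι with hD
  have hD1 : |D| ≤ L * h := by
    rw [hD, abs_div, Nat.abs_cast]
    exact (div_le_self (abs_nonneg _) hn).trans hL
  have hD2 : |D| ≤ C := by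
    rw [hD, abs_div, Nat.abs_cast, div_le_iff₀ (by linarith)]
    refine (Finset.abs_sum_le_sum_abs _ _).trans ((Finset.sum_le_sum fun i _ => hC i).trans ?_)
    simp [mul_comm]
  set β : ι → F := fun i => ((μ i - D) * (h ^ r / r.factorial)) • w with hβ
  refine ⟨d - β, β, by abel, ?_, ?_, ?_⟩
  · rw [hβ, ← Finset.sum_smul, ← Finset.sum_mul, Finset.sum_sub_distrib]
    have : ∑ _i : ι, D = ∑ i, μ i := by
      rw [Finset.sum_const, Finset.card_univ, nsmul_eq_mul, hD]; field_simp
    rw [this]; simp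
  · refine (pi_norm_le_iff_of_nonneg (by positivity)).2 fun i => ?_
    refine norm_leading_le hh ?_ hw
    exact (abs_sub _ _).trans (by linarith [hC i])
  · refine (pi_norm_le_iff_of_nonneg ?_).2 fun i => ?_
    · have : (C + L) * h = C * h + L * h := by ring
      rw [this]; positivity
    · have e : (d - β) i = (d i - (μ i * (h ^ r / r.factorial)) • w)
          + (D * (h ^ r / r.factorial)) • w := by
        simp only [hβ, Pi.sub_apply, sub_mul, sub_smul]; abel
      rw [e]
      refine (norm_add_le _ _).trans ((add_le_add (hd i)
        (norm_leading_le hh hD1 hw)).trans (le_of_eq ?_))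
      ring

/-- Replacing weighted values at different nodes by the value at one node, when the weights satisfy
one-leg conditions. -/
lemma norm_oneLeg_sub_le {s : ℕ} {c : Fin s → ℝ} {L : Matrix (Fin s) (Fin s) ℝ} {n r : ℕ}
    (hn : 1 ≤ n) (hnr : n ≤ r) (h1 : ∀ k < n, OneLeg c L k) {I J : Set ℝ} {f : ℕ → ℝ → F}
    (hf : ∀ k < n, ∀ τ ∈ I, HasDerivWithinAt (f k) (f (k + 1) τ) I τ) (hJ : J ⊆ I) {M t h κ Z : ℝ}
    (hM : ∀ τ ∈ J, ‖f n τ‖ ≤ M) (htJ : t ∈ J) (hh : 0 ≤ h)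
    (hx : ∀ i, uIcc t (t + h * c i) ⊆ J) (hκ : 0 ≤ κ) (hZ : 1 ≤ Z) (hL : ∀ i j, |L i j| ≤ κ)
    (hc : ∀ i, |c i| ≤ Z) (i : Fin s) :
    ‖∑ j, L j i • f 0 (t + h * c j) - (∑ j, L j i) • f 0 (t + h * c i)‖ ≤
      2 * s * κ * Z ^ r * (h ^ n * M) := by
  have hM0 : 0 ≤ M := (norm_nonneg _).trans (hM t htJ)
  obtain ⟨k, rfl⟩ := Nat.exists_eq_add_of_le' hn
  set mom := defectMoment (fun j => L j i) (fun _ : Fin s => 0) c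
    (fun _ : Unit => ∑ j, L j i) (fun _ => c i) with hmomdef
  have hmom : ∀ l < k + 1, mom l = 0 := by
    intro l hl
    have := h1 l hl i
    simp only [hmomdef, defectMoment, Finset.univ_unique, Finset.sum_singleton, zero_mul,
      Finset.sum_const_zero, sub_zero]
    rw [← this, sub_eq_zero]
    exact Finset.sum_congr rfl fun j _ => mul_comm _ _
  have key := norm_defect_sub_le I J t h M hh k f hf hJ hM (fun j => L j i) (fun _ => 0) c
    (fun _ : Unit => ∑ j, L j i) (fun _ => c i) hx (fun _ => hx i) mom (fun _ => rfl)
    (fun l hl => hmom l (by omega))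
  rw [hmom k (by omega)] at key
  simp only [Finset.univ_unique, Finset.sum_singleton, zero_smul, Finset.sum_const_zero, smul_zero,
    sub_zero, zero_mul, abs_zero, add_zero] at key
  refine key.trans ?_
  have e1 : ∑ j, |L j i| * |c j| ^ (k + 1) ≤ s * κ * Z ^ r :=
    sum_abs_mul_abs_pow_le (fun j => hL j i) hκ hc hZ (by simp) hnr
  have e2 : |∑ j, L j i| ≤ s * κ :=
    (Finset.abs_sum_le_sum_abs _ _).trans
      ((Finset.sum_le_sum fun j _ => hL j i).trans (by simp))
  have e3 : |c i| ^ (k + 1) ≤ Z ^ r :=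
    (pow_le_pow_left₀ (abs_nonneg _) (hc i) _).trans (pow_le_pow_right₀ hZ hnr)
  have e4 : |∑ j, L j i| * |c i| ^ (k + 1) ≤ s * κ * Z ^ r :=
    mul_le_mul e2 e3 (by positivity) (by positivity)
  rw [mul_comm M]
  refine mul_le_mul_of_nonneg_right ?_ (by positivity)
  linarith

end Defect

/-! ### Grids -/

namespace Grid

variable {G : Grid} {cst T Tstar σlo σhi H : ℝ}

lemma t_succ (G : Grid) (n : ℕ) : G.t (n + 1) = G.t n + G.h n := Finset.sum_range_succ _ _

lemma Admissible.t_nonneg (hG : G.Admissible cst T Tstar σlo σhi H) {n : ℕ} (hn : n ≤ G.N + 1) :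
    0 ≤ G.t n :=
  Finset.sum_nonneg fun k hk => (hG.2.1 k (by have := Finset.mem_range.1 hk; omega)).le

lemma Admissible.sum_h (hG : G.Admissible cst T Tstar σlo σhi H) :
    ∑ n ∈ Finset.range (G.N + 1), G.h n = T := hG.2.2.1

lemma Admissible.h_le (hG : G.Admissible cst T Tstar σlo σhi H) {n : ℕ} (hn : n ≤ G.N) :
    G.h n ≤ T := by
  rw [← hG.sum_h]
  exact Finset.single_le_sum
    (fun k hk => (hG.2.1 k (by have := Finset.mem_range.1 hk; omega)).le)
    (Finset.mem_range.2 (by omega))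

lemma Admissible.window_subset (hG : G.Admissible cst T Tstar σlo σhi H) (n : ℕ) :
    G.window cst n ⊆ Icc 0 Tstar := by
  rintro x ⟨k, hk, -, -, hx⟩
  exact ⟨(hG.t_nonneg (by omega)).trans hx.1, hx.2.trans (hG.2.2.2.1 k hk)⟩

lemma cell_subset_window {k n : ℕ} (hk : k ≤ G.N) (h1 : n ≤ k + 1) (h2 : k ≤ n + 1) :
    G.cell cst k ⊆ G.window cst n := fun _ hx => ⟨k, hk, h1, h2, hx⟩

lemma Admissible.mem_cell (hG : G.Admissible cst T Tstar σlo σhi H) {n : ℕ} (hn : n ≤ G.N) {x : ℝ}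
    (hx0 : 0 ≤ x) (hx : x ≤ cst) : G.t n + G.h n * x ∈ G.cell cst n := by
  have := hG.2.1 n hn
  exact ⟨by nlinarith, by nlinarith⟩

lemma Admissible.t_mem_cell (hG : G.Admissible cst T Tstar σlo σhi H) (hc : 1 ≤ cst) {n : ℕ}
    (hn : n ≤ G.N) : G.t n ∈ G.cell cst n := by
  simpa using hG.mem_cell hn le_rfl (zero_le_one.trans hc)

lemma Admissible.uIcc_node_subset (hG : G.Admissible cst T Tstar σlo σhi H) (hc : 1 ≤ cst) {n : ℕ}
    (hn : n ≤ G.N) {x : ℝ} (hx0 : 0 ≤ x) (hx : x ≤ cst) :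
    uIcc (G.t n) (G.t n + G.h n * x) ⊆ G.window cst n :=
  (ordConnected_Icc.uIcc_subset (hG.t_mem_cell hc hn) (hG.mem_cell hn hx0 hx)).trans
    (cell_subset_window hn (by omega) (by omega))

lemma Admissible.node_mem (hG : G.Admissible cst T Tstar σlo σhi H) {n : ℕ}
    (hn : n ≤ G.N) {x : ℝ} (hx0 : 0 ≤ x) (hx : x ≤ cst) :
    G.t n + G.h n * x ∈ Icc 0 Tstar :=
  hG.window_subset n (cell_subset_window hn (by omega) (by omega) (hG.mem_cell hn hx0 hx))

/-- The nodes of the previous step, relative to `t_n`. -/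
lemma Admissible.prev_node (hG : G.Admissible cst T Tstar σlo σhi H) {n : ℕ} (hn1 : 1 ≤ n)
    (hn : n ≤ G.N) (x : ℝ) :
    G.t n + G.h n * ((x - 1) / G.ratio n) = G.t (n - 1) + G.h (n - 1) * x := by
  have h1 := (hG.2.1 n hn).ne'
  have h2 := (hG.2.1 (n - 1) (by omega)).ne'
  obtain ⟨k, rfl⟩ := Nat.exists_eq_add_of_le' hn1
  rw [t_succ, ratio]
  simp only [Nat.add_sub_cancel] at h2 ⊢
  field_simp
  ring

/-- The nodes of the next step, relative to `t_n`. -/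
lemma Admissible.next_node (hG : G.Admissible cst T Tstar σlo σhi H) {n : ℕ} (hn : n < G.N)
    (x : ℝ) :
    G.t n + G.h n * (1 + G.ratio (n + 1) * x) = G.t (n + 1) + G.h (n + 1) * x := by
  have h1 := (hG.2.1 n hn.le).ne'
  rw [t_succ, ratio, Nat.add_sub_cancel]
  field_simp
  ring

lemma Admissible.uIcc_prev_subset (hG : G.Admissible cst T Tstar σlo σhi H) (hc : 1 ≤ cst) {n : ℕ}
    (hn1 : 1 ≤ n) (hn : n ≤ G.N) {x : ℝ} (hx0 : 0 ≤ x) (hx : x ≤ cst) :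
    uIcc (G.t n) (G.t n + G.h n * ((x - 1) / G.ratio n)) ⊆ G.window cst n := by
  rw [hG.prev_node hn1 hn]
  have h1 : G.t n = G.t (n - 1) + G.h (n - 1) * 1 := by
    obtain ⟨k, rfl⟩ := Nat.exists_eq_add_of_le' hn1
    rw [t_succ]; simp
  have h2 : G.t n ∈ G.cell cst (n - 1) := by
    rw [h1]; exact hG.mem_cell (by omega) zero_le_one hc
  exact (ordConnected_Icc.uIcc_subset h2 (hG.mem_cell (by omega) hx0 hx)).trans
    (cell_subset_window (by omega) (by omega) (by omega))

lemma Admissible.uIcc_next_subset (hG : G.Admissible cst T Tstar σlo σhi H) (hc : 1 ≤ cst) {n : ℕ}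
    (hn : n < G.N) {x : ℝ} (hx0 : 0 ≤ x) (hx : x ≤ cst) :
    uIcc (G.t n) (G.t n + G.h n * (1 + G.ratio (n + 1) * x)) ⊆ G.window cst n := by
  rw [hG.next_node hn]
  have h0 := hG.2.1 n hn.le
  have h1 := hG.2.1 (n + 1) hn
  have hle : G.t n ≤ G.t (n + 1) + G.h (n + 1) * x := by rw [t_succ]; nlinarith
  rw [uIcc_of_le hle]
  intro τ hτ
  rcases le_total τ (G.t (n + 1)) with h | h
  · refine cell_subset_window hn.le (by omega) (by omega) ⟨hτ.1, h.trans ?_⟩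
    rw [t_succ]; nlinarith
  · exact cell_subset_window hn (by omega) (by omega) ⟨h, hτ.2.trans (by nlinarith)⟩

lemma le_maxOver (G : Grid) (f : ℕ → ℝ) {n : ℕ} (hn : n ≤ G.N) : f n ≤ G.maxOver f :=
  Finset.le_sup' f (Finset.mem_range.2 (by omega))

lemma maxOver_le {f : ℕ → ℝ} {b : ℝ} (h : ∀ n ≤ G.N, f n ≤ b) : G.maxOver f ≤ b :=
  Finset.sup'_le _ _ fun n hn => h n (by have := Finset.mem_range.1 hn; omega)

variable {m : ℕ} {v : ℝ → Eu m}

/-- The derivatives up to order `s` of a `C^s` function on `[0, b]` have a common bound. -/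
lemma exists_bound_iteratedDerivWithin {s : ℕ} {b : ℝ} (hb : 0 < b)
    (hv : ContDiffOn ℝ s v (Icc 0 b)) :
    ∃ M, 0 ≤ M ∧ ∀ k ≤ s, ∀ τ ∈ Icc 0 b, ‖iteratedDerivWithin k v (Icc 0 b) τ‖ ≤ M := by
  have h : ∀ k : Fin (s + 1), ∃ M, ∀ τ ∈ Icc 0 b, ‖iteratedDerivWithin k v (Icc 0 b) τ‖ ≤ M :=
    fun k => isCompact_Icc.exists_bound_of_continuousOn
      (hv.continuousOn_iteratedDerivWithin (by exact_mod_cast Nat.lt_succ_iff.1 k.2)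
        (uniqueDiffOn_Icc hb))
  choose M hM using h
  refine ⟨∑ k, |M k|, Finset.sum_nonneg fun _ _ => abs_nonneg _, fun k hk τ hτ => ?_⟩
  exact (hM ⟨k, by omega⟩ τ hτ).trans ((le_abs_self _).trans
    (Finset.single_le_sum (f := fun k => |M k|) (fun _ _ => abs_nonneg _) (Finset.mem_univ _)))

lemma Admissible.norm_le_semi (hG : G.Admissible cst T Tstar σlo σhi H) (hTs : 0 < Tstar) {s : ℕ}
    (hv : ContDiffOn ℝ s v (Icc 0 Tstar)) {r₁ r₂ k n : ℕ} (h1 : r₁ ≤ k) (h2 : k ≤ r₂) (h3 : r₂ ≤ s)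
    {τ : ℝ} (hτ : τ ∈ G.window cst n) :
    ‖iteratedDerivWithin k v (Icc 0 Tstar) τ‖ ≤ G.semi cst Tstar v r₁ r₂ n := by
  obtain ⟨M, -, hM⟩ := exists_bound_iteratedDerivWithin hTs hv
  refine le_csSup ⟨M, ?_⟩ ⟨k, h1, h2, τ, hτ, rfl⟩
  rintro _ ⟨l, -, hl, ξ, hξ, rfl⟩
  exact hM l (hl.trans h3) ξ (hG.window_subset n hξ)

lemma semi_nonneg (G : Grid) (cst Tstar : ℝ) (v : ℝ → Eu m) (r₁ r₂ n : ℕ) :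
    0 ≤ G.semi cst Tstar v r₁ r₂ n :=
  Real.sSup_nonneg (by rintro _ ⟨k, -, -, τ, -, rfl⟩; exact norm_nonneg _)

lemma Admissible.semi_le (hG : G.Admissible cst T Tstar σlo σhi H) {M : ℝ} {s : ℕ} (hM0 : 0 ≤ M)
    (hM : ∀ k ≤ s, ∀ τ ∈ Icc 0 Tstar, ‖iteratedDerivWithin k v (Icc 0 Tstar) τ‖ ≤ M) {r₁ r₂ n : ℕ}
    (h : r₂ ≤ s) : G.semi cst Tstar v r₁ r₂ n ≤ M :=
  Real.sSup_le (by
    rintro _ ⟨k, -, hk, τ, hτ, rfl⟩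
    exact hM k (hk.trans h) τ (hG.window_subset n hτ)) hM0

end Grid

/-! ### Residuals of the exact solution -/

namespace PeerTriplet

/-- The constant in the bounds for local defects. -/
noncomputable def defectConst (r : ℕ) (κ : ℝ) : ℝ :=
  (r + 1 : ℕ) * (r + 3) * κ * (2 * κ ^ 2) ^ (r + 1)

lemma c_le_cstar {s : ℕ} (X : PeerTriplet s) (i : Fin s) : X.c i ≤ X.cstar :=
  (le_ciSup (Set.finite_range X.c).bddAbove i).trans (le_max_right _ _)

lemma one_le_cstar {s : ℕ} (X : PeerTriplet s) : 1 ≤ X.cstar := le_max_left _ _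

/-- The quantity `max_n h_n^{s-1} ‖v^{(s-1:s)}‖_{[n]}` of the error bound. -/
noncomputable def derivBound {s m : ℕ} (X : PeerTriplet s) (G : Grid) (v : ℝ → Eu m)
    (Tstar : ℝ) : ℝ :=
  G.maxOver fun n => G.h n ^ (s - 1) * G.semi X.cstar Tstar v (s - 1) s n

variable {r m : ℕ} {X : PeerTriplet (r + 1)} {W : Matrix (Fin (r + 1)) (Fin (r + 1)) ℝ}
  {σlo σhi κ T Tstar H : ℝ} {G : Grid} {v v' : ℝ → Eu m}

lemma le_derivBound {n : ℕ} (hn : n ≤ G.N) :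
    G.h n ^ r * G.semi X.cstar Tstar v r (r + 1) n ≤ X.derivBound G v Tstar :=
  G.le_maxOver (fun n => G.h n ^ (r + 1 - 1) * G.semi X.cstar Tstar v (r + 1 - 1) (r + 1) n) hn

lemma derivBound_nonneg (hG : G.Admissible X.cstar T Tstar σlo σhi H) :
    0 ≤ X.derivBound G v Tstar :=
  (mul_nonneg (pow_nonneg (hG.2.1 0 (Nat.zero_le _)).le _) (G.semi_nonneg _ _ _ _ _ _)).trans
    (le_derivBound (Nat.zero_le _))

lemma defectConst_nonneg (hκ : 0 ≤ κ) : 0 ≤ defectConst r κ := by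
  unfold defectConst; positivity

namespace BoundedBy

lemma nonneg (hκ : X.BoundedBy W σlo σhi κ) : 0 ≤ κ := zero_le_one.trans hκ.one_le

lemma one_le_two_mul_sq (hκ : X.BoundedBy W σlo σhi κ) : 1 ≤ 2 * κ ^ 2 := by
  nlinarith [hκ.one_le]

lemma le_two_mul_sq (hκ : X.BoundedBy W σlo σhi κ) : κ ≤ 2 * κ ^ 2 := by
  nlinarith [hκ.one_le]

lemma abs_c_le (hκ : X.BoundedBy W σlo σhi κ) (hc : ∀ i, 0 ≤ X.c i) (i : Fin (r + 1)) :
    |X.c i| ≤ 2 * κ ^ 2 := by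
  rw [abs_of_nonneg (hc i)]
  exact (hκ.c i).trans hκ.le_two_mul_sq

lemma abs_prev_le (hκ : X.BoundedBy W σlo σhi κ) (hc : ∀ i, 0 ≤ X.c i) (hlo : 0 < σlo) {σ : ℝ}
    (hσ : σ ∈ Icc σlo σhi) (i : Fin (r + 1)) : |(X.c i - 1) / σ| ≤ 2 * κ ^ 2 := by
  have hσ0 : 0 < σ := hlo.trans_le hσ.1
  have h1 : |X.c i - 1| ≤ κ := by
    rw [abs_le]; constructor <;> linarith [hc i, hκ.c i, hκ.one_le]
  have h2 : σ⁻¹ ≤ κ := (inv_anti₀ hlo hσ.1).trans hκ.lo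
  rw [abs_div, abs_of_pos hσ0, div_eq_mul_inv]
  have := mul_le_mul h1 h2 (by positivity) hκ.nonneg
  nlinarith [hκ.nonneg]

lemma abs_next_le (hκ : X.BoundedBy W σlo σhi κ) (hc : ∀ i, 0 ≤ X.c i) (hlo : 0 < σlo) {σ : ℝ}
    (hσ : σ ∈ Icc σlo σhi) (i : Fin (r + 1)) : |1 + σ * X.c i| ≤ 2 * κ ^ 2 := by
  have hσ0 : 0 < σ := hlo.trans_le hσ.1
  have h1 : σ * X.c i ≤ κ * κ := mul_le_mul (hσ.2.trans hκ.hi) (hκ.c i) (hc i) hκ.nonneg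
  have h2 : 0 ≤ σ * X.c i := mul_nonneg hσ0.le (hc i)
  rw [abs_of_nonneg (by linarith)]
  nlinarith [hκ.one_le]

end BoundedBy

/-- Expansion of a defect in step `n` whose nodes outside of the step lie in the window of `n`. -/
lemma step_expansion (hκ : X.BoundedBy W σlo σhi κ) (hc : ∀ i, 0 ≤ X.c i)
    (hG : G.Admissible X.cstar T Tstar σlo σhi H) (hTs : 0 < Tstar)
    (hv : ContDiffOn ℝ (r + 1 : ℕ) v (Icc 0 Tstar))
    (hv' : ∀ τ ∈ Icc 0 Tstar, HasDerivWithinAt v (v' τ) (Icc 0 Tstar) τ) {n : ℕ} (hn : n ≤ G.N)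
    {ι : Type*} [Fintype ι] {a k : Fin (r + 1) → ℝ} {b z : ι → ℝ}
    (hz : ∀ i, uIcc (G.t n) (G.t n + G.h n * z i) ⊆ G.window X.cstar n)
    (hmom : ∀ j < r, defectMoment a k X.c b z j = 0)
    (ha : ∀ i, |a i| ≤ κ) (hk : ∀ i, |k i| ≤ κ) (hb : ∀ i, |b i| ≤ κ)
    (hzZ : ∀ i, |z i| ≤ 2 * κ ^ 2) (hι : Fintype.card ι ≤ r + 1) :
    |defectMoment a k X.c b z r| ≤ defectConst r κ ∧
    ‖defect a k X.c b z v v' (G.t n) (G.h n)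
      - (defectMoment a k X.c b z r * (G.h n ^ r / r.factorial)) •
        iteratedDerivWithin r v (Icc 0 Tstar) (G.t n)‖ ≤
      defectConst r κ * (G.semi X.cstar Tstar v r (r + 1) n * G.h n ^ (r + 1)) :=
  defect_expansion hTs hv hv' (hG.window_subset n)
    (fun τ hτ => hG.norm_le_semi hTs hv (Nat.le_succ r) le_rfl le_rfl hτ)
    (Grid.cell_subset_window hn (by omega) (by omega) (hG.t_mem_cell X.one_le_cstar hn))
    (hG.2.1 n hn).le
    (fun i => hG.uIcc_node_subset X.one_le_cstar hn (hc i) (X.c_le_cstar i)) hz hmom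
    hκ.nonneg hκ.one_le_two_mul_sq ha hk hb (hκ.abs_c_le hc) hzZ (by simp) hι

lemma norm_step_le (hκ : X.BoundedBy W σlo σhi κ) (hc : ∀ i, 0 ≤ X.c i)
    (hG : G.Admissible X.cstar T Tstar σlo σhi H) (hTs : 0 < Tstar)
    (hv : ContDiffOn ℝ (r + 1 : ℕ) v (Icc 0 Tstar))
    (hv' : ∀ τ ∈ Icc 0 Tstar, HasDerivWithinAt v (v' τ) (Icc 0 Tstar) τ) {n : ℕ} (hn : n ≤ G.N)
    {ι : Type*} [Fintype ι] {a k : Fin (r + 1) → ℝ} {b z : ι → ℝ}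
    (hz : ∀ i, uIcc (G.t n) (G.t n + G.h n * z i) ⊆ G.window X.cstar n)
    (hmom : ∀ j < r, defectMoment a k X.c b z j = 0)
    (ha : ∀ i, |a i| ≤ κ) (hk : ∀ i, |k i| ≤ κ) (hb : ∀ i, |b i| ≤ κ)
    (hzZ : ∀ i, |z i| ≤ 2 * κ ^ 2) (hι : Fintype.card ι ≤ r + 1) :
    ‖defect a k X.c b z v v' (G.t n) (G.h n)‖ ≤
      defectConst r κ * (1 + T) * X.derivBound G v Tstar := by
  obtain ⟨h1, h2⟩ := step_expansion hκ hc hG hTs hv hv' hn hz hmom ha hk hb hzZ hι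
  have hT : 0 ≤ T := (hG.2.1 n hn).le.trans (hG.h_le hn)
  refine (norm_le_of_expansion (hG.2.1 n hn).le (hG.h_le hn) h1
    (hG.norm_le_semi hTs hv le_rfl (Nat.le_succ r) le_rfl (Grid.cell_subset_window hn (by omega)
      (by omega) (hG.t_mem_cell X.one_le_cstar hn))) h2).trans ?_
  exact mul_le_mul_of_nonneg_left (le_derivBound hn)
    (mul_nonneg (defectConst_nonneg hκ.nonneg) (by linarith))

/-- Splitting of the defects of a standard step into a part with vanishing sum, of order `s - 1`,
and a part of order `s`. -/
lemma exists_step_split (hκ : X.BoundedBy W σlo σhi κ) (hc : ∀ i, 0 ≤ X.c i)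
    (hG : G.Admissible X.cstar T Tstar σlo σhi H) (hTs : 0 < Tstar)
    (hv : ContDiffOn ℝ (r + 1 : ℕ) v (Icc 0 Tstar))
    (hv' : ∀ τ ∈ Icc 0 Tstar, HasDerivWithinAt v (v' τ) (Icc 0 Tstar) τ) {n : ℕ} (hn : n ≤ G.N)
    {L : ℝ} (hL0 : 0 ≤ L) {a k b : Fin (r + 1) → Fin (r + 1) → ℝ} {z : Fin (r + 1) → ℝ}
    (hz : ∀ i, uIcc (G.t n) (G.t n + G.h n * z i) ⊆ G.window X.cstar n)
    (hmom : ∀ i, ∀ j < r, defectMoment (a i) (k i) X.c (b i) z j = 0)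
    (ha : ∀ i j, |a i j| ≤ κ) (hk : ∀ i j, |k i j| ≤ κ) (hb : ∀ i j, |b i j| ≤ κ)
    (hzZ : ∀ i, |z i| ≤ 2 * κ ^ 2)
    (hL : |∑ i, defectMoment (a i) (k i) X.c (b i) z r| ≤ L * G.h n) :
    ∃ α β : Fin (r + 1) → Eu m,
      (fun i => defect (a i) (k i) X.c (b i) z v v' (G.t n) (G.h n)) = α + β ∧ ∑ i, β i = 0 ∧
      ‖β‖ ≤ 2 * defectConst r κ * X.derivBound G v Tstar ∧
      ‖α‖ ≤ (defectConst r κ + L) * G.h n * X.derivBound G v Tstar := by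
  have h := fun i => step_expansion hκ hc hG hTs hv hv' hn hz (hmom i) (ha i) (hk i) (hb i) hzZ
    (by simp)
  have hh := (hG.2.1 n hn).le
  obtain ⟨α, β, h1, h2, h3, h4⟩ := exists_split_of_expansion (w :=
      iteratedDerivWithin r v (Icc 0 Tstar) (G.t n)) hh (fun i => (h i).1)
    (hG.norm_le_semi hTs hv le_rfl (Nat.le_succ r) le_rfl (Grid.cell_subset_window hn (by omega)
      (by omega) (hG.t_mem_cell X.one_le_cstar hn))) (fun i => (h i).2) hL
  have hC := defectConst_nonneg (r := r) hκ.nonneg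
  refine ⟨α, β, h1, h2, h3.trans (mul_le_mul_of_nonneg_left (le_derivBound hn) (by positivity)),
    h4.trans (mul_le_mul_of_nonneg_left (le_derivBound hn) (by positivity))⟩

/-- Residual of the exact values in a forward step. -/
noncomputable def stateResidual (X : PeerTriplet (r + 1)) (G : Grid)
    (M L : Matrix (Fin (r + 1)) (Fin (r + 1)) ℝ)
    (v v' : ℝ → Eu m) (n : ℕ) : Fin (r + 1) → Eu m :=
  stageMul M (X.exact G v n) - stageMul (X.B (G.ratio n)) (X.exact G v (n - 1))
    - G.h n • stageMul L (X.exact G v' n)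

/-- Residual of the exact values in an adjoint step, where `-v'` stands for the values of `φ`
combined with the columns of the matrix `L`. -/
noncomputable def adjointResidual (X : PeerTriplet (r + 1)) (G : Grid)
    (M L : Matrix (Fin (r + 1)) (Fin (r + 1)) ℝ) (v v' : ℝ → Eu m) (n : ℕ) : Fin (r + 1) → Eu m :=
  stageMul M.transpose (X.exact G v n)
    - stageMul (X.B (G.ratio (n + 1))).transpose (X.exact G v (n + 1))
    + G.h n • stageMul L.transpose (X.exact G v' n)

lemma stateResidual_eq (hG : G.Admissible X.cstar T Tstar σlo σhi H)
    (M L : Matrix (Fin (r + 1)) (Fin (r + 1)) ℝ) {n : ℕ} (hn1 : 1 ≤ n) (hn : n ≤ G.N) :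
    stateResidual X G M L v v' n = fun i => defect (M i) (L i) X.c (X.B (G.ratio n) i)
      (fun j => (X.c j - 1) / G.ratio n) v v' (G.t n) (G.h n) := by
  funext i
  simp only [stateResidual, defect, hG.prev_node hn1 hn, stageMul, exact, Pi.sub_apply,
    Pi.smul_apply]

lemma adjointResidual_eq (hG : G.Admissible X.cstar T Tstar σlo σhi H)
    (M L : Matrix (Fin (r + 1)) (Fin (r + 1)) ℝ) {n : ℕ} (hn : n < G.N) :
    adjointResidual X G M L v v' n = fun i => defect (fun j => M j i) (fun j => -L j i) X.c
      (fun j => X.B (G.ratio (n + 1)) j i)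
      (fun j => 1 + G.ratio (n + 1) * X.c j) v v' (G.t n) (G.h n) := by
  funext i
  simp only [adjointResidual, defect, hG.next_node hn, stageMul, exact, Pi.sub_apply, Pi.add_apply,
    Pi.smul_apply, Matrix.transpose_apply, neg_smul, Finset.sum_neg_distrib, smul_neg, sub_neg_eq_add]

lemma exists_stateResidual_split (hκ : X.BoundedBy W σlo σhi κ) (hc : ∀ i, 0 ≤ X.c i)
    (hlo : 0 < σlo) (hstd : X.StandardOrder r r)
    (hG : G.Admissible X.cstar T Tstar σlo σhi H) (hTs : 0 < Tstar)
    (hv : ContDiffOn ℝ (r + 1 : ℕ) v (Icc 0 Tstar))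
    (hv' : ∀ τ ∈ Icc 0 Tstar, HasDerivWithinAt v (v' τ) (Icc 0 Tstar) τ) {n : ℕ} (hn1 : 1 ≤ n)
    (hn : n ≤ G.N) {L : ℝ} (hL0 : 0 ≤ L) (hL : |X.supState r (G.ratio n)| ≤ L * G.h n) :
    ∃ α β : Fin (r + 1) → Eu m,
      stateResidual X G X.A X.K v v' n = α + β ∧ ∑ i, β i = 0 ∧
      ‖β‖ ≤ 2 * defectConst r κ * X.derivBound G v Tstar ∧
      ‖α‖ ≤ (defectConst r κ + L) * G.h n * X.derivBound G v Tstar := by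
  have hσ := hG.2.2.2.2.1 n hn1 hn
  have hσ0 := hlo.trans_le hσ.1
  rw [stateResidual_eq hG _ _ hn1 hn]
  refine exists_step_split (a := X.A) (k := X.K) (b := X.B (G.ratio n)) hκ hc hG hTs hv hv' hn hL0
    (fun i => hG.uIcc_prev_subset X.one_le_cstar hn1 hn (hc i) (X.c_le_cstar i))
    (fun i j hj => forward_moment hσ0 (hstd.1 _ hσ0) i hj) (hκ.A _ (by simp)) (hκ.K _ (by simp))
    (hκ.B _ hσ) (hκ.abs_prev_le hc hlo hσ) ?_
  convert hL using 2
  refine Finset.sum_congr rfl fun i _ => ?_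
  rw [defectMoment, ← Finset.sum_sub_distrib, ← Finset.sum_sub_distrib]
  refine Finset.sum_congr rfl fun j _ => ?_
  rw [div_pow]; ring

lemma exists_adjointResidual_split (hκ : X.BoundedBy W σlo σhi κ) (hc : ∀ i, 0 ≤ X.c i)
    (hlo : 0 < σlo) (hK : X.K.IsDiag) (hstd : X.StandardOrder r r)
    (hG : G.Admissible X.cstar T Tstar σlo σhi H) (hTs : 0 < Tstar)
    (hv : ContDiffOn ℝ (r + 1 : ℕ) v (Icc 0 Tstar))
    (hv' : ∀ τ ∈ Icc 0 Tstar, HasDerivWithinAt v (v' τ) (Icc 0 Tstar) τ) {n : ℕ}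
    (hn : n < G.N) {L : ℝ} (hL0 : 0 ≤ L)
    (hL : |X.supAdjoint r (G.ratio (n + 1))| ≤ L * G.h n) :
    ∃ α β : Fin (r + 1) → Eu m,
      adjointResidual X G X.A X.K v v' n = α + β ∧ ∑ i, β i = 0 ∧
      ‖β‖ ≤ 2 * defectConst r κ * X.derivBound G v Tstar ∧
      ‖α‖ ≤ (defectConst r κ + L) * G.h n * X.derivBound G v Tstar := by
  have hσ := hG.2.2.2.2.1 (n + 1) (by omega) hn
  have hσ0 := hlo.trans_le hσ.1
  rw [adjointResidual_eq hG _ _ hn]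
  refine exists_step_split (a := fun i j => X.A j i) (k := fun i j => -X.K j i)
    (b := fun i j => X.B (G.ratio (n + 1)) j i) hκ hc hG hTs hv hv' hn.le hL0
    (fun i => hG.uIcc_next_subset X.one_le_cstar hn (hc i) (X.c_le_cstar i))
    (fun i j hj => adjoint_moment (hstd.2.1 _ hσ0) i hj) (fun i j => hκ.A _ (by simp) j i)
    (fun i j => by rw [abs_neg]; exact hκ.K _ (by simp) j i)
    (fun i j => hκ.B _ hσ j i) (hκ.abs_next_le hc hlo hσ) ?_
  convert hL using 2
  refine Finset.sum_congr rfl fun i _ => ?_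
  rw [defectMoment, ← Finset.sum_sub_distrib, ← Finset.sum_sub_distrib]
  refine Finset.sum_congr rfl fun j _ => ?_
  have : X.K j i = X.K i j := by
    by_cases hij : i = j
    · rw [hij]
    · rw [hK hij, hK (Ne.symm hij)]
  rw [this]; ring

lemma norm_stateResidual_end_le (hκ : X.BoundedBy W σlo σhi κ) (hc : ∀ i, 0 ≤ X.c i)
    (hlo : 0 < σlo) {qb : ℕ} (hend : X.EndOrder r r qb)
    (hG : G.Admissible X.cstar T Tstar σlo σhi H) (hTs : 0 < Tstar)
    (hv : ContDiffOn ℝ (r + 1 : ℕ) v (Icc 0 Tstar))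
    (hv' : ∀ τ ∈ Icc 0 Tstar, HasDerivWithinAt v (v' τ) (Icc 0 Tstar) τ) :
    ‖stateResidual X G X.AN X.KN v v' G.N‖ ≤
      defectConst r κ * (1 + T) * X.derivBound G v Tstar := by
  have hσ := hG.2.2.2.2.1 G.N hG.1 le_rfl
  have hσ0 := hlo.trans_le hσ.1
  rw [stateResidual_eq hG _ _ hG.1 le_rfl]
  refine (pi_norm_le_iff_of_nonempty _).2 fun i => ?_
  exact norm_step_le hκ hc hG hTs hv hv' le_rfl
    (fun i => hG.uIcc_prev_subset X.one_le_cstar hG.1 le_rfl (hc i) (X.c_le_cstar i))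
    (fun j hj => forward_moment hσ0 (hend.1 _ hσ0) i hj) (hκ.A _ (by simp) i) (hκ.K _ (by simp) i)
    (hκ.B _ hσ i) (hκ.abs_prev_le hc hlo hσ) (by simp)

lemma norm_adjointResidual_start_le (hκ : X.BoundedBy W σlo σhi κ) (hc : ∀ i, 0 ≤ X.c i)
    (hlo : 0 < σlo) {qb : ℕ} (hstart : X.StartOrder r r qb)
    (hG : G.Admissible X.cstar T Tstar σlo σhi H) (hTs : 0 < Tstar)
    (hv : ContDiffOn ℝ (r + 1 : ℕ) v (Icc 0 Tstar))
    (hv' : ∀ τ ∈ Icc 0 Tstar, HasDerivWithinAt v (v' τ) (Icc 0 Tstar) τ) :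
    ‖adjointResidual X G X.A0 X.K0 v v' 0‖ ≤
      defectConst r κ * (1 + T) * X.derivBound G v Tstar := by
  have hN : 0 < G.N := hG.1
  have hσ := hG.2.2.2.2.1 1 le_rfl hN
  have hσ0 := hlo.trans_le hσ.1
  rw [adjointResidual_eq hG _ _ hN]
  refine (pi_norm_le_iff_of_nonempty _).2 fun i => ?_
  exact norm_step_le hκ hc hG hTs hv hv' (Nat.zero_le _)
    (fun i => hG.uIcc_next_subset X.one_le_cstar hN (hc i) (X.c_le_cstar i))
    (fun j hj => adjoint_moment (hstart.2.1 _ hσ0) i hj) (fun j => hκ.A _ (by simp) j i)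
    (fun j => by rw [abs_neg]; exact hκ.K _ (by simp) j i)
    (fun j => hκ.B _ hσ j i) (hκ.abs_next_le hc hlo hσ) (by simp)

lemma norm_stateResidual_start_le (hκ : X.BoundedBy W σlo σhi κ) (hc : ∀ i, 0 ≤ X.c i)
    {qb : ℕ} (hstart : X.StartOrder r r qb)
    (hG : G.Admissible X.cstar T Tstar σlo σhi H) (hTs : 0 < Tstar)
    (hv : ContDiffOn ℝ (r + 1 : ℕ) v (Icc 0 Tstar))
    (hv' : ∀ τ ∈ Icc 0 Tstar, HasDerivWithinAt v (v' τ) (Icc 0 Tstar) τ) :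
    ‖stageMul X.A0 (X.exact G v 0) - (fun i => X.a i • v 0)
        - G.h 0 • stageMul X.K0 (X.exact G v' 0)‖ ≤
      defectConst r κ * (1 + T) * X.derivBound G v Tstar := by
  refine (pi_norm_le_iff_of_nonempty _).2 fun i => ?_
  have hz : uIcc (G.t 0) (G.t 0 + G.h 0 * 0) ⊆ G.window X.cstar 0 :=
    hG.uIcc_node_subset X.one_le_cstar (Nat.zero_le _) le_rfl (zero_le_one.trans X.one_le_cstar)
  have key := norm_step_le (a := X.A0 i) (k := X.K0 i) (b := fun _ : Unit => X.a i)
    (z := fun _ => 0) hκ hc hG hTs hv hv' (Nat.zero_le _) (fun _ => hz)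
    (fun j hj => start_moment hstart i hj) (hκ.A _ (by simp) i) (hκ.K _ (by simp) i)
    (fun _ => hκ.a i) (fun _ => by simp; positivity) (by simp)
  have ht : G.t 0 = 0 := by simp [Grid.t]
  simpa [defect, stageMul, exact, ht] using key

lemma norm_adjointResidual_end_le (hκ : X.BoundedBy W σlo σhi κ) (hc : ∀ i, 0 ≤ X.c i)
    {qb : ℕ} (hend : X.EndOrder r r qb)
    (hG : G.Admissible X.cstar T Tstar σlo σhi H) (hTs : 0 < Tstar)
    (hv : ContDiffOn ℝ (r + 1 : ℕ) v (Icc 0 Tstar))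
    (hv' : ∀ τ ∈ Icc 0 Tstar, HasDerivWithinAt v (v' τ) (Icc 0 Tstar) τ) :
    ‖stageMul X.AN.transpose (X.exact G v G.N) - (fun i => X.w i • v T)
        + G.h G.N • stageMul X.KN.transpose (X.exact G v' G.N)‖ ≤
      defectConst r κ * (1 + T) * X.derivBound G v Tstar := by
  refine (pi_norm_le_iff_of_nonempty _).2 fun i => ?_
  have hz : uIcc (G.t G.N) (G.t G.N + G.h G.N * 1) ⊆ G.window X.cstar G.N :=
    hG.uIcc_node_subset X.one_le_cstar le_rfl zero_le_one X.one_le_cstar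
  have key := norm_step_le (a := fun j => X.AN j i) (k := fun j => -X.KN j i)
    (b := fun _ : Unit => X.w i)
    (z := fun _ => 1) hκ hc hG hTs hv hv' le_rfl (fun _ => hz)
    (fun j hj => end_moment hend i hj) (fun j => hκ.A _ (by simp) j i)
    (fun j => by rw [abs_neg]; exact hκ.K _ (by simp) j i)
    (fun _ => hκ.w i) (fun _ => by rw [abs_one]; exact hκ.one_le_two_mul_sq) (by simp)
  have ht : G.t G.N + G.h G.N = T := by rw [← G.t_succ, hG.2.2.1]
  simpa [defect, stageMul, exact, ht] using key

/-- The weights `w` of the end method evaluate the state at the end point. -/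
lemma norm_end_value_sub_le (hκ : X.BoundedBy W σlo σhi κ) (hc : ∀ i, 0 ≤ X.c i)
    {qb : ℕ} (hend : X.EndOrder r r qb)
    (hG : G.Admissible X.cstar T Tstar σlo σhi H) (hTs : 0 < Tstar)
    (hv : ContDiffOn ℝ (r + 1 : ℕ) v (Icc 0 Tstar))
    (hv' : ∀ τ ∈ Icc 0 Tstar, HasDerivWithinAt v (v' τ) (Icc 0 Tstar) τ) :
    ‖∑ j, X.w j • X.exact G v G.N j - v T‖ ≤
      defectConst r κ * (1 + T) * X.derivBound G v Tstar := by
  have hz : uIcc (G.t G.N) (G.t G.N + G.h G.N * 1) ⊆ G.window X.cstar G.N :=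
    hG.uIcc_node_subset X.one_le_cstar le_rfl zero_le_one X.one_le_cstar
  have key := norm_step_le (a := X.w) (k := fun _ => 0) (b := fun _ : Unit => 1)
    (z := fun _ => 1) hκ hc hG hTs hv hv' le_rfl (fun _ => hz)
    (fun j hj => by have := hend.2.1 ⟨j, hj⟩; simp_all [defectMoment]) hκ.w
    (fun _ => by simpa using hκ.nonneg)
    (fun _ => by simpa using hκ.one_le) (fun _ => by rw [abs_one]; exact hκ.one_le_two_mul_sq)
    (by simp)
  have ht : G.t G.N + G.h G.N = T := by rw [← G.t_succ, hG.2.2.1]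
  simpa [defect, exact, ht] using key

end PeerTriplet

/-! ### Stability of the forward and the adjoint recursion -/

namespace PeerTriplet

variable {r m d : ℕ} {X : PeerTriplet (r + 1)} {W : Matrix (Fin (r + 1)) (Fin (r + 1)) ℝ}
  {σlo σhi κ γ T Tstar H : ℝ} {G : Grid}

/-- The constant in the stability estimates. -/
noncomputable def stabConst (r : ℕ) (κ γ : ℝ) : ℝ := ((r + 1 : ℕ) : ℝ) ^ 3 * κ ^ 6 / (1 - γ)

lemma stabConst_nonneg (hγ : γ < 1) : 0 ≤ stabConst r κ γ :=
  div_nonneg (by positivity) (by linarith)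

/-- `recursion_bound` for stage vectors, with all constants expressed through `κ` and `γ`. -/
lemma stage_recursion_bound (ν : Seminorm ℝ (Fin (r + 1) → Eu m))
    (J : Matrix (Fin (r + 1)) (Fin (r + 1)) ℝ)
    (M E : ℕ → Matrix (Fin (r + 1)) (Fin (r + 1)) ℝ) {N : ℕ} (hN : 1 ≤ N) (hγ0 : 0 ≤ γ)
    (hγ : γ < 1) (hκ : 1 ≤ κ) {b : ℝ} (hb : 0 ≤ b) (hν1 : ∀ x, ν x ≤ κ * ‖x‖)
    (hν2 : ∀ x, ‖x‖ ≤ κ * ν x)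
    (hM : ∀ n, 1 ≤ n → n < N → ∀ x : Fin (r + 1) → Eu m, ν (stageMul (M n) x) ≤ ν x)
    (hMγ : ∀ n, 1 ≤ n → n < N → ∀ x : Fin (r + 1) → Eu m, stageMul J x = 0 →
      stageMul J (stageMul (M n) x) = 0 ∧ ν (stageMul (M n) x) ≤ γ * ν x)
    (hMN : ∀ x : Fin (r + 1) → Eu m,
      ‖stageMul (M N) x‖ ≤ (r + 1 : ℕ) * κ * ((r + 1 : ℕ) * κ * ‖x‖))
    (hE : ∀ n ≤ N, ∀ i j, |E n i j| ≤ κ)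
    (hJ : ∀ n, 1 ≤ n → n < N → ∀ x : Fin (r + 1) → Eu m, ∑ i, x i = 0 →
      stageMul J (stageMul (E n) x) = 0)
    (Z α β : ℕ → Fin (r + 1) → Eu m) (h0 : Z 0 = stageMul (E 0) (α 0))
    (hZ : ∀ n, 1 ≤ n → n < N →
      Z n = stageMul (M n) (Z (n - 1)) + stageMul (E n) (α n + β n))
    (hZN : Z N = stageMul (M N) (Z (N - 1)) + stageMul (E N) (α N))
    (hβ : ∀ n, 1 ≤ n → n < N → ∑ i, β n i = 0 ∧ ‖β n‖ ≤ b) :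
    ∀ n ≤ N, ν (Z n) ≤ stabConst r κ γ * (∑ j ∈ Finset.range (N + 1), ‖α j‖ + b) := by
  set S : ℝ := ((r + 1 : ℕ) : ℝ) with hS
  have hS1 : 1 ≤ S := by rw [hS]; exact_mod_cast Nat.succ_pos r
  have hκ0 : 0 ≤ κ := by linarith
  have hγ' : 0 < 1 - γ := by linarith
  have hEν : ∀ n ≤ N, ∀ x, ν (stageMul (E n) x) ≤ S * κ ^ 2 * ‖x‖ := by
    intro n hn x
    have h1 : ‖stageMul (E n) x‖ ≤ S * κ * ‖x‖ :=
      (pi_norm_le_iff_of_nonneg (by positivity)).2 fun i =>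
        norm_stageMul_le_of_entries (E n) (hE n hn) x i
    calc ν (stageMul (E n) x) ≤ κ * (S * κ * ‖x‖) :=
          (hν1 _).trans (mul_le_mul_of_nonneg_left h1 hκ0)
      _ = _ := by ring
  have hMN' : ∀ x, ν (stageMul (M N) x) ≤ S ^ 2 * κ ^ 4 * ν x := by
    intro x
    calc ν (stageMul (M N) x) ≤ κ * (S * κ * (S * κ * (κ * ν x))) := by
          refine (hν1 _).trans (mul_le_mul_of_nonneg_left ((hMN x).trans ?_) hκ0)
          gcongr
          exact hν2 x
      _ = _ := by ring
  have hκ1 : 1 ≤ S ^ 2 * κ ^ 4 := one_le_mul_of_one_le_of_one_le (one_le_pow₀ hS1) (one_le_pow₀ hκ)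
  intro n hn
  have key := recursion_bound ν (stageLin J) (fun n => stageLin (M n)) hN hγ0 hγ hκ1
    (b := S * κ ^ 2 * b) (by positivity) hM hMγ hMN' Z (fun n => stageMul (E n) (α n))
    (fun n => stageMul (E n) (β n)) h0
    (fun n h1 h2 => by rw [hZ n h1 h2, stageMul_add, stageLin_apply]) hZN
    (fun n h1 h2 => ⟨hJ n h1 h2 _ (hβ n h1 h2).1, (hEν n h2.le _).trans
      (mul_le_mul_of_nonneg_left (hβ n h1 h2).2 (by positivity))⟩) n hn
  refine key.trans ?_
  have h1 : ∑ j ∈ Finset.range (N + 1), ν (stageMul (E j) (α j)) ≤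
      S * κ ^ 2 * ∑ j ∈ Finset.range (N + 1), ‖α j‖ := by
    rw [Finset.mul_sum]
    exact Finset.sum_le_sum fun j hj => hEν j (by have := Finset.mem_range.1 hj; omega) _
  have h2 : 0 ≤ ∑ j ∈ Finset.range (N + 1), ‖α j‖ := Finset.sum_nonneg fun _ _ => norm_nonneg _
  have h3 : S * κ ^ 2 * ∑ j ∈ Finset.range (N + 1), ‖α j‖ ≤
      S * κ ^ 2 * (∑ j ∈ Finset.range (N + 1), ‖α j‖) / (1 - γ) :=
    le_div_self (by positivity) hγ' (by linarith)
  calc S ^ 2 * κ ^ 4 * (∑ j ∈ Finset.range (N + 1), ν (stageMul (E j) (α j))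
        + S * κ ^ 2 * b / (1 - γ)) ≤
      S ^ 2 * κ ^ 4 * (S * κ ^ 2 * (∑ j ∈ Finset.range (N + 1), ‖α j‖) / (1 - γ)
        + S * κ ^ 2 * b / (1 - γ)) := by gcongr; exact h1.trans h3
    _ = _ := by rw [stabConst, ← hS]; field_simp

lemma An_zero (X : PeerTriplet (r + 1)) (N : ℕ) : X.An N 0 = X.A0 := if_pos rfl

lemma An_last (X : PeerTriplet (r + 1)) {N : ℕ} (hN : 1 ≤ N) : X.An N N = X.AN := by
  rw [An, if_neg (by omega), if_pos rfl]

lemma An_of_lt (X : PeerTriplet (r + 1)) {N n : ℕ} (h1 : 1 ≤ n) (h2 : n < N) : X.An N n = X.A := by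
  rw [An, if_neg (by omega), if_neg (by omega)]

lemma Kn_zero (X : PeerTriplet (r + 1)) (N : ℕ) : X.Kn N 0 = X.K0 := if_pos rfl

lemma Kn_last (X : PeerTriplet (r + 1)) {N : ℕ} (hN : 1 ≤ N) : X.Kn N N = X.KN := by
  rw [Kn, if_neg (by omega), if_pos rfl]

lemma Kn_of_lt (X : PeerTriplet (r + 1)) {N n : ℕ} (h1 : 1 ≤ n) (h2 : n < N) : X.Kn N n = X.K := by
  rw [Kn, if_neg (by omega), if_neg (by omega)]

lemma An_mem (X : PeerTriplet (r + 1)) (N n : ℕ) : X.An N n ∈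
    ({X.A, X.A0, X.AN} : Set (Matrix (Fin (r + 1)) (Fin (r + 1)) ℝ)) := by
  rw [An]; split_ifs <;> simp

lemma Kn_mem (X : PeerTriplet (r + 1)) (N n : ℕ) : X.Kn N n ∈
    ({X.K, X.K0, X.KN} : Set (Matrix (Fin (r + 1)) (Fin (r + 1)) ℝ)) := by
  rw [Kn]; split_ifs <;> simp

lemma Structural.isUnit_An (hX : X.Structural) (N n : ℕ) : IsUnit (X.An N n).det := by
  rw [An]; split_ifs
  exacts [hX.2.2.1, hX.2.2.2.1, hX.2.1]

/-- Columns of `K`, `K_0`, `K_N` with sum zero vanish. -/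
lemma Structural.col_eq_zero (hX : X.Structural) {M : Matrix (Fin (r + 1)) (Fin (r + 1)) ℝ}
    (hM : M ∈ ({X.K, X.K0, X.KN} : Set (Matrix (Fin (r + 1)) (Fin (r + 1)) ℝ))) {i : Fin (r + 1)}
    (h : ∑ j, M j i = 0) (j : Fin (r + 1)) : M j i = 0 := by
  rcases hM with rfl | rfl | rfl
  · by_cases hij : j = i
    · subst hij
      rw [Finset.sum_eq_single j (fun l _ hl => hX.2.2.2.2.1 hl) (by simp)] at h
      exact h
    · exact hX.2.2.2.2.1 hij
  · exact hX.2.2.2.2.2.1 i h j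
  · exact hX.2.2.2.2.2.2 i h j

/-- Propagation matrix of the forward scheme. -/
noncomputable def stepMat (X : PeerTriplet (r + 1)) (G : Grid) (n : ℕ) :
    Matrix (Fin (r + 1)) (Fin (r + 1)) ℝ := (X.An G.N n)⁻¹ * X.B (G.ratio n)

/-- Propagation matrix of the adjoint scheme, where `k = N - n` counts the steps backwards from the
end point. -/
noncomputable def backMat (X : PeerTriplet (r + 1)) (G : Grid) (k : ℕ) :
    Matrix (Fin (r + 1)) (Fin (r + 1)) ℝ :=
  (X.An G.N (G.N - k)).transpose⁻¹ * (X.B (G.ratio (G.N - k + 1))).transpose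

lemma norm_stageMul_mul_le {M E : Matrix (Fin (r + 1)) (Fin (r + 1)) ℝ} (hκ : 0 ≤ κ)
    (hM : ∀ i j, |M i j| ≤ κ) (hE : ∀ i j, |E i j| ≤ κ) (x : Fin (r + 1) → Eu m) :
    ‖stageMul (M * E) x‖ ≤ (r + 1 : ℕ) * κ * ((r + 1 : ℕ) * κ * ‖x‖) := by
  rw [stageMul_mul]
  refine (pi_norm_le_iff_of_nonneg (by positivity)).2 fun i => ?_
  refine (norm_stageMul_le_of_entries M hM _ i).trans ?_
  gcongr
  exact (pi_norm_le_iff_of_nonneg (by positivity)).2 fun i => norm_stageMul_le_of_entries E hE x i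

lemma stageMul_ones {x : Fin (r + 1) → Eu m} (hx : ∑ i, x i = 0) :
    stageMul (Matrix.of fun _ _ => (1 : ℝ)) x = 0 := by
  funext i; simp [stageMul, hx]

lemma Binf_mul_Bbar (hr : 0 < r) (hA : IsUnit X.A.det) (hstd : X.StandardOrder r r) {σ : ℝ}
    (hσ : 0 < σ) : X.Binf * X.Bbar σ = X.Binf := by
  rw [Binf, Bbar, Matrix.mul_assoc, ← Matrix.mul_assoc X.A, Matrix.mul_nonsing_inv _ hA,
    Matrix.one_mul]
  ext i j
  simp [Matrix.mul_apply, sum_col_B hr hstd hσ]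

lemma BinfT_mul_BtildeT (hr : 0 < r) (hA : IsUnit X.A.det) (hstd : X.StandardOrder r r) {σ : ℝ}
    (hσ : 0 < σ) : X.BinfT * X.BtildeT σ = X.BinfT := by
  have h : X.A.transpose * X.A⁻¹.transpose = 1 := by
    rw [← Matrix.transpose_mul, Matrix.nonsing_inv_mul _ hA, Matrix.transpose_one]
  rw [BinfT, BtildeT, Matrix.mul_assoc, ← Matrix.mul_assoc X.A.transpose, h, Matrix.one_mul]
  ext i j
  simp [Matrix.mul_apply, sum_row_B hr hstd hσ]

lemma isUnit_Wdag (hA : IsUnit X.A.det) (hW : IsUnit W.det) : IsUnit (X.Wdag W).det := by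
  rw [Wdag, Matrix.det_transpose]
  exact Matrix.isUnit_nonsing_inv_det _ (by rw [Matrix.det_mul]; exact hA.mul hW)

/-- Stability of the forward scheme in the norm with weight `W⁻¹`. -/
lemma forward_stable (hr : 0 < r) (hX : X.Structural) (hstd : X.StandardOrder r r)
    (hstab : X.UniformlyZeroStable W σlo σhi) (hdamp : X.UniformlyDamped W σlo σhi γ)
    (hγ0 : 0 ≤ γ) (hγ : γ < 1) (hlo : 0 < σlo) (hκ : X.BoundedBy W σlo σhi κ)
    (hG : G.Admissible X.cstar T Tstar σlo σhi H) {b : ℝ} (hb : 0 ≤ b)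
    (Z α β : ℕ → Fin (r + 1) → Eu m) (h0 : Z 0 = stageMul (X.An G.N 0)⁻¹ (α 0))
    (hZ : ∀ n, 1 ≤ n → n ≤ G.N →
      Z n = stageMul (X.stepMat G n) (Z (n - 1)) + stageMul (X.An G.N n)⁻¹ (α n + β n))
    (hβN : β G.N = 0) (hβ : ∀ n, 1 ≤ n → n < G.N → ∑ i, β n i = 0 ∧ ‖β n‖ ≤ b) :
    ∀ n ≤ G.N, maxSeminorm W⁻¹ (Z n) ≤
      stabConst r κ γ * (∑ j ∈ Finset.range (G.N + 1), ‖α j‖ + b) := by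
  have hW := hstab.1
  have hWi : IsUnit W⁻¹.det := Matrix.isUnit_nonsing_inv_det _ hW
  have hWii : W⁻¹⁻¹ = W := Matrix.nonsing_inv_nonsing_inv _ hW
  have hσ : ∀ n, 1 ≤ n → n ≤ G.N → G.ratio n ∈ Icc σlo σhi := hG.2.2.2.2.1
  have hmat : ∀ n, 1 ≤ n → n < G.N → X.stepMat G n = X.Bbar (G.ratio n) := fun n h1 h2 => by
    rw [stepMat, An_of_lt X h1 h2, Bbar]
  refine stage_recursion_bound (maxSeminorm W⁻¹) X.Binf (X.stepMat G) (fun n => (X.An G.N n)⁻¹)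
    hG.1 hγ0 hγ hκ.one_le hb
    (fun x => (maxSeminorm_le _ _).trans (mul_le_mul_of_nonneg_right hκ.weight (norm_nonneg _)))
    (fun x => (norm_le_maxSeminorm hWi x).trans
      (mul_le_mul_of_nonneg_right hκ.weight_inv (apply_nonneg _ _)))
    ?_ ?_ ?_ (fun n _ => hκ.Ainv _ (An_mem _ _ _)) ?_ Z α β h0
    (fun n h1 h2 => hZ n h1 h2.le) (by rw [hZ G.N hG.1 le_rfl, hβN, add_zero]) hβ
  · intro n h1 h2 x
    rw [hmat n h1 h2]
    have := maxSeminorm_stageMul_le (M := X.Bbar (G.ratio n)) hWi (k := 1)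
      (by rw [hWii]; exact (hstab.2 _ (hσ n h1 h2.le)).1.le) x
    rwa [one_mul] at this
  · intro n h1 h2 x hx
    rw [hmat n h1 h2]
    refine ⟨by rw [← stageMul_mul,
      Binf_mul_Bbar hr hX.2.1 hstd (hlo.trans_le (hσ n h1 h2.le).1), hx], ?_⟩
    have e : stageMul (X.Bbar (G.ratio n)) x = stageMul (X.Bbar (G.ratio n) - X.Binf) x := by
      rw [sub_stageMul, hx, sub_zero]
    rw [e]
    exact maxSeminorm_stageMul_le hWi (by rw [hWii]; exact (hdamp _ (hσ n h1 h2.le)).1) x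
  · exact norm_stageMul_mul_le hκ.nonneg (hκ.Ainv _ (An_mem _ _ _)) (hκ.B _ (hσ _ hG.1 le_rfl))
  · intro n h1 h2 x hx
    rw [An_of_lt X h1 h2, ← stageMul_mul, Binf, Matrix.mul_assoc, Matrix.mul_nonsing_inv _ hX.2.1,
      Matrix.mul_one, stageMul_ones hx]

/-- Stability of the adjoint scheme in the norm with weight `(W^†)⁻¹`. -/
lemma backward_stable (hr : 0 < r) (hX : X.Structural) (hstd : X.StandardOrder r r)
    (hstab : X.UniformlyZeroStable W σlo σhi) (hdamp : X.UniformlyDamped W σlo σhi γ)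
    (hγ0 : 0 ≤ γ) (hγ : γ < 1) (hlo : 0 < σlo) (hκ : X.BoundedBy W σlo σhi κ)
    (hG : G.Admissible X.cstar T Tstar σlo σhi H) {b : ℝ} (hb : 0 ≤ b)
    (Z α β : ℕ → Fin (r + 1) → Eu m) (h0 : Z 0 = stageMul (X.An G.N G.N).transpose⁻¹ (α 0))
    (hZ : ∀ k, 1 ≤ k → k ≤ G.N → Z k = stageMul (X.backMat G k) (Z (k - 1))
      + stageMul (X.An G.N (G.N - k)).transpose⁻¹ (α k + β k))
    (hβN : β G.N = 0) (hβ : ∀ k, 1 ≤ k → k < G.N → ∑ i, β k i = 0 ∧ ‖β k‖ ≤ b) :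
    ∀ k ≤ G.N, sumSeminorm (X.Wdag W)⁻¹ (Z k) ≤
      stabConst r κ γ * (∑ j ∈ Finset.range (G.N + 1), ‖α j‖ + b) := by
  have hW := isUnit_Wdag hX.2.1 hstab.1
  have hWi : IsUnit (X.Wdag W)⁻¹.det := Matrix.isUnit_nonsing_inv_det _ hW
  have hWii : (X.Wdag W)⁻¹⁻¹ = X.Wdag W := Matrix.nonsing_inv_nonsing_inv _ hW
  have hAT : IsUnit X.A.transpose.det := by rw [Matrix.det_transpose]; exact hX.2.1
  have hσ : ∀ k, 1 ≤ k → k ≤ G.N → G.ratio (G.N - k + 1) ∈ Icc σlo σhi := fun k h1 h2 =>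
    hG.2.2.2.2.1 _ (by omega) (by omega)
  have hmat : ∀ k, 1 ≤ k → k < G.N → X.backMat G k = X.BtildeT (G.ratio (G.N - k + 1)) :=
    fun k h1 h2 => by
      rw [backMat, An_of_lt X (by omega) (by omega), BtildeT, Matrix.transpose_nonsing_inv]
  have hinv : ∀ n i j, |(X.An G.N n).transpose⁻¹ i j| ≤ κ := fun n i j => by
    rw [← Matrix.transpose_nonsing_inv]
    exact hκ.Ainv _ (An_mem _ _ _) j i
  refine stage_recursion_bound (sumSeminorm (X.Wdag W)⁻¹) X.BinfT (X.backMat G)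
    (fun k => (X.An G.N (G.N - k)).transpose⁻¹)
    hG.1 hγ0 hγ hκ.one_le hb
    (fun x => (sumSeminorm_le _ _).trans (mul_le_mul_of_nonneg_right hκ.weightDag (norm_nonneg _)))
    (fun x => (norm_le_sumSeminorm hWi x).trans
      (mul_le_mul_of_nonneg_right hκ.weightDag_inv (apply_nonneg _ _)))
    ?_ ?_ ?_ (fun n _ => hinv _) ?_ Z α β h0
    (fun n h1 h2 => hZ n h1 h2.le) (by rw [hZ G.N hG.1 le_rfl, hβN, add_zero]) hβ
  · intro n h1 h2 x
    rw [hmat n h1 h2]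
    have := sumSeminorm_stageMul_le (M := X.BtildeT (G.ratio (G.N - n + 1))) hWi (k := 1)
      (by rw [hWii]; exact (hstab.2 _ (hσ n h1 h2.le)).2.le) x
    rwa [one_mul] at this
  · intro n h1 h2 x hx
    rw [hmat n h1 h2]
    refine ⟨by rw [← stageMul_mul,
      BinfT_mul_BtildeT hr hX.2.1 hstd (hlo.trans_le (hσ n h1 h2.le).1), hx], ?_⟩
    have e : stageMul (X.BtildeT (G.ratio (G.N - n + 1))) x =
        stageMul (X.BtildeT (G.ratio (G.N - n + 1)) - X.BinfT) x := by
      rw [sub_stageMul, hx, sub_zero]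
    rw [e]
    exact sumSeminorm_stageMul_le hWi (by rw [hWii]; exact (hdamp _ (hσ n h1 h2.le)).2) x
  · exact norm_stageMul_mul_le hκ.nonneg (hinv _) fun i j => hκ.B _ (hσ _ hG.1 le_rfl) j i
  · intro n h1 h2 x hx
    rw [An_of_lt X (by omega) (by omega), ← stageMul_mul, BinfT, Matrix.mul_assoc,
      Matrix.mul_nonsing_inv _ hAT, Matrix.mul_one, stageMul_ones hx]

/-! ### The discrete boundary value problem as a fixed point equation -/

/-- Stage values of `g`. -/
noncomputable def gStage (Q : ControlProblem m d) (u : Eu m → Eu m → Eu d)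
    (Y P : Fin (r + 1) → Eu m) : Fin (r + 1) → Eu m := fun i => Q.g u (Y i) (P i)

/-- Stage values of `φ`, with multipliers combined by the columns of `L`. -/
noncomputable def phiStage (Q : ControlProblem m d) (u : Eu m → Eu m → Eu d)
    (L : Matrix (Fin (r + 1)) (Fin (r + 1)) ℝ) (Y P : Fin (r + 1) → Eu m) : Fin (r + 1) → Eu m :=
  fun i => Q.phi u (Y i) (stageMul L.transpose P i)

/-- Right-hand side of the forward scheme without its propagation term. -/
noncomputable def stateRhs (X : PeerTriplet (r + 1)) (Q : ControlProblem m d)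
    (u : Eu m → Eu m → Eu d) (G : Grid) (Y P : ℕ → Fin (r + 1) → Eu m) (n : ℕ) :
    Fin (r + 1) → Eu m :=
  (if n = 0 then fun i => X.a i • Q.y0 else 0)
    + G.h n • stageMul (X.Kn G.N n) (gStage Q u (Y n) (P n))

/-- Right-hand side of the adjoint scheme without its propagation term, counted backwards. -/
noncomputable def adjointRhs (X : PeerTriplet (r + 1)) (Q : ControlProblem m d)
    (u : Eu m → Eu m → Eu d) (G : Grid) (Y P : ℕ → Fin (r + 1) → Eu m) (k : ℕ) :
    Fin (r + 1) → Eu m :=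
  (if k = 0 then fun i => X.w i • gradient Q.C (∑ j, X.w j • Y G.N j) else 0)
    - G.h (G.N - k) • phiStage Q u (X.Kn G.N (G.N - k)) (Y (G.N - k)) (P (G.N - k))

/-- State component of the fixed point map: the forward recursion with `g` evaluated at given stage
values. -/
noncomputable def stateMap (X : PeerTriplet (r + 1)) (Q : ControlProblem m d)
    (u : Eu m → Eu m → Eu d) (G : Grid) (Y P : ℕ → Fin (r + 1) → Eu m) :
    ℕ → Fin (r + 1) → Eu m :=
  recSeq (fun n => stageLin (X.stepMat G n))
    fun n => stageMul (X.An G.N n)⁻¹ (X.stateRhs Q u G Y P n)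

/-- Adjoint component of the fixed point map, counted backwards from the end point. -/
noncomputable def backMap (X : PeerTriplet (r + 1)) (Q : ControlProblem m d)
    (u : Eu m → Eu m → Eu d) (G : Grid) (Y P : ℕ → Fin (r + 1) → Eu m) :
    ℕ → Fin (r + 1) → Eu m :=
  recSeq (fun k => stageLin (X.backMat G k))
    fun k => stageMul (X.An G.N (G.N - k)).transpose⁻¹ (X.adjointRhs Q u G Y P k)

/-- The discrete solutions are the fixed points of the map with components `stateMap` and
`backMap`. -/
lemma isDiscreteSolution_iff (hX : X.Structural) (Q : ControlProblem m d)
    (u : Eu m → Eu m → Eu d) (hN : 1 ≤ G.N) (Y P : ℕ → Fin (r + 1) → Eu m) :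
    X.IsDiscreteSolution Q u G Y P ↔
      ∀ n ≤ G.N, Y n = X.stateMap Q u G Y P n ∧ P n = X.backMap Q u G Y P (G.N - n) := by
  have hA := fun n => hX.isUnit_An G.N n
  have hAT : ∀ n, IsUnit (X.An G.N n).transpose.det := fun n => by
    rw [Matrix.det_transpose]; exact hA n
  have key : X.IsDiscreteSolution Q u G Y P ↔
      (stageMul (X.An G.N 0) (Y 0) = X.stateRhs Q u G Y P 0) ∧
      (∀ n, 1 ≤ n → n ≤ G.N → stageMul (X.An G.N n) (Y n) =
        stageMul (X.B (G.ratio n)) (Y (n - 1)) + X.stateRhs Q u G Y P n) ∧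
      (∀ k, 1 ≤ k → k ≤ G.N → stageMul (X.An G.N (G.N - k)).transpose (P (G.N - k)) =
        stageMul (X.B (G.ratio (G.N - k + 1))).transpose (P (G.N - (k - 1)))
          + X.adjointRhs Q u G Y P k) ∧
      (stageMul (X.An G.N (G.N - 0)).transpose (P (G.N - 0)) = X.adjointRhs Q u G Y P 0) := by
    refine and_congr ?_ (and_congr ?_ (and_congr ?_ ?_))
    · rw [An_zero, stateRhs, if_pos rfl, Kn_zero]; rfl
    · refine forall_congr' fun n => forall_congr' fun h1 => forall_congr' fun h2 => ?_
      rw [stateRhs, if_neg (by omega), zero_add]; rfl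
    · constructor
      · intro h k h1 h2
        have := h (G.N - k) (by omega)
        rw [adjointRhs, if_neg (by omega), zero_sub, ← sub_eq_add_neg,
          show G.N - (k - 1) = G.N - k + 1 by omega]
        exact this
      · intro h n hn
        have := h (G.N - n) (by omega) (by omega)
        rw [adjointRhs, if_neg (by omega), zero_sub, ← sub_eq_add_neg,
          show G.N - (G.N - n - 1) = n + 1 by omega, show G.N - (G.N - n) = n by omega] at this
        exact this
    · rw [Nat.sub_zero, An_last X hN, adjointRhs, if_pos rfl, Nat.sub_zero, Kn_last X hN]; rfl
  rw [key]
  simp only [stageMul_eq_iff (hA _), stageMul_eq_iff (hAT _), stageMul_add, ← stageMul_mul]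
  constructor
  · rintro ⟨h0, h1, h2, h3⟩ n hn
    refine ⟨eq_recSeq _ _ Y G.N h0 h1 n hn, ?_⟩
    have := eq_recSeq (fun k => stageLin (X.backMat G k))
      (fun k => stageMul (X.An G.N (G.N - k)).transpose⁻¹ (X.adjointRhs Q u G Y P k))
      (fun k => P (G.N - k)) G.N h3 h2 (G.N - n) (by omega)
    simp only [show G.N - (G.N - n) = n by omega] at this
    exact this
  · intro h
    have hP : ∀ k ≤ G.N, P (G.N - k) = X.backMap Q u G Y P k := fun k hk => by
      have := (h (G.N - k) (by omega)).2
      rwa [show G.N - (G.N - k) = k by omega] at this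
    refine ⟨(h 0 (by omega)).1, fun n h1 h2 => ?_, fun k h1 h2 => ?_, hP 0 (by omega)⟩
    · rw [(h n h2).1, (h (n - 1) (by omega)).1]
      exact recSeq_of_pos _ _ h1
    · rw [hP k h2, hP (k - 1) (by omega)]
      exact recSeq_of_pos _ _ h1

end PeerTriplet

namespace PeerTriplet

variable {r m d : ℕ} {X : PeerTriplet (r + 1)} {W : Matrix (Fin (r + 1)) (Fin (r + 1)) ℝ}
  {σlo σhi κ γ T Tstar H : ℝ} {G : Grid} {Q : ControlProblem m d} {u : Eu m → Eu m → Eu d}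
  {y p : ℝ → Eu m} {ρ Λy Λp Λy' Λp' : ℝ}

/-! ### Lipschitz estimates for the fixed point map -/

/-- All arguments of `g` and, after normalization by the column sums of `K_n`, of `φ` in the scheme
lie in the tube of radius `ρ`, at the times of the corresponding stages. -/
def NearExact (X : PeerTriplet (r + 1)) (G : Grid) (y p : ℝ → Eu m) (ρ : ℝ)
    (Y P : ℕ → Fin (r + 1) → Eu m) : Prop :=
  ∀ n ≤ G.N, ∀ i, ‖Y n i - X.exact G y n i‖ < ρ ∧ ‖P n i - X.exact G p n i‖ < ρ ∧
    (∑ j, X.Kn G.N n j i ≠ 0 →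
      ‖(∑ j, X.Kn G.N n j i)⁻¹ • stageMul (X.Kn G.N n).transpose (P n) i
        - X.exact G p n i‖ < ρ)

lemma stageMul_transpose_eq_zero (hX : X.Structural) {N n : ℕ} {i : Fin (r + 1)}
    (h : ∑ j, X.Kn N n j i = 0) (P : Fin (r + 1) → Eu m) :
    stageMul (X.Kn N n).transpose P i = 0 := by
  simp only [stageMul, Matrix.transpose_apply]
  exact Finset.sum_eq_zero fun j _ => by rw [hX.col_eq_zero (X.Kn_mem N n) h j, zero_smul]

lemma phiStage_eq_zero (hX : X.Structural) {N n : ℕ} {i : Fin (r + 1)}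
    (h : ∑ j, X.Kn N n j i = 0) (Y P : Fin (r + 1) → Eu m) :
    phiStage Q u (X.Kn N n) Y P i = 0 := by
  rw [phiStage, stageMul_transpose_eq_zero hX h, ControlProblem.phi_zero]

/-- The scaling property of the control makes `φ` homogeneous along the multiples that occur in the
scheme. -/
lemma phiStage_eq_smul
    (hscal : ControlProblem.ControlScaling X u (ControlProblem.tube y p Tstar ρ)) {N n : ℕ}
    {i : Fin (r + 1)} (h : ∑ j, X.Kn N n j i ≠ 0) {Y P : Fin (r + 1) → Eu m} {t : ℝ}
    (ht : t ∈ Icc 0 Tstar) (hY : ‖Y i - y t‖ < ρ)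
    (hP : ‖(∑ j, X.Kn N n j i)⁻¹ • stageMul (X.Kn N n).transpose P i - p t‖ < ρ) :
    phiStage Q u (X.Kn N n) Y P i = (∑ j, X.Kn N n j i) •
      Q.phi u (Y i) ((∑ j, X.Kn N n j i)⁻¹ • stageMul (X.Kn N n).transpose P i) := by
  have h1 := hscal _ (ControlProblem.mem_tube ht hY hP) _ (X.Kn_mem N n) i h
  rw [← ControlProblem.phi_smul h1, smul_inv_smul₀ h, phiStage]

lemma abs_sum_col_le (hκ : X.BoundedBy W σlo σhi κ) (N n : ℕ) (i : Fin (r + 1)) :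
    |∑ j, X.Kn N n j i| ≤ (r + 1 : ℕ) * κ :=
  (Finset.abs_sum_le_sum_abs _ _).trans
    ((Finset.sum_le_sum fun j _ => hκ.K _ (X.Kn_mem N n) j i).trans (by simp))

lemma norm_gStage_sub_le (hc : ∀ i, 0 ≤ X.c i)
    (hD : Q.DerivativeBounds u (ControlProblem.tube y p Tstar ρ) Λy Λp Λy' Λp')
    (hΛ : 0 ≤ Λy ∧ 0 ≤ Λp) (hG : G.Admissible X.cstar T Tstar σlo σhi H)
    {Y P Y' P' : ℕ → Fin (r + 1) → Eu m} (h : NearExact X G y p ρ Y P)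
    (h' : NearExact X G y p ρ Y' P') {n : ℕ} (hn : n ≤ G.N) :
    ‖gStage Q u (Y n) (P n) - gStage Q u (Y' n) (P' n)‖ ≤
      Λy * ‖Y n - Y' n‖ + Λp * ‖P n - P' n‖ := by
  refine (pi_norm_le_iff_of_nonempty _).2 fun i => ?_
  refine (hD.norm_g_sub_le (hG.node_mem hn (hc i) (X.c_le_cstar i)) (h n hn i).1 (h n hn i).2.1
    (h' n hn i).1 (h' n hn i).2.1).trans ?_
  exact add_le_add (mul_le_mul_of_nonneg_left (norm_le_pi_norm (Y n - Y' n) i) hΛ.1)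
    (mul_le_mul_of_nonneg_left (norm_le_pi_norm (P n - P' n) i) hΛ.2)

lemma norm_phiStage_sub_le (hX : X.Structural) (hκ : X.BoundedBy W σlo σhi κ)
    (hscal : ControlProblem.ControlScaling X u (ControlProblem.tube y p Tstar ρ))
    (hD : Q.DerivativeBounds u (ControlProblem.tube y p Tstar ρ) Λy Λp Λy' Λp')
    (hΛ : 0 ≤ Λy' ∧ 0 ≤ Λp') (hG : G.Admissible X.cstar T Tstar σlo σhi H)
    {Y P Y' P' : ℕ → Fin (r + 1) → Eu m} (h : NearExact X G y p ρ Y P)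
    (h' : NearExact X G y p ρ Y' P') {n : ℕ} (hn : n ≤ G.N) :
    ‖phiStage Q u (X.Kn G.N n) (Y n) (P n) - phiStage Q u (X.Kn G.N n) (Y' n) (P' n)‖ ≤
      (r + 1 : ℕ) * κ * (Λy' * ‖Y n - Y' n‖ + Λp' * ‖P n - P' n‖) := by
  have hκ0 := hκ.nonneg
  have hΛy := hΛ.1
  have hΛp := hΛ.2
  refine (pi_norm_le_iff_of_nonneg (by positivity)).2 fun i => ?_
  rw [Pi.sub_apply]
  set k := ∑ j, X.Kn G.N n j i with hk
  by_cases hk0 : k = 0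
  · rw [phiStage_eq_zero hX hk0, phiStage_eq_zero hX hk0, sub_zero, norm_zero]
    positivity
  · have ht := hG.node_mem hn (hX.1 i) (X.c_le_cstar i)
    rw [phiStage_eq_smul hscal hk0 ht (h n hn i).1 ((h n hn i).2.2 hk0),
      phiStage_eq_smul hscal hk0 ht (h' n hn i).1 ((h' n hn i).2.2 hk0), ← smul_sub, norm_smul,
      Real.norm_eq_abs]
    have e1 := hD.norm_phi_sub_le ht (h n hn i).1 ((h n hn i).2.2 hk0) (h' n hn i).1
      ((h' n hn i).2.2 hk0)
    rw [← hk, ← smul_sub, ← Pi.sub_apply (stageMul _ _), ← stageMul_sub, norm_smul, norm_inv,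
      Real.norm_eq_abs] at e1
    have e2 : ‖stageMul (X.Kn G.N n).transpose (P n - P' n) i‖ ≤
        (r + 1 : ℕ) * κ * ‖P n - P' n‖ :=
      norm_stageMul_le_of_entries _ (fun a b => hκ.K _ (X.Kn_mem _ _) b a) _ i
    have e3 : |k| ≤ (r + 1 : ℕ) * κ := abs_sum_col_le hκ _ _ _
    have hk' : |k| ≠ 0 := abs_ne_zero.2 hk0
    calc |k| * _ ≤ |k| * (Λy' * ‖Y n i - Y' n i‖
          + Λp' * (|k|⁻¹ * ‖stageMul (X.Kn G.N n).transpose (P n - P' n) i‖)) :=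
          mul_le_mul_of_nonneg_left e1 (abs_nonneg _)
      _ = |k| * (Λy' * ‖(Y n - Y' n) i‖)
          + Λp' * ‖stageMul (X.Kn G.N n).transpose (P n - P' n) i‖ := by
          rw [Pi.sub_apply]; field_simp
      _ ≤ (r + 1 : ℕ) * κ * (Λy' * ‖Y n - Y' n‖) + Λp' * ((r + 1 : ℕ) * κ * ‖P n - P' n‖) := by
          gcongr
          exact norm_le_pi_norm (Y n - Y' n) i
      _ = _ := by ring

lemma sum_norm_le_of_step_bound {N : ℕ} {α : ℕ → Fin (r + 1) → Eu m} {h : ℕ → ℝ} {A B D : ℝ}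
    (hα : ∀ n ≤ N, ‖α n‖ ≤ (if n = 0 then A else 0) + (if n = N then B else 0) + h n * D) :
    ∑ n ∈ Finset.range (N + 1), ‖α n‖ ≤ A + B + (∑ n ∈ Finset.range (N + 1), h n) * D := by
  refine (Finset.sum_le_sum fun n hn => hα n (by have := Finset.mem_range.1 hn; omega)).trans
    (le_of_eq ?_)
  rw [Finset.sum_add_distrib, Finset.sum_add_distrib, Finset.sum_ite_eq', Finset.sum_ite_eq',
    if_pos (by simp), if_pos (by simp), Finset.sum_mul]

lemma _root_.Grid.Admissible.sum_h_reflect (hG : G.Admissible X.cstar T Tstar σlo σhi H) :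
    ∑ k ∈ Finset.range (G.N + 1), G.h (G.N - k) = T := by
  rw [← hG.sum_h]
  exact Finset.sum_range_reflect G.h (G.N + 1)

/-- The Lipschitz constant of the fixed point map, up to the constants of the problem. -/
noncomputable def lipConst (r : ℕ) (κ γ : ℝ) : ℝ :=
  stabConst r κ γ * ((r + 1 : ℕ) * κ ^ 3)

lemma norm_le_of_max (hκ : X.BoundedBy W σlo σhi κ) (hW : IsUnit W.det) {Z : Fin (r + 1) → Eu m}
    {a : ℝ} (h : maxSeminorm W⁻¹ Z ≤ a) : ‖Z‖ ≤ κ * a :=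
  (norm_le_maxSeminorm (Matrix.isUnit_nonsing_inv_det _ hW) Z).trans
    (mul_le_mul hκ.weight_inv h (apply_nonneg _ _) hκ.nonneg)

lemma norm_le_of_sum (hκ : X.BoundedBy W σlo σhi κ) (hA : IsUnit X.A.det) (hW : IsUnit W.det)
    {Z : Fin (r + 1) → Eu m} {a : ℝ} (h : sumSeminorm (X.Wdag W)⁻¹ Z ≤ a) : ‖Z‖ ≤ κ * a :=
  (norm_le_sumSeminorm (Matrix.isUnit_nonsing_inv_det _ (isUnit_Wdag hA hW)) Z).trans
    (mul_le_mul hκ.weightDag_inv h (apply_nonneg _ _) hκ.nonneg)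

lemma stateMap_sub_le (hr : 0 < r) (hX : X.Structural) (hstd : X.StandardOrder r r)
    (hstab : X.UniformlyZeroStable W σlo σhi) (hdamp : X.UniformlyDamped W σlo σhi γ)
    (hγ0 : 0 ≤ γ) (hγ : γ < 1) (hlo : 0 < σlo) (hκ : X.BoundedBy W σlo σhi κ)
    (hD : Q.DerivativeBounds u (ControlProblem.tube y p Tstar ρ) Λy Λp Λy' Λp')
    (hΛ : 0 ≤ Λy ∧ 0 ≤ Λp) (hG : G.Admissible X.cstar T Tstar σlo σhi H)
    {Y P Y' P' : ℕ → Fin (r + 1) → Eu m} (h : NearExact X G y p ρ Y P)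
    (h' : NearExact X G y p ρ Y' P') {a b : ℝ}
    (hYa : ∀ n ≤ G.N, maxSeminorm W⁻¹ (Y n - Y' n) ≤ a)
    (hPb : ∀ n ≤ G.N, sumSeminorm (X.Wdag W)⁻¹ (P n - P' n) ≤ b) :
    ∀ n ≤ G.N, maxSeminorm W⁻¹ (X.stateMap Q u G Y P n - X.stateMap Q u G Y' P' n) ≤
      lipConst r κ γ * (T * (Λy * a + Λp * b)) := by
  intro n hn
  have hκ0 := hκ.nonneg
  have ha : 0 ≤ a := (apply_nonneg _ _).trans (hYa n hn)
  have hb : 0 ≤ b := (apply_nonneg _ _).trans (hPb n hn)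
  have hΛy := hΛ.1
  have hΛp := hΛ.2
  set D : ℝ := (r + 1 : ℕ) * κ ^ 3 * (Λy * a + Λp * b) with hDdef
  set α : ℕ → Fin (r + 1) → Eu m := fun n => X.stateRhs Q u G Y P n - X.stateRhs Q u G Y' P' n
  have hα : ∀ n ≤ G.N, ‖α n‖ ≤ (if n = 0 then 0 else 0) + (if n = G.N then 0 else 0) + G.h n * D := by
    intro n hn
    have hh := (hG.2.1 n hn).le
    have e : α n = G.h n • stageMul (X.Kn G.N n)
        (gStage Q u (Y n) (P n) - gStage Q u (Y' n) (P' n)) := by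
      simp only [α, stateRhs, add_sub_add_left_eq_sub, ← smul_sub, ← stageMul_sub]
    rw [e, norm_smul, Real.norm_eq_abs, abs_of_nonneg hh, ite_self, ite_self, zero_add, zero_add]
    refine mul_le_mul_of_nonneg_left ?_ hh
    have e1 := norm_gStage_sub_le hX.1 hD hΛ hG h h' hn
    have e2 := norm_le_of_max hκ hstab.1 (hYa n hn)
    have e3 := norm_le_of_sum hκ hX.2.1 hstab.1 (hPb n hn)
    refine (pi_norm_le_iff_of_nonneg (by positivity)).2 fun i => ?_
    calc _ ≤ (r + 1 : ℕ) * κ * ‖gStage Q u (Y n) (P n) - gStage Q u (Y' n) (P' n)‖ :=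
          norm_stageMul_le_of_entries _ (hκ.K _ (X.Kn_mem _ _)) _ i
      _ ≤ (r + 1 : ℕ) * κ * (Λy * (κ * a) + Λp * (κ * b)) := by
          gcongr; exact e1.trans (by gcongr)
      _ = (r + 1 : ℕ) * κ ^ 2 * (Λy * a + Λp * b) := by ring
      _ ≤ D := by
          rw [hDdef]; gcongr
          · exact hκ.one_le
          · norm_num
  have key := forward_stable hr hX hstd hstab hdamp hγ0 hγ hlo hκ hG le_rfl
    (fun n => X.stateMap Q u G Y P n - X.stateMap Q u G Y' P' n) α (fun _ => 0)
    (by simp only [α, stageMul_sub]; rfl)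
    (fun n h1 h2 => by
      simp only [stateMap]
      rw [recSeq_of_pos _ _ h1, recSeq_of_pos (n := n) _ _ h1]
      simp only [stageLin_apply, α, stageMul_sub, add_zero]
      abel) rfl (fun n _ _ => ⟨by simp, by simp⟩) n hn
  refine key.trans ?_
  rw [lipConst, mul_assoc]
  refine mul_le_mul_of_nonneg_left ?_ (stabConst_nonneg hγ)
  refine (add_le_add_left (sum_norm_le_of_step_bound hα) _).trans (le_of_eq ?_)
  rw [hG.sum_h, hDdef]; ring

lemma backMap_sub_le (hr : 0 < r) (hX : X.Structural) (hstd : X.StandardOrder r r)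
    (hstab : X.UniformlyZeroStable W σlo σhi) (hdamp : X.UniformlyDamped W σlo σhi γ)
    (hγ0 : 0 ≤ γ) (hγ : γ < 1) (hlo : 0 < σlo) (hκ : X.BoundedBy W σlo σhi κ)
    (hQ : Q.Regular)
    (hscal : ControlProblem.ControlScaling X u (ControlProblem.tube y p Tstar ρ))
    (hD : Q.DerivativeBounds u (ControlProblem.tube y p Tstar ρ) Λy Λp Λy' Λp')
    (hΛ : 0 ≤ Λy' ∧ 0 ≤ Λp') (hG : G.Admissible X.cstar T Tstar σlo σhi H)
    {Y P Y' P' : ℕ → Fin (r + 1) → Eu m} (h : NearExact X G y p ρ Y P)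
    (h' : NearExact X G y p ρ Y' P') {a b : ℝ}
    (hYa : ∀ n ≤ G.N, maxSeminorm W⁻¹ (Y n - Y' n) ≤ a)
    (hPb : ∀ n ≤ G.N, sumSeminorm (X.Wdag W)⁻¹ (P n - P' n) ≤ b) :
    ∀ k ≤ G.N, sumSeminorm (X.Wdag W)⁻¹ (X.backMap Q u G Y P k - X.backMap Q u G Y' P' k) ≤
      lipConst r κ γ * (T * (Λy' * a + Λp' * b) + Q.Gam * a) := by
  intro k hk
  have hκ0 := hκ.nonneg
  have ha : 0 ≤ a := (apply_nonneg _ _).trans (hYa k hk)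
  have hb : 0 ≤ b := (apply_nonneg _ _).trans (hPb k hk)
  have hΛy := hΛ.1
  have hΛp := hΛ.2
  have hGam : 0 ≤ Q.Gam := norm_nonneg _
  set S : ℝ := ((r + 1 : ℕ) : ℝ) with hS
  set D : ℝ := S * κ ^ 3 * (Λy' * a + Λp' * b) with hDdef
  set α : ℕ → Fin (r + 1) → Eu m := fun n => X.adjointRhs Q u G Y P n - X.adjointRhs Q u G Y' P' n
  have hα : ∀ n ≤ G.N, ‖α n‖ ≤ (if n = 0 then S * κ ^ 3 * (Q.Gam * a) else 0)
      + (if n = G.N then 0 else 0) + G.h (G.N - n) * D := by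
    intro n hn
    have hh := (hG.2.1 (G.N - n) (by omega)).le
    have e : α n = (if n = 0 then fun i => X.w i • (gradient Q.C (∑ j, X.w j • Y G.N j)
          - gradient Q.C (∑ j, X.w j • Y' G.N j)) else 0)
        - G.h (G.N - n) • (phiStage Q u (X.Kn G.N (G.N - n)) (Y (G.N - n)) (P (G.N - n))
          - phiStage Q u (X.Kn G.N (G.N - n)) (Y' (G.N - n)) (P' (G.N - n))) := by
      simp only [α, adjointRhs]
      split_ifs
      · funext i
        simp only [Pi.sub_apply, Pi.smul_apply, smul_sub]
        abel
      · rw [smul_sub]; abel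
    have e2 := norm_le_of_max hκ hstab.1 (hYa _ (Nat.sub_le G.N n))
    have e3 := norm_le_of_sum hκ hX.2.1 hstab.1 (hPb _ (Nat.sub_le G.N n))
    have e4 := norm_phiStage_sub_le hX hκ hscal hD hΛ hG h h' (Nat.sub_le G.N n)
    rw [e, ite_self, add_zero]
    refine (norm_sub_le _ _).trans (add_le_add ?_ ?_)
    · split_ifs with h0
      · refine (pi_norm_le_iff_of_nonneg (by positivity)).2 fun i => ?_
        rw [norm_smul, Real.norm_eq_abs]
        have e5 := hQ.norm_gradient_sub_le (∑ j, X.w j • Y G.N j) (∑ j, X.w j • Y' G.N j)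
        have e6 : ‖∑ j, X.w j • Y G.N j - ∑ j, X.w j • Y' G.N j‖ ≤ S * (κ * (κ * a)) := by
          rw [← Finset.sum_sub_distrib]
          have : ∀ j ∈ Finset.univ, ‖X.w j • Y G.N j - X.w j • Y' G.N j‖ ≤ κ * (κ * a) := by
            intro j _
            rw [← smul_sub, norm_smul, Real.norm_eq_abs]
            exact mul_le_mul (hκ.w j) ((norm_le_pi_norm (Y G.N - Y' G.N) j).trans
              (norm_le_of_max hκ hstab.1 (hYa _ le_rfl))) (norm_nonneg _) hκ0
          refine (norm_sum_le_of_le _ this).trans (le_of_eq ?_)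
          simp [hS]
        calc _ ≤ κ * (Q.Gam * (S * (κ * (κ * a)))) :=
              mul_le_mul (hκ.w i) (e5.trans (mul_le_mul_of_nonneg_left e6 hGam)) (norm_nonneg _) hκ0
          _ = _ := by ring
      · simp
    · rw [norm_smul, Real.norm_eq_abs, abs_of_nonneg hh]
      refine mul_le_mul_of_nonneg_left ?_ hh
      calc _ ≤ S * κ * (Λy' * (κ * a) + Λp' * (κ * b)) := by
            refine e4.trans ?_
            gcongr
        _ = S * κ ^ 2 * (Λy' * a + Λp' * b) := by ring
        _ ≤ D := by
            rw [hDdef]; gcongr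
            · exact hκ.one_le
            · norm_num
  have key := backward_stable hr hX hstd hstab hdamp hγ0 hγ hlo hκ hG le_rfl
    (fun n => X.backMap Q u G Y P n - X.backMap Q u G Y' P' n) α (fun _ => 0)
    (by simp only [α, stageMul_sub]; rfl)
    (fun n h1 h2 => by
      simp only [backMap]
      rw [recSeq_of_pos _ _ h1, recSeq_of_pos (n := n) _ _ h1]
      simp only [stageLin_apply, α, stageMul_sub, add_zero]
      abel) rfl (fun n _ _ => ⟨by simp, by simp⟩) k hk
  refine key.trans ?_
  rw [lipConst, mul_assoc]
  refine mul_le_mul_of_nonneg_left ?_ (stabConst_nonneg hγ)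
  refine (add_le_add_left (sum_norm_le_of_step_bound hα) _).trans (le_of_eq ?_)
  rw [hG.sum_h_reflect, hDdef]; ring

end PeerTriplet

namespace PeerTriplet

variable {r m d : ℕ} {X : PeerTriplet (r + 1)} {W : Matrix (Fin (r + 1)) (Fin (r + 1)) ℝ}
  {σlo σhi κ γ T Tstar H : ℝ} {G : Grid} {Q : ControlProblem m d} {u : Eu m → Eu m → Eu d}
  {y p : ℝ → Eu m} {ρ Λy Λp Λy' Λp' : ℝ}

/-! ### The exact solution under the fixed point map -/

/-- The contribution of boundary step `n` with coefficient matrix `M` to the error bound. -/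
noncomputable def boundaryTerm (X : PeerTriplet (r + 1)) (G : Grid)
    (M : Matrix (Fin (r + 1)) (Fin (r + 1)) ℝ) (p : ℝ → Eu m) (Tstar : ℝ) (n : ℕ) : ℝ :=
  oneLegDefect X.c M r * (G.h n ^ r * G.semi X.cstar Tstar p (r - 1) (r - 1) n)

lemma oneLegDefect_nonneg {s : ℕ} (c : Fin s → ℝ) (M : Matrix (Fin s) (Fin s) ℝ) (q : ℕ) :
    0 ≤ oneLegDefect c M q := by
  unfold oneLegDefect; split_ifs <;> norm_num

lemma boundaryTerm_nonneg (hG : G.Admissible X.cstar T Tstar σlo σhi H)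
    (M : Matrix (Fin (r + 1)) (Fin (r + 1)) ℝ) {n : ℕ} (hn : n ≤ G.N) :
    0 ≤ boundaryTerm X G M p Tstar n :=
  mul_nonneg (oneLegDefect_nonneg _ _ _)
    (mul_nonneg (pow_nonneg (hG.2.1 n hn).le _) (G.semi_nonneg _ _ _ _ _ _))

/-- In the steps with diagonal `K` the exact values of `φ` and `-p'` agree. -/
lemma phiStage_exact_eq (hX : X.Structural)
    (hscal : ControlProblem.ControlScaling X u (ControlProblem.tube y p Tstar ρ)) (hρ : 0 < ρ)
    (hG : G.Admissible X.cstar T Tstar σlo σhi H) {n : ℕ} (hn1 : 1 ≤ n) (hn : n < G.N) :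
    phiStage Q u (X.Kn G.N n) (X.exact G y n) (X.exact G p n) =
      stageMul (X.Kn G.N n).transpose (X.exact G (fun t => Q.phi u (y t) (p t)) n) := by
  funext i
  have hdiag : ∀ V : Fin (r + 1) → Eu m, stageMul (X.Kn G.N n).transpose V i =
      (∑ j, X.Kn G.N n j i) • V i := by
    intro V
    rw [Kn_of_lt X hn1 hn, stageMul,
      Finset.sum_eq_single i (fun j _ hj => by
        rw [Matrix.transpose_apply, hX.2.2.2.2.1 hj, zero_smul]) (by simp),
      Finset.sum_eq_single i (fun j _ hj => hX.2.2.2.2.1 hj) (by simp), Matrix.transpose_apply]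
  by_cases hk : ∑ j, X.Kn G.N n j i = 0
  · rw [phiStage_eq_zero hX hk, stageMul_transpose_eq_zero hX hk]
  · have e : (∑ j, X.Kn G.N n j i)⁻¹ • stageMul (X.Kn G.N n).transpose (X.exact G p n) i =
        X.exact G p n i := by rw [hdiag, inv_smul_smul₀ hk]
    have ht := hG.node_mem hn.le (hX.1 i) (X.c_le_cstar i)
    rw [phiStage_eq_smul hscal hk ht (by simpa [exact] using hρ)
      (by rw [e]; simpa [exact] using hρ), e, hdiag]
    rfl

/-- In a boundary step the values of `φ` at the exact solution differ from those of `-p'` by the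
deviation from the one-leg conditions. -/
lemma norm_phiStage_exact_sub_le (hr : 2 ≤ r) (hX : X.Structural) (hκ : X.BoundedBy W σlo σhi κ)
    (hscal : ControlProblem.ControlScaling X u (ControlProblem.tube y p Tstar ρ))
    (hD : Q.DerivativeBounds u (ControlProblem.tube y p Tstar ρ) Λy Λp Λy' Λp')
    (hΛ : 0 ≤ Λp') (hG : G.Admissible X.cstar T Tstar σlo σhi H) (hTs : 0 < Tstar)
    (hp : ContDiffOn ℝ (r + 1 : ℕ) p (Icc 0 Tstar))
    (hp' : ∀ τ ∈ Icc 0 Tstar, HasDerivWithinAt p (Q.phi u (y τ) (p τ)) (Icc 0 Tstar) τ)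
    (hnear : NearExact X G y p ρ (X.exact G y) (X.exact G p)) {n : ℕ} (hn : n ≤ G.N)
    (hleg : ∀ k < r - 1, OneLeg X.c (X.Kn G.N n) k) :
    ‖G.h n • (phiStage Q u (X.Kn G.N n) (X.exact G y n) (X.exact G p n)
        - stageMul (X.Kn G.N n).transpose (X.exact G (fun t => Q.phi u (y t) (p t)) n))‖ ≤
      defectConst r κ * (1 + (1 + T) * Λp') *
        (X.derivBound G p Tstar + boundaryTerm X G (X.Kn G.N n) p Tstar n) := by
  have hκ0 := hκ.nonneg
  have hh := (hG.2.1 n hn).le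
  have hhT := hG.h_le hn
  have hT : 0 ≤ T := hh.trans hhT
  have hC0 : 0 ≤ defectConst r κ := defectConst_nonneg hκ0
  have hRp := derivBound_nonneg (v := p) hG
  have hBt := boundaryTerm_nonneg (p := p) hG (X.Kn G.N n) hn
  have hJ := hG.window_subset n
  have htJ : G.t n ∈ G.window X.cstar n :=
    Grid.cell_subset_window hn (by omega) (by omega) (hG.t_mem_cell X.one_le_cstar hn)
  have hx : ∀ i, uIcc (G.t n) (G.t n + G.h n * X.c i) ⊆ G.window X.cstar n := fun i =>
    hG.uIcc_node_subset X.one_le_cstar hn (hX.1 i) (X.c_le_cstar i)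
  have hconst : 2 * ((r + 1 : ℕ) : ℝ) * κ * (2 * κ ^ 2) ^ r ≤ defectConst r κ := by
    have h1 : (2 * κ ^ 2) ^ r ≤ (2 * κ ^ 2) ^ (r + 1) :=
      pow_le_pow_right₀ hκ.one_le_two_mul_sq (Nat.le_succ r)
    have h2 : (2 : ℝ) ≤ r + 3 := by have : (0 : ℝ) ≤ r := Nat.cast_nonneg r; linarith
    calc 2 * ((r + 1 : ℕ) : ℝ) * κ * (2 * κ ^ 2) ^ r
        = (r + 1 : ℕ) * 2 * κ * (2 * κ ^ 2) ^ r := by ring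
      _ ≤ _ := by rw [defectConst]; gcongr
  have hder : ∀ k < r + 1, ∀ τ ∈ Icc 0 Tstar,
      HasDerivWithinAt (iteratedDerivWithin k p (Icc 0 Tstar))
        (iteratedDerivWithin (k + 1) p (Icc 0 Tstar) τ) (Icc 0 Tstar) τ := fun j hj τ hτ =>
    hasDerivWithinAt_iteratedDerivWithin hTs hp hj hτ
  have hd1 : ∀ j, iteratedDerivWithin 1 p (Icc 0 Tstar) (G.t n + G.h n * X.c j) =
      Q.phi u (y (G.t n + G.h n * X.c j)) (p (G.t n + G.h n * X.c j)) := by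
    intro j
    have hm := hJ (hx j right_mem_uIcc)
    rw [iteratedDerivWithin_one]
    exact (hp' _ hm).derivWithin (uniqueDiffOn_Icc hTs _ hm)
  -- Deviation of the combined multipliers, of order `r` or, without full one-leg conditions, `r - 1`.
  have hdev : ∀ i, G.h n * ‖stageMul (X.Kn G.N n).transpose (X.exact G p n) i
      - (∑ j, X.Kn G.N n j i) • X.exact G p n i‖ ≤
      defectConst r κ * (1 + T) *
        (X.derivBound G p Tstar + boundaryTerm X G (X.Kn G.N n) p Tstar n) := by
    intro i
    by_cases hall : ∀ k < r, OneLeg X.c (X.Kn G.N n) k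
    · have key := norm_oneLeg_sub_le (r := r) (n := r) (by omega) le_rfl hall
        (fun k hk => hder k (by omega)) hJ
        (fun τ hτ => hG.norm_le_semi hTs hp le_rfl (Nat.le_succ r) le_rfl hτ) htJ hh hx hκ0
        hκ.one_le_two_mul_sq (hκ.K _ (X.Kn_mem _ _)) (hκ.abs_c_le hX.1) i
      simp only [iteratedDerivWithin_zero] at key
      have key2 : ‖stageMul (X.Kn G.N n).transpose (X.exact G p n) i
          - (∑ j, X.Kn G.N n j i) • X.exact G p n i‖ ≤
          defectConst r κ * X.derivBound G p Tstar :=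
        key.trans (mul_le_mul hconst (le_derivBound hn)
          (mul_nonneg (pow_nonneg hh _) (G.semi_nonneg _ _ _ _ _ _)) hC0)
      calc _ ≤ T * (defectConst r κ * X.derivBound G p Tstar) :=
            mul_le_mul hhT key2 (norm_nonneg _) hT
        _ ≤ (1 + T) * (defectConst r κ * (X.derivBound G p Tstar
              + boundaryTerm X G (X.Kn G.N n) p Tstar n)) := by
            gcongr <;> linarith
        _ = _ := by ring
    · have key := norm_oneLeg_sub_le (r := r) (n := r - 1) (by omega) (by omega) hleg
        (fun k hk => hder k (by omega)) hJ
        (fun τ hτ => hG.norm_le_semi hTs hp le_rfl le_rfl (by omega) hτ) htJ hh hx hκ0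
        hκ.one_le_two_mul_sq (hκ.K _ (X.Kn_mem _ _)) (hκ.abs_c_le hX.1) i
      simp only [iteratedDerivWithin_zero] at key
      have hδ : boundaryTerm X G (X.Kn G.N n) p Tstar n =
          G.h n * (G.h n ^ (r - 1) * G.semi X.cstar Tstar p (r - 1) (r - 1) n) := by
        rw [boundaryTerm, oneLegDefect, if_neg hall, one_mul, ← mul_assoc, ← pow_succ',
          Nat.sub_add_cancel (by omega)]
      have hs : 0 ≤ G.h n ^ (r - 1) * G.semi X.cstar Tstar p (r - 1) (r - 1) n :=
        mul_nonneg (pow_nonneg hh _) (G.semi_nonneg _ _ _ _ _ _)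
      calc _ ≤ G.h n * (defectConst r κ *
            (G.h n ^ (r - 1) * G.semi X.cstar Tstar p (r - 1) (r - 1) n)) :=
            mul_le_mul_of_nonneg_left (key.trans (mul_le_mul_of_nonneg_right hconst hs)) hh
        _ = 1 * (defectConst r κ * boundaryTerm X G (X.Kn G.N n) p Tstar n) := by rw [hδ]; ring
        _ ≤ (1 + T) * (defectConst r κ * (X.derivBound G p Tstar
              + boundaryTerm X G (X.Kn G.N n) p Tstar n)) := by
            gcongr <;> linarith
        _ = _ := by ring
  have hdev' : ∀ i, G.h n * ‖stageMul (X.Kn G.N n).transpose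
      (X.exact G (fun t => Q.phi u (y t) (p t)) n) i
      - (∑ j, X.Kn G.N n j i) • X.exact G (fun t => Q.phi u (y t) (p t)) n i‖ ≤
      defectConst r κ * X.derivBound G p Tstar := by
    intro i
    have key := norm_oneLeg_sub_le (r := r) (n := r - 1) (by omega) (by omega) hleg
      (f := fun k => iteratedDerivWithin (k + 1) p (Icc 0 Tstar))
      (fun k hk => hder (k + 1) (by omega)) hJ
      (fun τ hτ => hG.norm_le_semi hTs hp (r₁ := r) (r₂ := r + 1) (by omega) (by omega) le_rfl hτ)
      htJ hh hx hκ0 hκ.one_le_two_mul_sq (hκ.K _ (X.Kn_mem _ _)) (hκ.abs_c_le hX.1) i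
    simp only [zero_add, hd1] at key
    have hs : 0 ≤ G.h n ^ (r - 1) * G.semi X.cstar Tstar p r (r + 1) n :=
      mul_nonneg (pow_nonneg hh _) (G.semi_nonneg _ _ _ _ _ _)
    calc _ ≤ G.h n * (defectConst r κ *
          (G.h n ^ (r - 1) * G.semi X.cstar Tstar p r (r + 1) n)) :=
          mul_le_mul_of_nonneg_left (key.trans (mul_le_mul_of_nonneg_right hconst hs)) hh
      _ = defectConst r κ * (G.h n ^ (r - 1 + 1) * G.semi X.cstar Tstar p r (r + 1) n) := by
          rw [pow_succ]; ring
      _ ≤ _ := by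
          rw [Nat.sub_add_cancel (by omega)]
          exact mul_le_mul_of_nonneg_left (le_derivBound hn) hC0
  refine (pi_norm_le_iff_of_nonneg (by positivity)).2 fun i => ?_
  rw [Pi.smul_apply, Pi.sub_apply, norm_smul, Real.norm_eq_abs, abs_of_nonneg hh]
  by_cases hk : ∑ j, X.Kn G.N n j i = 0
  · rw [phiStage_eq_zero hX hk, stageMul_transpose_eq_zero hX hk, sub_zero, norm_zero, mul_zero]
    positivity
  · have ht := hG.node_mem hn (hX.1 i) (X.c_le_cstar i)
    have hq := (hnear n hn i).2.2 hk
    rw [phiStage_eq_smul hscal hk ht (hnear n hn i).1 hq]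
    set k := ∑ j, X.Kn G.N n j i with hkdef
    set q := k⁻¹ • stageMul (X.Kn G.N n).transpose (X.exact G p n) i with hqdef
    have e1 := hD.norm_phi_sub_le ht (hnear n hn i).1 hq (hnear n hn i).1 (hnear n hn i).2.1
    rw [sub_self, norm_zero, mul_zero, zero_add] at e1
    have e2 : |k| * ‖q - X.exact G p n i‖ = ‖stageMul (X.Kn G.N n).transpose (X.exact G p n) i
      - k • X.exact G p n i‖ := by
      rw [← Real.norm_eq_abs, ← norm_smul, smul_sub, hqdef, smul_inv_smul₀ hk]
    have e3 : ‖k • Q.phi u (X.exact G y n i) q - stageMul (X.Kn G.N n).transpose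
        (X.exact G (fun t => Q.phi u (y t) (p t)) n) i‖ ≤
        Λp' * ‖stageMul (X.Kn G.N n).transpose (X.exact G p n) i - k • X.exact G p n i‖
        + ‖stageMul (X.Kn G.N n).transpose (X.exact G (fun t => Q.phi u (y t) (p t)) n) i
          - k • X.exact G (fun t => Q.phi u (y t) (p t)) n i‖ := by
      rw [← e2, norm_sub_rev (stageMul _ (X.exact G (fun t => Q.phi u (y t) (p t)) n) i)]
      calc _ = ‖k • (Q.phi u (X.exact G y n i) q
            - Q.phi u (X.exact G y n i) (X.exact G p n i))
            + (k • X.exact G (fun t => Q.phi u (y t) (p t)) n i - stageMul (X.Kn G.N n).transpose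
              (X.exact G (fun t => Q.phi u (y t) (p t)) n) i)‖ := by
            rw [smul_sub]
            simp only [exact]
            congr 1
            abel
        _ ≤ _ := by
            refine (norm_add_le _ _).trans (add_le_add_left ?_ _)
            rw [norm_smul, Real.norm_eq_abs]
            calc _ ≤ |k| * (Λp' * ‖q - X.exact G p n i‖) :=
                  mul_le_mul_of_nonneg_left e1 (abs_nonneg _)
              _ = _ := by ring
    calc _ ≤ G.h n * (Λp' * ‖stageMul (X.Kn G.N n).transpose (X.exact G p n) i
          - k • X.exact G p n i‖
          + ‖stageMul (X.Kn G.N n).transpose (X.exact G (fun t => Q.phi u (y t) (p t)) n) i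
          - k • X.exact G (fun t => Q.phi u (y t) (p t)) n i‖) :=
          mul_le_mul_of_nonneg_left e3 hh
      _ = Λp' * (G.h n * ‖stageMul (X.Kn G.N n).transpose (X.exact G p n) i
          - k • X.exact G p n i‖)
          + G.h n * ‖stageMul (X.Kn G.N n).transpose
            (X.exact G (fun t => Q.phi u (y t) (p t)) n) i
          - k • X.exact G (fun t => Q.phi u (y t) (p t)) n i‖ := by ring
      _ ≤ Λp' * (defectConst r κ * (1 + T) *
          (X.derivBound G p Tstar + boundaryTerm X G (X.Kn G.N n) p Tstar n))
          + defectConst r κ * (X.derivBound G p Tstar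
            + boundaryTerm X G (X.Kn G.N n) p Tstar n) := by
          refine add_le_add (mul_le_mul_of_nonneg_left (hdev i) hΛ) ((hdev' i).trans ?_)
          gcongr
          linarith
      _ = _ := by ring

/-- The constant in the estimate of the residual of the exact solution; `L` bounds the
super-convergence residuals relative to the stepsize and `Λ` the derivative of `φ`. -/
noncomputable def residualConst (r : ℕ) (κ γ T L Λ : ℝ) : ℝ :=
  stabConst r κ γ * (defectConst r κ * (κ * (1 + T) + 2 * (1 + (1 + T) * Λ) + 2 * (1 + T) + 2)
    + T * (defectConst r κ + L))

lemma stateMap_exact_sub_le (hr : 2 ≤ r) (hX : X.Structural) (hstd : X.StandardOrder r r) {qb : ℕ}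
    (hstart : X.StartOrder r r qb) (hend : X.EndOrder r r qb)
    (hstab : X.UniformlyZeroStable W σlo σhi) (hdamp : X.UniformlyDamped W σlo σhi γ)
    (hγ0 : 0 ≤ γ) (hγ : γ < 1) (hlo : 0 < σlo) (hκ : X.BoundedBy W σlo σhi κ)
    (hG : G.Admissible X.cstar T Tstar σlo σhi H) (hTs : 0 < Tstar) (hy0 : y 0 = Q.y0)
    (hy : ContDiffOn ℝ (r + 1 : ℕ) y (Icc 0 Tstar))
    (hy' : ∀ τ ∈ Icc 0 Tstar, HasDerivWithinAt y (Q.g u (y τ) (p τ)) (Icc 0 Tstar) τ)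
    {L Λ : ℝ} (hL0 : 0 ≤ L) (hΛ : 0 ≤ Λ)
    (hL : ∀ n, 1 ≤ n → n < G.N → |X.supState r (G.ratio n)| ≤ L * G.h n) :
    ∀ n ≤ G.N, maxSeminorm W⁻¹
        (X.stateMap Q u G (X.exact G y) (X.exact G p) n - X.exact G y n) ≤
      residualConst r κ γ T L Λ * X.derivBound G y Tstar := by
  have hκ0 := hκ.nonneg
  have hN := hG.1
  have hT : 0 ≤ T := (hG.2.1 0 (by omega)).le.trans (hG.h_le (by omega))
  have hC0 : 0 ≤ defectConst r κ := defectConst_nonneg hκ0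
  have hR := derivBound_nonneg (v := y) hG
  set R := X.derivBound G y Tstar with hRdef
  set C := defectConst r κ with hCdef
  set g' : ℝ → Eu m := fun t => Q.g u (y t) (p t) with hg'
  have hrhs : ∀ n, X.stateRhs Q u G (X.exact G y) (X.exact G p) n =
      (if n = 0 then fun i => X.a i • Q.y0 else 0)
        + G.h n • stageMul (X.Kn G.N n) (X.exact G g' n) := fun n => rfl
  set res : ℕ → Fin (r + 1) → Eu m := fun n => stageMul (X.An G.N n) (X.exact G y n)
    - (if n = 0 then 0 else stageMul (X.B (G.ratio n)) (X.exact G y (n - 1)))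
    - X.stateRhs Q u G (X.exact G y) (X.exact G p) n with hres
  have hsplit : ∀ n, ∃ α β : Fin (r + 1) → Eu m, n ≤ G.N → -res n = α + β ∧
      (n = 0 ∨ n = G.N → β = 0) ∧ ∑ i, β i = 0 ∧ ‖β‖ ≤ 2 * C * R ∧
      ‖α‖ ≤ (if n = 0 then C * (1 + T) * R else 0) + (if n = G.N then C * (1 + T) * R else 0)
        + G.h n * ((C + L) * R) := by
    intro n
    by_cases hn : n ≤ G.N
    swap
    · exact ⟨0, 0, fun h => absurd h hn⟩
    have hh := (hG.2.1 n hn).le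
    have hlast : 0 ≤ G.h n * ((C + L) * R) := by positivity
    rcases Nat.eq_zero_or_pos n with rfl | hn0
    · refine ⟨-res 0, 0, fun _ => ⟨by simp, fun _ => rfl, by simp, by simp; positivity, ?_⟩⟩
      have e : res 0 = stageMul X.A0 (X.exact G y 0) - (fun i => X.a i • y 0)
          - G.h 0 • stageMul X.K0 (X.exact G g' 0) := by
        simp only [hres, hrhs, if_true, An_zero, Kn_zero, hy0]
        abel
      have := norm_stateResidual_start_le hκ hX.1 hstart hG hTs hy hy'
      rw [norm_neg, e, if_pos rfl, if_neg (by omega), add_zero]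
      exact this.trans (le_add_of_nonneg_right hlast)
    · have e : ∀ n, 0 < n → res n = stateResidual X G (X.An G.N n) (X.Kn G.N n) y g' n := by
        intro n hn
        simp only [hres, hrhs, if_neg hn.ne', zero_add, stateResidual]
      rcases hn.lt_or_eq with hnN | rfl
      · obtain ⟨α, β, h1, h2, h3, h4⟩ := exists_stateResidual_split hκ hX.1 hlo hstd hG hTs hy hy'
          hn0 hn hL0 (hL n hn0 hnN)
        rw [← An_of_lt X hn0 hnN, ← Kn_of_lt X hn0 hnN, ← e n hn0] at h1
        refine ⟨-α, -β, fun _ => ⟨by rw [h1]; abel, fun h => by omega, by simp [h2], by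
          rw [norm_neg]; exact h3, ?_⟩⟩
        rw [norm_neg, if_neg hn0.ne', if_neg hnN.ne, zero_add, zero_add]
        refine h4.trans (le_of_eq (by ring))
      · refine ⟨-res G.N, 0, fun _ => ⟨by simp, fun _ => rfl, by simp, by simp; positivity, ?_⟩⟩
        rw [norm_neg, e _ hn0, An_last X hN, Kn_last X hN, if_neg hn0.ne', if_pos rfl, zero_add]
        exact (norm_stateResidual_end_le hκ hX.1 hlo hend hG hTs hy hy').trans
          (le_add_of_nonneg_right hlast)
  choose α β hαβ using hsplit
  intro n hn
  have hA := fun n => hX.isUnit_An G.N n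
  have key := forward_stable (by omega) hX hstd hstab hdamp hγ0 hγ hlo hκ hG
    (b := 2 * C * R) (by positivity)
    (fun n => X.stateMap Q u G (X.exact G y) (X.exact G p) n - X.exact G y n) α β ?_ ?_
    ((hαβ G.N le_rfl).2.1 (Or.inr rfl))
    (fun n _ h2 => ⟨(hαβ n h2.le).2.2.1, (hαβ n h2.le).2.2.2.1⟩) n hn
  · refine key.trans ?_
    rw [residualConst, mul_assoc (stabConst r κ γ)]
    refine mul_le_mul_of_nonneg_left ?_ (stabConst_nonneg hγ)
    refine (add_le_add_left (sum_norm_le_of_step_bound fun n hn => (hαβ n hn).2.2.2.2) _).trans ?_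
    rw [hG.sum_h]
    have h1 : 0 ≤ C * (κ * (1 + T) + 2 * (1 + (1 + T) * Λ)) * R := by positivity
    linarith
  · have h1 : α 0 = -res 0 := by
      rw [(hαβ 0 (by omega)).1, (hαβ 0 (by omega)).2.1 (Or.inl rfl), add_zero]
    simp only [h1, hres, if_true, sub_zero, neg_sub, stageMul_sub]
    rw [stageMul_inv_cancel (hA 0)]
    rfl
  · intro n h1 h2
    rw [← (hαβ n h2).1]
    simp only [stateMap]
    rw [recSeq_of_pos _ _ h1]
    simp only [hres, if_neg (show n ≠ 0 by omega), stageLin_apply, stageMul_sub, neg_sub,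
      stageMul_inv_cancel (hA n)]
    rw [stepMat, stageMul_mul _ _ (X.exact G y (n - 1))]
    abel

lemma backMap_exact_sub_le (hr : 2 ≤ r) (hX : X.Structural) (hstd : X.StandardOrder r r) {qb : ℕ}
    (hqb : r - 1 ≤ qb) (hqb2 : qb ≤ 2)
    (hstart : X.StartOrder r r qb) (hend : X.EndOrder r r qb)
    (hstab : X.UniformlyZeroStable W σlo σhi) (hdamp : X.UniformlyDamped W σlo σhi γ)
    (hγ0 : 0 ≤ γ) (hγ : γ < 1) (hlo : 0 < σlo) (hκ : X.BoundedBy W σlo σhi κ)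
    (hQ : Q.Regular) (hGam : Q.Gam ≤ 1)
    (hscal : ControlProblem.ControlScaling X u (ControlProblem.tube y p Tstar ρ)) (hρ : 0 < ρ)
    (hD : Q.DerivativeBounds u (ControlProblem.tube y p Tstar ρ) Λy Λp Λy' Λp')
    (hΛp : 0 ≤ Λp') (hG : G.Admissible X.cstar T Tstar σlo σhi H) (hTs : 0 < Tstar)
    (hpT : p T = gradient Q.C (y T))
    (hy : ContDiffOn ℝ (r + 1 : ℕ) y (Icc 0 Tstar))
    (hp : ContDiffOn ℝ (r + 1 : ℕ) p (Icc 0 Tstar))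
    (hy' : ∀ τ ∈ Icc 0 Tstar, HasDerivWithinAt y (Q.g u (y τ) (p τ)) (Icc 0 Tstar) τ)
    (hp' : ∀ τ ∈ Icc 0 Tstar, HasDerivWithinAt p (Q.phi u (y τ) (p τ)) (Icc 0 Tstar) τ)
    (hnear : NearExact X G y p ρ (X.exact G y) (X.exact G p))
    {L Λ : ℝ} (hL0 : 0 ≤ L) (hΛ : Λp' ≤ Λ)
    (hL : ∀ n, 1 ≤ n → n < G.N → |X.supAdjoint r (G.ratio (n + 1))| ≤ L * G.h n) :
    ∀ k ≤ G.N, sumSeminorm (X.Wdag W)⁻¹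
        (X.backMap Q u G (X.exact G y) (X.exact G p) k - X.exact G p (G.N - k)) ≤
      residualConst r κ γ T L Λ * (X.derivBound G y Tstar + X.derivBound G p Tstar
        + boundaryTerm X G X.K0 p Tstar 0 + boundaryTerm X G X.KN p Tstar G.N) := by
  have hκ0 := hκ.nonneg
  have hN := hG.1
  have hT : 0 ≤ T := (hG.2.1 0 (by omega)).le.trans (hG.h_le (by omega))
  have hC0 : 0 ≤ defectConst r κ := defectConst_nonneg hκ0
  have hRy := derivBound_nonneg (v := y) hG
  have hRp := derivBound_nonneg (v := p) hG
  have hB0 := boundaryTerm_nonneg (p := p) hG X.K0 (Nat.zero_le _)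
  have hBN := boundaryTerm_nonneg (p := p) hG X.KN (le_refl G.N)
  have hΛ0 : 0 ≤ Λ := hΛp.trans hΛ
  set R := X.derivBound G y Tstar + X.derivBound G p Tstar
        + boundaryTerm X G X.K0 p Tstar 0 + boundaryTerm X G X.KN p Tstar G.N with hRdef
  have hR : 0 ≤ R := by positivity
  have hRyR : X.derivBound G y Tstar ≤ R := by linarith
  have hRpR : X.derivBound G p Tstar ≤ R := by linarith
  set C := defectConst r κ with hCdef
  set p' : ℝ → Eu m := fun t => Q.phi u (y t) (p t) with hp'def
  set dev : ℕ → Fin (r + 1) → Eu m := fun n =>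
    G.h n • (phiStage Q u (X.Kn G.N n) (X.exact G y n) (X.exact G p n)
        - stageMul (X.Kn G.N n).transpose (X.exact G p' n)) with hdev
  have hdev0 : ‖dev 0‖ ≤ C * (1 + (1 + T) * Λ) * R := by
    refine (norm_phiStage_exact_sub_le hr hX hκ hscal hD hΛp hG hTs hp hp' hnear
      (Nat.zero_le _) (by rw [Kn_zero]; exact oneLeg_of_lt hqb hqb2 hstart.2.2.2.2)).trans ?_
    rw [Kn_zero]
    gcongr
    linarith
  have hdevN : ‖dev G.N‖ ≤ C * (1 + (1 + T) * Λ) * R := by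
    refine (norm_phiStage_exact_sub_le hr hX hκ hscal hD hΛp hG hTs hp hp' hnear
      le_rfl (by rw [Kn_last X hN]; exact oneLeg_of_lt hqb hqb2 hend.2.2.2)).trans ?_
    rw [Kn_last X hN]
    gcongr
    linarith
  set fin : Fin (r + 1) → Eu m := fun i => X.w i •
    (gradient Q.C (∑ j, X.w j • X.exact G y G.N j) - p T) with hfin
  have hfinle : ‖fin‖ ≤ κ * (C * (1 + T) * R) := by
    refine (pi_norm_le_iff_of_nonneg (by positivity)).2 fun i => ?_
    rw [hfin, norm_smul, Real.norm_eq_abs]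
    refine mul_le_mul (hκ.w i) ?_ (norm_nonneg _) hκ0
    rw [hpT]
    refine (hQ.norm_gradient_sub_le _ _).trans ((mul_le_of_le_one_left (norm_nonneg _) hGam).trans
      ((norm_end_value_sub_le hκ hX.1 hend hG hTs hy hy').trans ?_))
    exact mul_le_mul_of_nonneg_left hRyR (by positivity)
  set res : ℕ → Fin (r + 1) → Eu m := fun k =>
    stageMul (X.An G.N (G.N - k)).transpose (X.exact G p (G.N - k))
    - (if k = 0 then 0 else
        stageMul (X.B (G.ratio (G.N - k + 1))).transpose (X.exact G p (G.N - k + 1)))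
    - X.adjointRhs Q u G (X.exact G y) (X.exact G p) k with hres
  have e0 : res 0 = stageMul X.AN.transpose (X.exact G p G.N) - (fun i => X.w i • p T)
      + G.h G.N • stageMul X.KN.transpose (X.exact G p' G.N) - fin + dev G.N := by
    simp only [hres, adjointRhs, if_true, An_last X hN, Nat.sub_zero, hfin, hdev, Kn_last X hN,
      smul_sub]
    funext i
    simp only [Pi.sub_apply, Pi.add_apply, Pi.zero_apply]
    abel
  have e : ∀ k, 0 < k → res k =
      adjointResidual X G (X.An G.N (G.N - k)) (X.Kn G.N (G.N - k)) p p' (G.N - k)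
        + dev (G.N - k) := by
    intro k hk
    simp only [hres, adjointRhs, if_neg hk.ne', zero_sub, sub_neg_eq_add, adjointResidual, hdev,
      smul_sub]
    abel
  set A : ℝ := C * (1 + T) * R + κ * (C * (1 + T) * R) + C * (1 + (1 + T) * Λ) * R with hAdef
  set B : ℝ := C * (1 + T) * R + C * (1 + (1 + T) * Λ) * R with hBdef
  have hA0 : 0 ≤ A := by positivity
  have hB0' : 0 ≤ B := by positivity
  have hsplit : ∀ k, ∃ α β : Fin (r + 1) → Eu m, k ≤ G.N → -res k = α + β ∧
      (k = 0 ∨ k = G.N → β = 0) ∧ ∑ i, β i = 0 ∧ ‖β‖ ≤ 2 * C * R ∧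
      ‖α‖ ≤ (if k = 0 then A else 0) + (if k = G.N then B else 0)
        + G.h (G.N - k) * ((C + L) * R) := by
    intro k
    by_cases hk : k ≤ G.N
    swap
    · exact ⟨0, 0, fun h => absurd h hk⟩
    have hh := (hG.2.1 (G.N - k) (by omega)).le
    have hlast : 0 ≤ G.h (G.N - k) * ((C + L) * R) := by positivity
    rcases Nat.eq_zero_or_pos k with rfl | hk0
    · refine ⟨-res 0, 0, fun _ => ⟨by simp, fun _ => rfl, by simp, by simp; positivity, ?_⟩⟩
      rw [norm_neg, e0, if_pos rfl, if_neg (by omega), add_zero]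
      have h1 := (norm_adjointResidual_end_le hκ hX.1 hend hG hTs hp hp').trans
        (mul_le_mul_of_nonneg_left hRpR (by positivity))
      exact ((norm_add_le _ _).trans (add_le_add ((norm_sub_le _ _).trans
        (add_le_add h1 hfinle)) hdevN)).trans (le_add_of_nonneg_right hlast)
    · rcases hk.lt_or_eq with hkN | rfl
      · obtain ⟨α, β, h1, h2, h3, h4⟩ := exists_adjointResidual_split hκ hX.1 hlo hX.2.2.2.2.1 hstd
          hG hTs hp hp' (n := G.N - k) (by omega) hL0 (hL (G.N - k) (by omega) (by omega))
        have hd0 : dev (G.N - k) = 0 := by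
          simp only [hdev]
          rw [phiStage_exact_eq hX hscal hρ hG (by omega) (by omega), sub_self, smul_zero]
        have h1' : res k = α + β := by
          rw [e k hk0, hd0, add_zero, An_of_lt X (by omega) (by omega),
            Kn_of_lt X (by omega) (by omega)]
          exact h1
        refine ⟨-α, -β, fun _ => ⟨by rw [h1']; abel, fun h => by omega, by simp [h2], ?_, ?_⟩⟩
        · rw [norm_neg]
          exact h3.trans (mul_le_mul_of_nonneg_left hRpR (by positivity))
        · rw [norm_neg, if_neg hk0.ne', if_neg hkN.ne, zero_add, zero_add]
          refine h4.trans ((mul_le_mul_of_nonneg_left hRpR (by positivity)).trans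
            (le_of_eq (by ring)))
      · refine ⟨-res G.N, 0, fun _ => ⟨by simp, fun _ => rfl, by simp, by simp; positivity, ?_⟩⟩
        rw [norm_neg, e _ hk0, Nat.sub_self, An_zero, Kn_zero, if_neg hk0.ne', if_pos rfl, zero_add]
        rw [Nat.sub_self] at hlast
        have h1 := (norm_adjointResidual_start_le hκ hX.1 hlo hstart hG hTs hp hp').trans
          (mul_le_mul_of_nonneg_left hRpR (by positivity))
        exact ((norm_add_le _ _).trans (add_le_add h1 hdev0)).trans
          (le_add_of_nonneg_right hlast)
  choose α β hαβ using hsplit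
  intro k hk
  have hAT : ∀ n, IsUnit (X.An G.N n).transpose.det := fun n => by
    rw [Matrix.det_transpose]; exact hX.isUnit_An G.N n
  have key := backward_stable (by omega) hX hstd hstab hdamp hγ0 hγ hlo hκ hG
    (b := 2 * C * R) (by positivity)
    (fun k => X.backMap Q u G (X.exact G y) (X.exact G p) k - X.exact G p (G.N - k)) α β ?_ ?_
    ((hαβ G.N le_rfl).2.1 (Or.inr rfl))
    (fun n _ h2 => ⟨(hαβ n h2.le).2.2.1, (hαβ n h2.le).2.2.2.1⟩) k hk
  · refine key.trans ?_
    rw [residualConst, mul_assoc (stabConst r κ γ)]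
    refine mul_le_mul_of_nonneg_left ?_ (stabConst_nonneg hγ)
    refine (add_le_add_left (sum_norm_le_of_step_bound fun n hn => (hαβ n hn).2.2.2.2) _).trans ?_
    rw [hG.sum_h_reflect, hAdef, hBdef]
    exact le_of_eq (by ring)
  · have h1 : α 0 = -res 0 := by
      rw [(hαβ 0 (by omega)).1, (hαβ 0 (by omega)).2.1 (Or.inl rfl), add_zero]
    simp only [h1, hres, if_true, sub_zero, neg_sub, stageMul_sub, Nat.sub_zero]
    rw [stageMul_inv_cancel (hAT G.N)]
    rfl
  · intro n h1 h2
    rw [← (hαβ n h2).1]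
    simp only [backMap]
    rw [recSeq_of_pos _ _ h1]
    simp only [hres, if_neg (show n ≠ 0 by omega), stageLin_apply, stageMul_sub, neg_sub,
      stageMul_inv_cancel (hAT (G.N - n)), show G.N - (n - 1) = G.N - n + 1 by omega]
    rw [backMat, stageMul_mul _ _ (X.exact G p (G.N - n + 1))]
    abel

end PeerTriplet

/-! ### Existence, uniqueness and error bound -/

section FixedPoint

variable {V : Type*} [AddCommGroup V] [Module ℝ V]

/-- A weighted maximum norm on pairs of finite sequences. -/
lemma exists_seminorm_pair (N : ℕ) (A B : Seminorm ℝ V) {θ : ℝ} (hθ : 0 ≤ θ) :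
    ∃ ν : Seminorm ℝ ((Fin (N + 1) → V) × (Fin (N + 1) → V)), ∀ x R, 0 ≤ R →
      (ν x ≤ R ↔ ∀ n, A (x.1 n) ≤ R ∧ θ * B (x.2 n) ≤ R) := by
  lift θ to NNReal using hθ
  set f : Fin (N + 1) → Seminorm ℝ ((Fin (N + 1) → V) × (Fin (N + 1) → V)) := fun n =>
    A.comp ((LinearMap.proj (φ := fun _ : Fin (N + 1) => V) n).comp
        (LinearMap.fst ℝ (Fin (N + 1) → V) (Fin (N + 1) → V))) ⊔
      θ • B.comp ((LinearMap.proj (φ := fun _ : Fin (N + 1) => V) n).comp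
        (LinearMap.snd ℝ (Fin (N + 1) → V) (Fin (N + 1) → V))) with hf
  have hfx : ∀ n x R, f n x ≤ R ↔ A (x.1 n) ≤ R ∧ θ * B (x.2 n) ≤ R := fun n x R => by
    rw [hf, Seminorm.sup_apply, max_le_iff]
    rfl
  refine ⟨Finset.univ.sup f, fun x R hR => ⟨fun h n => ?_, fun h => ?_⟩⟩
  · exact (hfx n x R).1 ((Seminorm.le_finset_sup_apply (Finset.mem_univ n)).trans h)
  · exact Seminorm.finset_sup_apply_le hR fun n _ => (hfx n x R).2 (h n)

/-- A contraction of pairs of finite sequences, in a weighted maximum norm, has a fixed point. The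
sequences are represented by functions on `ℕ`, of which only the values up to `N` matter. -/
lemma exists_fixedPoint_pair [FiniteDimensional ℝ V] (N : ℕ) (A B : Seminorm ℝ V)
    (hA : ∀ x, A x = 0 → x = 0) (hB : ∀ x, B x = 0 → x = 0) {θ R : ℝ} (hθ : 0 < θ) (hR : 0 ≤ R)
    (F₁ F₂ : (ℕ → V) → (ℕ → V) → ℕ → V)
    (hmaps : ∀ Y P, (∀ n ≤ N, A (Y n) ≤ R ∧ θ * B (P n) ≤ R) →
      ∀ n ≤ N, A (F₁ Y P n) ≤ R ∧ θ * B (F₂ Y P n) ≤ R)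
    (hcontr : ∀ Y P Y' P' D, 0 ≤ D → (∀ n ≤ N, A (Y n) ≤ R ∧ θ * B (P n) ≤ R) →
      (∀ n ≤ N, A (Y' n) ≤ R ∧ θ * B (P' n) ≤ R) →
      (∀ n ≤ N, A (Y n - Y' n) ≤ D ∧ θ * B (P n - P' n) ≤ D) →
      ∀ n ≤ N, A (F₁ Y P n - F₁ Y' P' n) ≤ 1 / 2 * D ∧
        θ * B (F₂ Y P n - F₂ Y' P' n) ≤ 1 / 2 * D) :
    ∃ Y P : ℕ → V, (∀ n ≤ N, A (Y n) ≤ R ∧ θ * B (P n) ≤ R) ∧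
      ∀ n ≤ N, Y n = F₁ Y P n ∧ P n = F₂ Y P n := by
  obtain ⟨ν, hν⟩ := exists_seminorm_pair N A B hθ.le
  set e : (Fin (N + 1) → V) → ℕ → V := fun x n => if h : n < N + 1 then x ⟨n, h⟩ else 0 with he
  have hel : ∀ x n, (h : n ≤ N) → e x n = x ⟨n, Nat.lt_succ_of_le h⟩ := fun x n h => by
    rw [he]; exact dif_pos (Nat.lt_succ_of_le h)
  have hν' : ∀ x R, 0 ≤ R →
      (ν x ≤ R ↔ ∀ n ≤ N, A (e x.1 n) ≤ R ∧ θ * B (e x.2 n) ≤ R) := fun x R hR => by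
    rw [hν x R hR]
    refine ⟨fun h n hn => by rw [hel _ _ hn, hel _ _ hn]; exact h _, fun h n => ?_⟩
    have := h n (Nat.lt_succ_iff.1 n.2)
    rwa [hel _ _ (Nat.lt_succ_iff.1 n.2), hel _ _ (Nat.lt_succ_iff.1 n.2)] at this
  set f : (Fin (N + 1) → V) × (Fin (N + 1) → V) → (Fin (N + 1) → V) × (Fin (N + 1) → V) :=
    fun x => (fun n => F₁ (e x.1) (e x.2) n, fun n => F₂ (e x.1) (e x.2) n) with hf
  obtain ⟨x, hx, hfx⟩ := exists_fixedPoint_of_seminorm ν (fun x hx => by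
      have h := (hν x 0 le_rfl).1 hx.le
      refine Prod.ext (funext fun n => hA _ (le_antisymm (h n).1 (apply_nonneg _ _)))
        (funext fun n => hB _ (le_antisymm ?_ (apply_nonneg _ _)))
      exact nonpos_of_mul_nonpos_right (h n).2 hθ) f hR
    (fun x hx => (hν _ R hR).2 fun n =>
      hmaps _ _ ((hν' x R hR).1 hx) n (Nat.lt_succ_iff.1 n.2))
    (fun x y hx hy => (hν _ _ (by positivity)).2 fun n => by
      refine hcontr _ _ _ _ (ν (x - y)) (apply_nonneg _ _) ((hν' x R hR).1 hx)
        ((hν' y R hR).1 hy) (fun n hn => ?_) n (Nat.lt_succ_iff.1 n.2)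
      have := (hν' (x - y) _ (apply_nonneg _ _)).1 le_rfl n hn
      simpa only [hel _ _ hn, Prod.fst_sub, Prod.snd_sub, Pi.sub_apply] using this)
  refine ⟨e x.1, e x.2, (hν' x R hR).1 hx, fun n hn => ?_⟩
  have h1 := congrFun (congrArg Prod.fst hfx) ⟨n, Nat.lt_succ_of_le hn⟩
  have h2 := congrFun (congrArg Prod.snd hfx) ⟨n, Nat.lt_succ_of_le hn⟩
  rw [hel _ _ hn, hel _ _ hn]
  exact ⟨h1.symm, h2.symm⟩

/-- An approximate fixed point `(y, p)` of a local contraction has a unique exact fixed point in its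
neighbourhood, at a distance of at most twice the residual. -/
lemma exists_unique_fixedPoint_near [FiniteDimensional ℝ V] (N : ℕ) (A B : Seminorm ℝ V)
    (hA : ∀ x, A x = 0 → x = 0) (hB : ∀ x, B x = 0 → x = 0) {θ ε δ : ℝ} (hθ : 0 < θ) (hθ1 : θ ≤ 1)
    (hε : 0 ≤ ε) (hδ : 0 ≤ δ) (hδε : δ ≤ 1 / 2 * (θ * ε))
    (F₁ F₂ : (ℕ → V) → (ℕ → V) → ℕ → V) (y p : ℕ → V)
    (hcontr : ∀ Y P Y' P' D, 0 ≤ D → (∀ n ≤ N, A (Y n - y n) ≤ ε ∧ B (P n - p n) ≤ ε) →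
      (∀ n ≤ N, A (Y' n - y n) ≤ ε ∧ B (P' n - p n) ≤ ε) →
      (∀ n ≤ N, A (Y n - Y' n) ≤ D ∧ θ * B (P n - P' n) ≤ D) →
      ∀ n ≤ N, A (F₁ Y P n - F₁ Y' P' n) ≤ 1 / 2 * D ∧
        θ * B (F₂ Y P n - F₂ Y' P' n) ≤ 1 / 2 * D)
    (hres : ∀ n ≤ N, A (F₁ y p n - y n) ≤ δ ∧ θ * B (F₂ y p n - p n) ≤ δ) :
    ∃ Y P : ℕ → V, (∀ n ≤ N, Y n = F₁ Y P n ∧ P n = F₂ Y P n) ∧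
      (∀ n ≤ N, A (Y n - y n) ≤ ε ∧ B (P n - p n) ≤ ε) ∧
      (∀ n ≤ N, A (Y n - y n) ≤ 2 * δ ∧ θ * B (P n - p n) ≤ 2 * δ) ∧
      ∀ Y' P' : ℕ → V, (∀ n ≤ N, Y' n = F₁ Y' P' n ∧ P' n = F₂ Y' P' n) →
        (∀ n ≤ N, A (Y' n - y n) ≤ ε ∧ B (P' n - p n) ≤ ε) →
        ∀ n ≤ N, Y' n = Y n ∧ P' n = P n := by
  have hball : ∀ a b, A a ≤ 2 * δ ∧ θ * B b ≤ 2 * δ → A a ≤ ε ∧ B b ≤ ε := fun a b h =>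
    ⟨h.1.trans ((by linarith : 2 * δ ≤ θ * ε).trans (mul_le_of_le_one_left hε hθ1)),
      le_of_mul_le_mul_left (h.2.trans (by linarith : 2 * δ ≤ θ * ε)) hθ⟩
  have hnear : ∀ Y P : ℕ → V, (∀ n ≤ N, A (Y n) ≤ 2 * δ ∧ θ * B (P n) ≤ 2 * δ) →
      ∀ n ≤ N, A (y n + Y n - y n) ≤ ε ∧ B (p n + P n - p n) ≤ ε := fun Y P h n hn => by
    rw [add_sub_cancel_left, add_sub_cancel_left]
    exact hball _ _ (h n hn)
  have hnear0 : ∀ n ≤ N, A (y n - y n) ≤ ε ∧ B (p n - p n) ≤ ε := fun n _ => by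
    rw [sub_self, sub_self, map_zero, map_zero]
    exact ⟨hε, hε⟩
  -- The fixed point problem for the errors, in the ball of radius `2 δ`.
  obtain ⟨Y₀, P₀, hbd, hfix⟩ := exists_fixedPoint_pair N A B hA hB hθ
    (R := 2 * δ) (by positivity)
    (fun Y P n => F₁ (fun n => y n + Y n) (fun n => p n + P n) n - y n)
    (fun Y P n => F₂ (fun n => y n + Y n) (fun n => p n + P n) n - p n)
    (fun Y P h n hn => by
      have hc := hcontr _ _ y p (2 * δ) (by positivity) (hnear Y P h) hnear0
        (fun n hn => by
          rw [add_sub_cancel_left, add_sub_cancel_left]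
          exact h n hn) n hn
      have h1 := map_add_le_add A
        (F₁ (fun n => y n + Y n) (fun n => p n + P n) n - F₁ y p n) (F₁ y p n - y n)
      have h2 := mul_le_mul_of_nonneg_left (map_add_le_add B
        (F₂ (fun n => y n + Y n) (fun n => p n + P n) n - F₂ y p n) (F₂ y p n - p n)) hθ.le
      rw [sub_add_sub_cancel] at h1 h2
      have h3 := hres n hn
      constructor
      · linarith [hc.1, h3.1]
      · linarith [hc.2, h3.2])
    (fun Y P Y' P' D hD0 h h' hdist n hn => by
      have hc := hcontr _ _ _ _ D hD0 (hnear Y P h) (hnear Y' P' h')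
        (fun n hn => by
          rw [add_sub_add_left_eq_sub, add_sub_add_left_eq_sub]
          exact hdist n hn) n hn
      rw [sub_sub_sub_cancel_right, sub_sub_sub_cancel_right]
      exact hc)
  have hsol : ∀ n ≤ N, y n + Y₀ n = F₁ (fun n => y n + Y₀ n) (fun n => p n + P₀ n) n ∧
      p n + P₀ n = F₂ (fun n => y n + Y₀ n) (fun n => p n + P₀ n) n := fun n hn =>
    ⟨add_eq_of_eq_sub' (hfix n hn).1, add_eq_of_eq_sub' (hfix n hn).2⟩
  refine ⟨fun n => y n + Y₀ n, fun n => p n + P₀ n, hsol, hnear Y₀ P₀ hbd, fun n hn => ?_,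
    fun Y' P' hsol' herr' => ?_⟩
  · rw [add_sub_cancel_left, add_sub_cancel_left]
    exact hbd n hn
  · set D : ℕ → ℝ := fun n => max (A (Y' n - (y n + Y₀ n))) (θ * B (P' n - (p n + P₀ n))) with hD
    obtain ⟨k, hk, hmax⟩ := Finset.exists_max_image (Finset.range (N + 1)) D ⟨0, by simp⟩
    have hD0 : ∀ n, 0 ≤ D n := fun n => (apply_nonneg A _).trans (le_max_left _ _)
    have hle : ∀ n ≤ N, A (Y' n - (y n + Y₀ n)) ≤ D k ∧ θ * B (P' n - (p n + P₀ n)) ≤ D k :=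
      fun n hn => max_le_iff.1 (hmax n (Finset.mem_range.2 (Nat.lt_succ_of_le hn)))
    have hkN : k ≤ N := Nat.lt_succ_iff.1 (Finset.mem_range.1 hk)
    have hc := hcontr Y' P' _ _ (D k) (hD0 k) herr' (hnear Y₀ P₀ hbd) hle k hkN
    rw [← (hsol k hkN).1, ← (hsol k hkN).2, ← (hsol' k hkN).1, ← (hsol' k hkN).2] at hc
    have hhalf : D k ≤ 1 / 2 * D k := max_le hc.1 hc.2
    have hzero : D k ≤ 0 := by linarith
    intro n hn
    have h1 := (hle n hn).1.trans hzero
    have h2 := nonpos_of_mul_nonpos_right ((hle n hn).2.trans hzero) hθ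
    exact ⟨sub_eq_zero.1 (hA _ (le_antisymm h1 (apply_nonneg _ _))),
      sub_eq_zero.1 (hB _ (le_antisymm h2 (apply_nonneg _ _)))⟩

end FixedPoint

namespace PeerTriplet

variable {r m d : ℕ} {X : PeerTriplet (r + 1)} {W : Matrix (Fin (r + 1)) (Fin (r + 1)) ℝ}
  {σlo σhi κ γ T Tstar H : ℝ} {G : Grid} {Q : ControlProblem m d} {u : Eu m → Eu m → Eu d}
  {y p : ℝ → Eu m} {ρ Λy Λp Λy' Λp' : ℝ}

/-- Small stage errors and stepsizes keep the arguments of `g` and `φ` inside of the tube. -/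
lemma nearExact_of_le (hX : X.Structural) (hκ : X.BoundedBy W σlo σhi κ) (hW : IsUnit W.det)
    (hG : G.Admissible X.cstar T Tstar σlo σhi H) {p' : ℝ → Eu m} {M ε : ℝ} (hM0 : 0 ≤ M)
    (hε0 : 0 ≤ ε) (hp' : ∀ τ ∈ Icc 0 Tstar, HasDerivWithinAt p (p' τ) (Icc 0 Tstar) τ)
    (hM : ∀ τ ∈ Icc 0 Tstar, ‖p' τ‖ ≤ M)
    (hρ : κ * ((r + 1 : ℕ) * κ * (κ * ε + M * (H * κ))) < ρ) {Y P : ℕ → Fin (r + 1) → Eu m}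
    (hY : ∀ n ≤ G.N, maxSeminorm W⁻¹ (Y n - X.exact G y n) ≤ ε)
    (hP : ∀ n ≤ G.N, sumSeminorm (X.Wdag W)⁻¹ (P n - X.exact G p n) ≤ ε) :
    NearExact X G y p ρ Y P := by
  have hκ0 := hκ.nonneg
  have hκ1 := hκ.one_le
  have hH0 : 0 ≤ H := (hG.2.1 0 (Nat.zero_le _)).le.trans (hG.2.2.2.2.2 0 (Nat.zero_le _))
  have hS : (1 : ℝ) ≤ ((r + 1 : ℕ) : ℝ) := by exact_mod_cast Nat.succ_pos r
  have hερ : κ * ε < ρ := by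
    refine lt_of_le_of_lt ?_ hρ
    have h1 : κ * ε ≤ κ * ε + M * (H * κ) := le_add_of_nonneg_right (by positivity)
    have h2 : 1 ≤ κ * ((r + 1 : ℕ) * κ) :=
      one_le_mul_of_one_le_of_one_le hκ1 (one_le_mul_of_one_le_of_one_le hS hκ1)
    calc κ * ε ≤ κ * ε + M * (H * κ) := h1
      _ ≤ κ * ((r + 1 : ℕ) * κ) * (κ * ε + M * (H * κ)) :=
          le_mul_of_one_le_left (by positivity) h2
      _ = _ := by ring
  intro n hn i
  have hYn := norm_le_of_max hκ hW (hY n hn)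
  have hPn := norm_le_of_sum hκ hX.2.1 hW (hP n hn)
  refine ⟨((norm_le_pi_norm (Y n - X.exact G y n) i).trans hYn).trans_lt hερ,
    ((norm_le_pi_norm (P n - X.exact G p n) i).trans hPn).trans_lt hερ, fun hk => ?_⟩
  set k := ∑ j, X.Kn G.N n j i with hkdef
  have hpp : ∀ j, ‖X.exact G p n j - X.exact G p n i‖ ≤ M * (H * κ) := by
    intro j
    refine (Convex.norm_image_sub_le_of_norm_hasDerivWithin_le hp' hM (convex_Icc _ _)
      (hG.node_mem hn (hX.1 i) (X.c_le_cstar i)) (hG.node_mem hn (hX.1 j) (X.c_le_cstar j))).trans ?_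
    refine mul_le_mul_of_nonneg_left ?_ hM0
    rw [add_sub_add_left_eq_sub, ← mul_sub, norm_mul, Real.norm_eq_abs, Real.norm_eq_abs,
      abs_of_pos (hG.2.1 n hn)]
    refine mul_le_mul (hG.2.2.2.2.2 n hn) ?_ (abs_nonneg _) hH0
    rw [abs_le]
    constructor <;> linarith [hX.1 i, hX.1 j, hκ.c i, hκ.c j]
  have hPp : ∀ j, ‖P n j - X.exact G p n i‖ ≤ κ * ε + M * (H * κ) := fun j => by
    calc _ = ‖(P n j - X.exact G p n j) + (X.exact G p n j - X.exact G p n i)‖ := by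
          congr 1; abel
      _ ≤ _ := (norm_add_le _ _).trans (add_le_add
          ((norm_le_pi_norm (P n - X.exact G p n) j).trans hPn) (hpp j))
  have e : k⁻¹ • stageMul (X.Kn G.N n).transpose (P n) i - X.exact G p n i =
      k⁻¹ • ∑ j, X.Kn G.N n j i • (P n j - X.exact G p n i) := by
    simp only [smul_sub, Finset.sum_sub_distrib, ← Finset.sum_smul, ← hkdef, inv_smul_smul₀ hk]
    rfl
  rw [e, norm_smul, norm_inv, Real.norm_eq_abs]
  refine lt_of_le_of_lt (mul_le_mul (hκ.Kcol _ (X.Kn_mem _ _) i) ?_ (norm_nonneg _) hκ0) hρ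
  refine (norm_sum_le_of_le _ fun j _ => ?_ :
    _ ≤ ∑ _j : Fin (r + 1), κ * (κ * ε + M * (H * κ))).trans (le_of_eq ?_)
  · rw [norm_smul, Real.norm_eq_abs]
    exact mul_le_mul (hκ.K _ (X.Kn_mem _ _) j i) (hPp j) (norm_nonneg _) hκ0
  · simp; ring

lemma localBound_eq (X : PeerTriplet (r + 1)) (G : Grid) (y p : ℝ → Eu m) (Tstar : ℝ) :
    X.localBound G y p Tstar = X.derivBound G y Tstar + X.derivBound G p Tstar
      + boundaryTerm X G X.K0 p Tstar 0 + boundaryTerm X G X.KN p Tstar G.N := rfl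

/-- The local quantity in the error bound tends to zero with the stepsizes. -/
lemma localBound_le (hr : 1 ≤ r) (hG : G.Admissible X.cstar T Tstar σlo σhi H) (hH : H ≤ 1)
    {M : ℝ} (hM0 : 0 ≤ M)
    (hy : ∀ k ≤ r + 1, ∀ τ ∈ Icc 0 Tstar, ‖iteratedDerivWithin k y (Icc 0 Tstar) τ‖ ≤ M)
    (hp : ∀ k ≤ r + 1, ∀ τ ∈ Icc 0 Tstar, ‖iteratedDerivWithin k p (Icc 0 Tstar) τ‖ ≤ M) :
    X.localBound G y p Tstar ≤ 4 * (H * M) := by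
  have hH0 : 0 ≤ H := (hG.2.1 0 (Nat.zero_le _)).le.trans (hG.2.2.2.2.2 0 (Nat.zero_le _))
  have hstep : ∀ n ≤ G.N, ∀ S, 0 ≤ S → S ≤ M → G.h n ^ r * S ≤ H * M := by
    intro n hn S hS0 hS
    have h0 := (hG.2.1 n hn).le
    have hle := hG.2.2.2.2.2 n hn
    have : G.h n ^ r ≤ H := (pow_le_of_le_one h0 (hle.trans hH) (by omega)).trans hle
    exact mul_le_mul this hS hS0 hH0
  have hδ : ∀ L : Matrix (Fin (r + 1)) (Fin (r + 1)) ℝ, oneLegDefect X.c L r ≤ 1 := fun L => by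
    unfold oneLegDefect; split_ifs <;> norm_num
  have hb : ∀ L, ∀ n ≤ G.N, boundaryTerm X G L p Tstar n ≤ H * M := by
    intro L n hn
    have h1 : (0 : ℝ) ≤ G.h n ^ r * G.semi X.cstar Tstar p (r - 1) (r - 1) n :=
      mul_nonneg (pow_nonneg (hG.2.1 n hn).le _) (G.semi_nonneg _ _ _ _ _ _)
    exact (mul_le_of_le_one_left h1 (hδ L)).trans
      (hstep n hn _ (G.semi_nonneg _ _ _ _ _ _) (hG.semi_le hM0 hp (by omega)))
  have hy1 : X.derivBound G y Tstar ≤ H * M := Grid.maxOver_le fun n hn =>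
    hstep n hn _ (G.semi_nonneg _ _ _ _ _ _) (hG.semi_le hM0 hy le_rfl)
  have hp1 : X.derivBound G p Tstar ≤ H * M := Grid.maxOver_le fun n hn =>
    hstep n hn _ (G.semi_nonneg _ _ _ _ _ _) (hG.semi_le hM0 hp le_rfl)
  rw [localBound_eq]
  linarith [hb X.K0 0 (Nat.zero_le _), hb X.KN G.N le_rfl]

lemma residualConst_nonneg {L Λ : ℝ} (hγ : γ < 1) (hκ : 0 ≤ κ) (hT : 0 ≤ T) (hL : 0 ≤ L)
    (hΛ : 0 ≤ Λ) : 0 ≤ residualConst r κ γ T L Λ := by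
  have h1 := stabConst_nonneg (r := r) (κ := κ) hγ
  have h2 := defectConst_nonneg (r := r) hκ
  unfold residualConst
  positivity

/-- Super-convergence on classes of grids where the super-convergence residuals are of the order of
the stepsize. The iteration contracts by the factor `1 / 2` in the norm
`max {|||Y|||, |||P||| / (4 c)}`, in which the coupling of `P` to `Y` through the end condition,
whose norm is bounded but not small, is harmless. -/
lemma superConvergent_of_residual_le (hr : 2 ≤ r) (hX : X.Structural) (hstd : X.StandardOrder r r)
    {qb : ℕ} (hqb : r - 1 ≤ qb) (hqb2 : qb ≤ 2)
    (hstart : X.StartOrder r r qb) (hend : X.EndOrder r r qb)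
    (hstab : X.UniformlyZeroStable W σlo σhi) (hdamp : X.UniformlyDamped W σlo σhi γ)
    (hγ0 : 0 ≤ γ) (hγ : γ < 1) (hlo : 0 < σlo) (hκ : X.BoundedBy W σlo σhi κ) {c : ℝ}
    (hc1 : 1 ≤ c) (hc : lipConst r κ γ ≤ c) (hT : 0 < T) {L : ℝ} (hL0 : 0 ≤ L)
    (cls : Grid → Prop)
    (hcls : ∀ (G : Grid) (Tstar H : ℝ), G.Admissible X.cstar T Tstar σlo σhi H → cls G →
      ∀ n, 1 ≤ n → n < G.N → |X.supState r (G.ratio n)| ≤ L * G.h n ∧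
        |X.supAdjoint r (G.ratio (n + 1))| ≤ L * G.h n) :
    X.SuperConvergent W σlo σhi (4 * c ^ 2) (4 * c ^ 2) (4 * c ^ 2) (4 * c ^ 2) T
      (8 * c * residualConst r κ γ T L (1 / (8 * c ^ 2 * T)) + 1) cls := by
  have hκ0 := hκ.nonneg
  have hc0 : 0 < c := by linarith
  set μ₀ := residualConst r κ γ T L (1 / (8 * c ^ 2 * T)) with hμ₀def
  have hμ₀ : 0 ≤ μ₀ := residualConst_nonneg hγ hκ0 hT.le hL0 (by positivity)
  intro m d Q u y p Tstar ρ Λy Λp Λy' Λp' hQ hρ hex hy hp _ hscal hD hsm1 hsm2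
  obtain ⟨hTT, hy0, hpT, hode⟩ := hex
  have hTs : 0 < Tstar := hT.trans_le hTT
  obtain ⟨hΛy, hΛp, hΛy', hΛp'⟩ := hD.nonneg hρ hTs.le
  have hy' : ∀ τ ∈ Icc 0 Tstar, HasDerivWithinAt y (Q.g u (y τ) (p τ)) (Icc 0 Tstar) τ :=
    fun τ hτ => (hode τ hτ).1
  have hp' : ∀ τ ∈ Icc 0 Tstar, HasDerivWithinAt p (Q.phi u (y τ) (p τ)) (Icc 0 Tstar) τ :=
    fun τ hτ => (hode τ hτ).2
  have hGam0 : 0 ≤ Q.Gam := norm_nonneg _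
  have hGam : Q.Gam ≤ 1 := by
    have h1 : 0 ≤ (4 * c ^ 2 * Λy' + 4 * c ^ 2 * Λp') * T := by positivity
    have h2 : (2 : ℝ) ≤ ((r + 1 : ℕ) : ℝ) := by exact_mod_cast (by omega : 2 ≤ r + 1)
    have h3 : (1 : ℝ) * Q.Gam ≤ ((r + 1 : ℕ) : ℝ) / 2 * Q.Gam :=
      mul_le_mul_of_nonneg_right (by linarith) hGam0
    linarith
  have hsm2' : 4 * c ^ 2 * (T * (Λy' + Λp')) ≤ 1 / 2 := by
    have : 0 ≤ ((r + 1 : ℕ) : ℝ) / 2 * Q.Gam := by positivity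
    linarith
  have hΛbd : Λp' ≤ 1 / (8 * c ^ 2 * T) := by
    rw [le_div_iff₀ (by positivity)]
    have : 0 ≤ 4 * c ^ 2 * (T * Λy') := by positivity
    linarith
  obtain ⟨M₁, hM₁0, hM₁⟩ := Grid.exists_bound_iteratedDerivWithin hTs hy
  obtain ⟨M₂, hM₂0, hM₂⟩ := Grid.exists_bound_iteratedDerivWithin hTs hp
  set M := M₁ + M₂ with hMdef
  have hM0 : 0 ≤ M := by positivity
  have hMy : ∀ k ≤ r + 1, ∀ τ ∈ Icc 0 Tstar, ‖iteratedDerivWithin k y (Icc 0 Tstar) τ‖ ≤ M :=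
    fun k hk τ hτ => (hM₁ k hk τ hτ).trans (by linarith)
  have hMp : ∀ k ≤ r + 1, ∀ τ ∈ Icc 0 Tstar, ‖iteratedDerivWithin k p (Icc 0 Tstar) τ‖ ≤ M :=
    fun k hk τ hτ => (hM₂ k hk τ hτ).trans (by linarith)
  have hMp' : ∀ τ ∈ Icc 0 Tstar, ‖Q.phi u (y τ) (p τ)‖ ≤ M := fun τ hτ => by
    have := hMp 1 (by omega) τ hτ
    rwa [iteratedDerivWithin_one, (hp' τ hτ).derivWithin (uniqueDiffOn_Icc hTs τ hτ)] at this
  -- `ε` and `H` keep the iterates in the tube; `H` also makes the residual small against `ε`.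
  set E : ℝ := ((r + 1 : ℕ) : ℝ) * κ ^ 3 with hE
  have hκpos : 0 < κ := zero_lt_one.trans_le hκ.one_le
  have hE0 : 0 < E := by positivity
  set ε : ℝ := ρ / (3 * E) with hε
  have hε0 : 0 < ε := by positivity
  set θ : ℝ := 1 / (4 * c) with hθ
  have hθ0 : 0 < θ := by positivity
  have hθ1 : θ ≤ 1 := by rw [hθ, div_le_one (by positivity)]; linarith
  have hθc : θ * (4 * c) = 1 := by rw [hθ]; field_simp
  set H : ℝ := min 1 (min (ρ / (3 * E * (M + 1))) (θ * ε / (8 * (μ₀ + 1) * (M + 1)))) with hH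
  have hH0 : 0 < H := by rw [hH]; positivity
  have hH1 : H ≤ 1 := min_le_left _ _
  have hH2 : E * (M * H) ≤ ρ / 3 := by
    have : H ≤ ρ / (3 * E * (M + 1)) := (min_le_right _ _).trans (min_le_left _ _)
    rw [le_div_iff₀ (by positivity)] at this
    nlinarith [mul_pos hE0 hH0]
  have hH3 : μ₀ * (4 * (H * M)) ≤ 1 / 2 * (θ * ε) := by
    have : H ≤ θ * ε / (8 * (μ₀ + 1) * (M + 1)) := (min_le_right _ _).trans (min_le_right _ _)
    rw [le_div_iff₀ (by positivity)] at this
    have h1 : μ₀ * (H * M) ≤ (μ₀ + 1) * (H * (M + 1)) := by gcongr <;> linarith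
    linarith
  have htube : κ * ((r + 1 : ℕ) * κ * (κ * ε + M * (H * κ))) < ρ := by
    have h1 : κ * ((r + 1 : ℕ) * κ * (κ * ε + M * (H * κ))) = E * ε + E * (M * H) := by
      rw [hE]; ring
    have h2 : E * ε = ρ / 3 := by rw [hε]; field_simp
    rw [h1, h2]; linarith
  refine ⟨ε, hε0, H, hH0, fun G hG hclsG => ?_⟩
  have hN := hG.1
  have hsup := hcls G Tstar H hG hclsG
  set A : Seminorm ℝ (Fin (r + 1) → Eu m) := maxSeminorm W⁻¹ with hA
  set B : Seminorm ℝ (Fin (r + 1) → Eu m) := sumSeminorm (X.Wdag W)⁻¹ with hB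
  have hA0 : ∀ Z, A Z = 0 → Z = 0 := fun Z hZ => by
    have := norm_le_of_max hκ hstab.1 (le_of_eq hZ)
    rw [mul_zero] at this
    exact norm_le_zero_iff.1 this
  have hB0 : ∀ Z, B Z = 0 → Z = 0 := fun Z hZ => by
    have := norm_le_of_sum hκ hX.2.1 hstab.1 (le_of_eq hZ)
    rw [mul_zero] at this
    exact norm_le_zero_iff.1 this
  set ey := X.exact G y with hey
  set ep := X.exact G p with hep
  set loc := X.localBound G y p Tstar with hloc
  have hlocle : loc ≤ 4 * (H * M) := localBound_le (by omega) hG hH1 hM0 hMy hMp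
  have hnear : ∀ Y P : ℕ → Fin (r + 1) → Eu m,
      (∀ n ≤ G.N, A (Y n - ey n) ≤ ε ∧ B (P n - ep n) ≤ ε) → NearExact X G y p ρ Y P :=
    fun Y P h => nearExact_of_le hX hκ hstab.1 hG hM0 hε0.le hp' hMp' htube
      (fun n hn => (h n hn).1) (fun n hn => (h n hn).2)
  have hnear0 : NearExact X G y p ρ ey ep := hnear ey ep fun n _ => by
    simp only [sub_self, map_zero]; exact ⟨hε0.le, hε0.le⟩
  have hcontr : ∀ Y P Y' P' : ℕ → Fin (r + 1) → Eu m, ∀ D, 0 ≤ D → NearExact X G y p ρ Y P →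
      NearExact X G y p ρ Y' P' →
      (∀ n ≤ G.N, A (Y n - Y' n) ≤ D ∧ θ * B (P n - P' n) ≤ D) →
      ∀ n ≤ G.N, A (X.stateMap Q u G Y P n - X.stateMap Q u G Y' P' n) ≤ 1 / 2 * D ∧
        θ * B (X.backMap Q u G Y P (G.N - n) - X.backMap Q u G Y' P' (G.N - n)) ≤ 1 / 2 * D := by
    intro Y P Y' P' D hD0 h h' hdist n hn
    have hYa : ∀ n ≤ G.N, A (Y n - Y' n) ≤ D := fun n hn => (hdist n hn).1
    have hPb : ∀ n ≤ G.N, B (P n - P' n) ≤ 4 * c * D := fun n hn => by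
      have := mul_le_mul_of_nonneg_left (hdist n hn).2 (by positivity : 0 ≤ 4 * c)
      rwa [← mul_assoc, mul_comm (4 * c) θ, hθc, one_mul] at this
    constructor
    · refine (stateMap_sub_le (by omega) hX hstd hstab hdamp hγ0 hγ hlo hκ hD ⟨hΛy, hΛp⟩ hG h h'
        hYa hPb n hn).trans ?_
      calc lipConst r κ γ * (T * (Λy * D + Λp * (4 * c * D))) ≤
            c * (T * (Λy * (4 * c * D) + Λp * (4 * c * D))) := by
            have : D ≤ 4 * c * D := le_mul_of_one_le_left hD0 (by linarith)
            gcongr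
        _ = ((4 * c ^ 2 * Λy + 4 * c ^ 2 * Λp) * T) * D := by ring
        _ ≤ 1 / 2 * D := mul_le_mul_of_nonneg_right hsm1 hD0
    · have h1 := backMap_sub_le (by omega) hX hstd hstab hdamp hγ0 hγ hlo hκ hQ hscal hD
        ⟨hΛy', hΛp'⟩ hG h h' hYa hPb (G.N - n) (Nat.sub_le _ _)
      have h2 : lipConst r κ γ * (T * (Λy' * D + Λp' * (4 * c * D)) + Q.Gam * D) ≤
          1 / 2 * D + c * D := by
        calc lipConst r κ γ * (T * (Λy' * D + Λp' * (4 * c * D)) + Q.Gam * D) ≤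
              c * (T * (Λy' * (4 * c * D) + Λp' * (4 * c * D)) + 1 * D) := by
              have : D ≤ 4 * c * D := le_mul_of_one_le_left hD0 (by linarith)
              gcongr
          _ = 4 * c ^ 2 * (T * (Λy' + Λp')) * D + c * D := by ring
          _ ≤ 1 / 2 * D + c * D := by gcongr
      calc θ * _ ≤ θ * (1 / 2 * D + c * D) := mul_le_mul_of_nonneg_left (h1.trans h2) hθ0.le
        _ ≤ θ * (c * D + c * D) := by
            gcongr; linarith
        _ = θ * (4 * c) * (1 / 2 * D) := by ring
        _ = 1 / 2 * D := by rw [hθc, one_mul]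
  have hresY : ∀ n ≤ G.N, A (X.stateMap Q u G ey ep n - ey n) ≤ μ₀ * loc := fun n hn => by
    refine (stateMap_exact_sub_le hr hX hstd hstart hend hstab hdamp hγ0 hγ hlo hκ hG hTs hy0 hy hy'
      hL0 (by positivity : 0 ≤ 1 / (8 * c ^ 2 * T)) (fun n h1 h2 => (hsup n h1 h2).1) n hn).trans ?_
    refine mul_le_mul_of_nonneg_left ?_ hμ₀
    rw [hloc, localBound_eq]
    have h1 := derivBound_nonneg (v := p) hG
    have h2 := boundaryTerm_nonneg (p := p) hG X.K0 (Nat.zero_le _)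
    have h3 := boundaryTerm_nonneg (p := p) hG X.KN (le_refl G.N)
    linarith
  have hresP : ∀ n ≤ G.N, θ * B (X.backMap Q u G ey ep (G.N - n) - ep n) ≤ μ₀ * loc := by
    intro n hn
    have h1 := backMap_exact_sub_le hr hX hstd hqb hqb2 hstart hend hstab hdamp hγ0 hγ hlo hκ hQ
      hGam hscal hρ hD hΛp' hG hTs hpT hy hp hy' hp' hnear0 hL0 hΛbd
      (fun n h1 h2 => (hsup n h1 h2).2) (G.N - n) (Nat.sub_le _ _)
    rw [show G.N - (G.N - n) = n by omega, ← localBound_eq] at h1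
    exact (mul_le_of_le_one_left (apply_nonneg _ _) hθ1).trans h1
  have hloc0 : μ₀ * loc ≤ 1 / 2 * (θ * ε) :=
    (mul_le_mul_of_nonneg_left hlocle hμ₀).trans hH3
  have hloc_nonneg : 0 ≤ loc := by
    rw [hloc, localBound_eq]
    have h0 := derivBound_nonneg (v := y) hG
    have h1 := derivBound_nonneg (v := p) hG
    have h2 := boundaryTerm_nonneg (p := p) hG X.K0 (Nat.zero_le _)
    have h3 := boundaryTerm_nonneg (p := p) hG X.KN (le_refl G.N)
    positivity
  obtain ⟨Y, P, hsol, herr, hbound, huniq⟩ := exists_unique_fixedPoint_near G.N A B hA0 hB0 hθ0 hθ1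
    hε0.le (mul_nonneg hμ₀ hloc_nonneg) hloc0 (X.stateMap Q u G)
    (fun Y P n => X.backMap Q u G Y P (G.N - n)) ey ep
    (fun Y P Y' P' D hD0 h h' hdist => hcontr Y P Y' P' D hD0 (hnear Y P h) (hnear Y' P' h') hdist)
    (fun n hn => ⟨hresY n hn, hresP n hn⟩)
  refine ⟨Y, P, (isDiscreteSolution_iff hX Q u hN Y P).2 hsol,
    max_le (Grid.maxOver_le fun n hn => (herr n hn).1)
      (Grid.maxOver_le fun n hn => (herr n hn).2), fun Y' P' hsol' herr' => ?_, ?_⟩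
  · exact huniq Y' P' ((isDiscreteSolution_iff hX Q u hN Y' P').1 hsol') fun n hn =>
      ⟨(G.le_maxOver (fun n => ‖stageMul W⁻¹ (Y' n - X.exact G y n)‖) hn).trans
        ((le_max_left _ _).trans herr'),
       (G.le_maxOver (fun n => ∑ i, ‖stageMul (X.Wdag W)⁻¹ (P' n - X.exact G p n) i‖) hn).trans
        ((le_max_right _ _).trans herr')⟩
  · have hbig : ∀ x, θ * x ≤ 2 * (μ₀ * loc) → x ≤ (8 * c * μ₀ + 1) * loc := fun x hx => by
      have h1 := mul_le_mul_of_nonneg_left hx (by positivity : 0 ≤ 4 * c)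
      rw [← mul_assoc, mul_comm (4 * c) θ, hθc, one_mul] at h1
      linarith
    refine max_le (Grid.maxOver_le fun n hn => hbig _ ?_) (Grid.maxOver_le fun n hn => hbig _ ?_)
    · exact (mul_le_of_le_one_left (norm_nonneg _) hθ1).trans (hbound n hn).1
    · exact (hbound n hn).2

end PeerTriplet

theorem lemma5 {s : ℕ} (hs : 3 ≤ s) (X : PeerTriplet s) (W : Matrix (Fin s) (Fin s) ℝ)
    (σlo σhi : ℝ) (qb : ℕ) (hσlo : 0 < σlo) (hσlo1 : σlo < 1) (hσhi : 1 < σhi)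
    (hqb : s - 1 - 1 ≤ qb) (hqb2 : qb ≤ 2)
    (hstruct : X.Structural)
    (hstd : X.StandardOrder (s - 1) (s - 1))
    (hstart : X.StartOrder (s - 1) (s - 1) qb)
    (hend : X.EndOrder (s - 1) (s - 1) qb)
    (hstab : X.UniformlyZeroStable W σlo σhi)
    (hdamp : ∃ γ < 1, X.UniformlyDamped W σlo σhi γ) :
    ∃ ζy > 0, ∃ ζp > 0, ∃ ζy' > 0, ∃ ζp' > 0,
      ((∀ σ > 0, X.supState (s - 1) σ = 0 ∧ X.supAdjoint (s - 1) σ = 0) →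
        ∀ T > 0, ∃ μ > 0,
          X.SuperConvergent W σlo σhi ζy ζp ζy' ζp' T μ (fun _ => True)) ∧
      ((X.supState (s - 1) 1 = 0 ∧ X.supAdjoint (s - 1) 1 = 0) →
        ∀ T > 0, ∀ L > 0, ∃ μ > 0,
          X.SuperConvergent W σlo σhi ζy ζp ζy' ζp' T μ (Grid.Smooth L)) := by
  obtain ⟨r, rfl⟩ : ∃ r, s = r + 1 := ⟨s - 1, by omega⟩
  simp only [Nat.add_sub_cancel] at hqb hstd hstart hend ⊢
  have hr : 2 ≤ r := by omega
  obtain ⟨γ, hγ, hdamp⟩ := hdamp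
  have hγ0 : 0 ≤ γ := (rowSumNorm_nonneg _).trans (hdamp 1 ⟨hσlo1.le, hσhi.le⟩).1
  obtain ⟨κ, hκ⟩ := X.exists_boundedBy hstruct.2.1 hstab
  set c : ℝ := max 1 (PeerTriplet.lipConst r κ γ) with hc
  have hc1 : 1 ≤ c := le_max_left _ _
  have hζ : 0 < 4 * c ^ 2 := by positivity
  have hμ : ∀ T > 0, ∀ L : ℝ, 0 ≤ L →
      0 < 8 * c * PeerTriplet.residualConst r κ γ T L (1 / (8 * c ^ 2 * T)) + 1 := by
    intro T hT L hL
    have := PeerTriplet.residualConst_nonneg (r := r) hγ hκ.nonneg hT.le hL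
      (by positivity : 0 ≤ 1 / (8 * c ^ 2 * T))
    positivity
  refine ⟨4 * c ^ 2, hζ, 4 * c ^ 2, hζ, 4 * c ^ 2, hζ, 4 * c ^ 2, hζ, fun h T hT => ?_,
    fun h T hT L hL => ?_⟩
  · refine ⟨_, hμ T hT 0 le_rfl, PeerTriplet.superConvergent_of_residual_le hr hstruct hstd hqb hqb2
      hstart hend hstab hdamp hγ0 hγ hσlo hκ hc1 (le_max_right _ _) hT le_rfl _ ?_⟩
    intro G Tstar H hG _ n h1 h2
    have hpos : ∀ k, 1 ≤ k → k ≤ G.N → 0 < G.ratio k := fun k hk1 hk2 =>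
      hσlo.trans_le (hG.2.2.2.2.1 k hk1 hk2).1
    rw [(h _ (hpos n h1 h2.le)).1, (h _ (hpos (n + 1) (by omega) h2)).2]
    simp
  · obtain ⟨L₁, hL₁0, hL₁⟩ := X.exists_abs_supState_le (by omega) hstd hσlo hσlo1 hσhi h.1
    obtain ⟨L₂, hL₂0, hL₂⟩ := X.exists_abs_supAdjoint_le (by omega) hstd hσlo hσlo1 hσhi h.2
    have hσhi0 : 0 < σhi := by linarith
    have hL' : 0 ≤ L₁ * L + L₂ * (L * σhi) := by positivity
    refine ⟨_, hμ T hT _ hL', PeerTriplet.superConvergent_of_residual_le hr hstruct hstd hqb hqb2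
      hstart hend hstab hdamp hγ0 hγ hσlo hκ hc1 (le_max_right _ _) hT hL' _ ?_⟩
    intro G Tstar H hG hsm n h1 h2
    have hh := hG.2.1 n h2.le
    have hnext : G.h (n + 1) ≤ σhi * G.h n := by
      have := (hG.2.2.2.2.1 (n + 1) (by omega) h2).2
      rwa [Grid.ratio, Nat.add_sub_cancel, div_le_iff₀ hh] at this
    have e1 : 0 ≤ L₁ * L * G.h n := by positivity
    have e2 : 0 ≤ L₂ * (L * σhi) * G.h n := by positivity
    constructor
    · have := (hL₁ _ (hG.2.2.2.2.1 n h1 h2.le)).trans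
        (mul_le_mul_of_nonneg_left (hsm n h1 h2.le) hL₁0)
      linarith
    · have h3 := (hL₂ _ (hG.2.2.2.2.1 (n + 1) (by omega) h2)).trans
        (mul_le_mul_of_nonneg_left (hsm (n + 1) (by omega) h2) hL₂0)
      have h4 : L₂ * (L * G.h (n + 1)) ≤ L₂ * (L * (σhi * G.h n)) := by gcongr
      linarith
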